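/- \textbf{Theorem.} Let $n,N\ge 0$ be integers. (1) \emph{(Smooth version.)} Let $M\subset\mathbb C^{n+1}$ and $M'\subset\mathbb C^{N+1}$ be $C^\infty$-smooth real hypersurfaces through $p$ and $p'$ respectively, and let $H\colon(\mathbb C^{n+1},p)\to(\mathbb C^{N+1},p')$ be a germ at $p$ of a holomorphic mapping such that $H(M)\subset M'$ (as germs). Let $r$ be the rank of the Levi form of $M'$ at $p'$; that is, if $\rho'$ is a smooth real-valued local defining function of $M'$ near $p'$ ($d\rho'\ne0$), $r$ is the rank of the restriction of the Hermitian form with matrix $\bigl(\partial^2\rho'/\partial Z_i\partial\bar Z_j(p')\bigr)$ to $\{c\in\mathbb C^{N+1}:\sum_j \frac{\partial\rho'}{\partial Z_j}(p')c_j=0\}$. Let $W_H$ be the analytic set of points at which the $(N+1)\times(n+1)$ Jacobian matrix $H_Z=(\partial H_i/\partial Z_j)$ has rank $<n+1$. If $2N-r\le 2n-2$ and the germ of $W_H$ at $p$ has codimension at least $2$ (in particular, if it is empty), then $H$ is transversal to $M'$ at $p$, i.e. $T_{p'}M'+dH(T_p\mathbb C^{n+1})=T_{p'}\mathbb C^{N+1}$.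 (2) \emph{(Formal version.)} Let $M$ and $M'$ be formal real hypersurfaces through $0$ in $\mathbb C^{n+1}$ and $\mathbb C^{N+1}$, given by formal power series $\rho\in\mathbb C[[Z,\xi]]$ and $\rho'\in\mathbb C[[Z',\xi']]$, respectively, which are real ($\rho(Z,\xi)=\bar\rho(\xi,Z)$, where the bar means conjugation of the coefficients), vanish at $0$, and have nonzero differential at $0$. Let $H\colon(\mathbb C^{n+1},0)\to(\mathbb C^{N+1},0)$ be a formal holomorphic mapping sending $M$ into $M'$, i.e. $\rho'(H(Z),\bar H(\xi))=a(Z,\xi)\rho(Z,\xi)$ for some $a\in\mathbb C[[Z,\xi]]$. Let $r$ be the rank of the Levi form of $M'$ at $0$, i.e. the rank of the Hermitian form with matrix $\rho'_{Z'\xi'}(0,0)$ restricted to $\{c:\sum_j\rho'_{Z'_j}(0,0)c_j=0\}$. Assume that $2N-r\le 2n-2$, that at least one $(n+1)\times(n+1)$-minor of $H_Z$ is not identically zero, and that the not identically zero $(n+1)\times(n+1)$-minors of $H_Z$ have no nontrivial (i.e. non-unit) common divisor in $\mathbb C[[Z]]$. Then $H$ is transversal to $M'$ at $0$, i.e. $T_0M'+dH(T_0\mathbb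 C^{n+1})=T_0\mathbb C^{N+1}$, where $T_0M'=\{v\in\mathbb C^{N+1}:\operatorname{Re}\sum_j\rho'_{Z'_j}(0,0)v_j=0\}$. -/

import Mathlib

open Topology
open scoped ContDiff

noncomputable section

/-! ### The rank of a Hermitian form on a complex hyperplane, and minors -/

/-- The form `(x, y) ↦ ∑ i j, A i j * x i * conj (y j)` on `ℂ^m`. -/
def hermForm {m : ℕ} (A : Matrix (Fin m) (Fin m) ℂ) :
    (Fin m → ℂ) →ₗ[ℂ] (Fin m → ℂ) →ₛₗ[starRingEnd ℂ] ℂ :=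
  LinearMap.mk₂'ₛₗ (RingHom.id ℂ) (starRingEnd ℂ)
    (fun x y => ∑ i, ∑ j, A i j * x i * starRingEnd ℂ (y j))
    (fun x x' y => by
      simp only [Pi.add_apply, mul_add, add_mul, Finset.sum_add_distrib])
    (fun c x y => by
      simp only [Pi.smul_apply, smul_eq_mul, RingHom.id_apply, Finset.mul_sum]
      exact Finset.sum_congr rfl fun i _ => Finset.sum_congr rfl fun j _ => by ring)
    (fun x y y' => by
      simp only [Pi.add_apply, map_add, mul_add, Finset.sum_add_distrib])
    (fun c x y => by
      simp only [Pi.smul_apply, smul_eq_mul, map_mul, Finset.mul_sum]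
      exact Finset.sum_congr rfl fun i _ => Finset.sum_congr rfl fun j _ => by ring)

/-- The subspace of all `v ∈ ℂ^m` with `∑ j, c j * v j = 0`. -/
def annihilatedBy {m : ℕ} (c : Fin m → ℂ) : Submodule ℂ (Fin m → ℂ) where
  carrier := {v | ∑ j, c j * v j = 0}
  add_mem' := fun {v w} hv hw => by
    simp only [Set.mem_ofPred_eq, Pi.add_apply, mul_add, Finset.sum_add_distrib] at *
    rw [hv, hw, add_zero]
  zero_mem' := by simp
  smul_mem' := fun t v hv => by
    simp only [Set.mem_ofPred_eq, Pi.smul_apply, smul_eq_mul] at *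
    have : ∑ j, c j * (t * v j) = t * ∑ j, c j * v j := by
      rw [Finset.mul_sum]
      exact Finset.sum_congr rfl fun j _ => by ring
    rw [this, hv, mul_zero]

/-- The rank of the restriction of the form given by `A` to the subspace
`{v | ∑ j, c j * v j = 0}`. -/
def restrictedRank {m : ℕ} (A : Matrix (Fin m) (Fin m) ℂ) (c : Fin m → ℂ) : ℕ :=
  Module.finrank ℂ
    (LinearMap.range ((hermForm A).domRestrict₁₂ (annihilatedBy c) (annihilatedBy c)))

/-! ### Smooth real hypersurfaces in `ℂ^m` and germs of holomorphic maps -/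

/-- `∂f/∂Z_j = (∂f/∂x_j - i ∂f/∂y_j) / 2`. -/
def wirtinger {m : ℕ} (j : Fin m) (f : (Fin m → ℂ) → ℂ) (p : Fin m → ℂ) : ℂ :=
  (fderiv ℝ f p (Pi.single j 1) - Complex.I * fderiv ℝ f p (Pi.single j Complex.I)) / 2

/-- `∂f/∂Z̄_j = (∂f/∂x_j + i ∂f/∂y_j) / 2`. -/
def wirtingerBar {m : ℕ} (j : Fin m) (f : (Fin m → ℂ) → ℂ) (p : Fin m → ℂ) : ℂ :=
  (fderiv ℝ f p (Pi.single j 1) + Complex.I * fderiv ℝ f p (Pi.single j Complex.I)) / 2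

/-- `ρ` is a smooth local defining function of `M` near the point `p`: on some open
neighbourhood `U` of `p`, `M` is the zero set of `ρ`, and `dρ ≠ 0` along `M`. -/
def IsLocalDefiningFunction {m : ℕ} (M : Set (Fin m → ℂ)) (p : Fin m → ℂ)
    (ρ : (Fin m → ℂ) → ℝ) : Prop :=
  ∃ U : Set (Fin m → ℂ), IsOpen U ∧ p ∈ U ∧ ContDiffOn ℝ ∞ ρ U ∧
    (∀ z ∈ U, z ∈ M ↔ ρ z = 0) ∧ (∀ z ∈ U, z ∈ M → fderiv ℝ ρ z ≠ 0)

/-- `M` is a smooth real hypersurface in `ℂ^m`. -/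
def IsSmoothRealHypersurface {m : ℕ} (M : Set (Fin m → ℂ)) : Prop :=
  ∀ p ∈ M, ∃ ρ : (Fin m → ℂ) → ℝ, IsLocalDefiningFunction M p ρ

/-- The rank at `p` of the Levi form of the real hypersurface with local defining function
`ρ`: the rank of `(∂²ρ/∂Z_i∂Z̄_j (p))` restricted to `T^{(1,0)}_p`, i.e. to the space of all
`c` with `∑ j, ∂ρ/∂Z_j (p) * c j = 0`. -/
def leviRank {m : ℕ} (ρ : (Fin m → ℂ) → ℝ) (p : Fin m → ℂ) : ℕ :=
  restrictedRank
    (Matrix.of fun i j => wirtinger i (wirtingerBar j fun z => (ρ z : ℂ)) p)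
    (fun j => wirtinger j (fun z => (ρ z : ℂ)) p)

/-- The holomorphic Jacobian matrix `H_Z` of `H` at `z`. -/
def jacobianMatrix {m k : ℕ} (H : (Fin m → ℂ) → (Fin k → ℂ)) (z : Fin m → ℂ) :
    Matrix (Fin k) (Fin m) ℂ :=
  Matrix.of fun i j => fderiv ℂ H z (Pi.single j 1) i

/-- The set `W_H` of all points at which `H_Z` has rank less than `m`. -/
def degeneracyLocus {m k : ℕ} (H : (Fin m → ℂ) → (Fin k → ℂ)) : Set (Fin m → ℂ) :=
  {z | (jacobianMatrix H z).rank < m}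

/-- The germ at `p` of the analytic set `W ⊆ ℂ^m` has codimension at least `k`: either the germ
is empty, or `p` is an isolated point of `W ∩ (p + L)` for some complex linear subspace `L` of
dimension `k`. (The dimension of an analytic germ is the least number of linear equations
cutting it down to an isolated point.) -/
def GermCodimAtLeast {m : ℕ} (W : Set (Fin m → ℂ)) (p : Fin m → ℂ) (k : ℕ) : Prop :=
  (∀ᶠ z in 𝓝 p, z ∉ W) ∨
    ∃ L : Submodule ℂ (Fin m → ℂ), Module.finrank ℂ L = k ∧
      ∀ᶠ z in 𝓝 p, z ∈ W → z - p ∈ L → z = p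

/-- `T_{H(p)} M' + dH(T_p ℂ^m) = T_{H(p)} ℂ^k`, where `ρ'` is a local defining function at `H p`
of `M'`, so that `T_{H(p)} M'` is the kernel of `dρ'`. -/
def IsTransversalAt {m k : ℕ} (H : (Fin m → ℂ) → (Fin k → ℂ)) (p : Fin m → ℂ)
    (ρ' : (Fin k → ℂ) → ℝ) : Prop :=
  LinearMap.ker (fderiv ℝ ρ' (H p)).toLinearMap ⊔
    LinearMap.range (fderiv ℝ H p).toLinearMap = ⊤

/-! ### Formal real hypersurfaces through `0` in `ℂ^m` and formal holomorphic maps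

Power series in `(Z, ξ)` are indexed by `Fin m ⊕ Fin m`: `Sum.inl` for `Z`, `Sum.inr` for `ξ`. -/

/-- The series `ū(ξ, Z)`, where `ū` has the conjugate coefficients of `u(Z, ξ)`. -/
def hermConj {m : ℕ} (u : MvPowerSeries (Fin m ⊕ Fin m) ℂ) :
    MvPowerSeries (Fin m ⊕ Fin m) ℂ :=
  MvPowerSeries.rename Sum.swap (MvPowerSeries.map (starRingEnd ℂ) u)

/-- The gradient `ρ_Z(0, 0)`. -/
def formalGradient {m : ℕ} (ρ : MvPowerSeries (Fin m ⊕ Fin m) ℂ) (j : Fin m) : ℂ :=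
  MvPowerSeries.constantCoeff (MvPowerSeries.pderiv ℂ (Sum.inl j) ρ)

/-- `ρ(Z, ξ)` defines a formal real hypersurface through `0` in `ℂ^m`: it is real
(`ρ(Z, ξ) = ρ̄(ξ, Z)`), vanishes at `0`, and `dρ(0) ≠ 0`; by reality the last condition means
`ρ_Z(0, 0) ≠ 0`. -/
structure IsFormalDefiningSeries {m : ℕ} (ρ : MvPowerSeries (Fin m ⊕ Fin m) ℂ) : Prop where
  real : hermConj ρ = ρ
  zero : MvPowerSeries.constantCoeff ρ = 0
  grad : formalGradient ρ ≠ 0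

/-- The rank at `0` of the Levi form of the formal hypersurface given by `ρ`. -/
def formalLeviRank {m : ℕ} (ρ : MvPowerSeries (Fin m ⊕ Fin m) ℂ) : ℕ :=
  restrictedRank
    (Matrix.of fun i j => MvPowerSeries.constantCoeff
      (MvPowerSeries.pderiv ℂ (Sum.inl i) (MvPowerSeries.pderiv ℂ (Sum.inr j) ρ)))
    (formalGradient ρ)

/-- The pair `(H(Z), H̄(ξ))`, a family of power series in `(Z, ξ)`. -/
def complexifiedMap {m k : ℕ} (H : Fin k → MvPowerSeries (Fin m) ℂ) :
    Fin k ⊕ Fin k → MvPowerSeries (Fin m ⊕ Fin m) ℂ :=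
  Sum.elim (fun i => MvPowerSeries.rename Sum.inl (H i))
    (fun i => MvPowerSeries.rename Sum.inr (MvPowerSeries.map (starRingEnd ℂ) (H i)))

/-- `H` (without constant terms) sends the formal hypersurface given by `ρ` into the one given by
`ρ'`: `ρ'(H(Z), H̄(ξ)) = a(Z, ξ) ρ(Z, ξ)` for some power series `a`. -/
def FormallyMapsInto {m k : ℕ} (H : Fin k → MvPowerSeries (Fin m) ℂ)
    (ρ : MvPowerSeries (Fin m ⊕ Fin m) ℂ) (ρ' : MvPowerSeries (Fin k ⊕ Fin k) ℂ) : Prop :=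
  ∃ a : MvPowerSeries (Fin m ⊕ Fin m) ℂ,
    MvPowerSeries.subst (complexifiedMap H) ρ' = a * ρ

/-- The formal Jacobian matrix `H_Z`. -/
def formalJacobian {m k : ℕ} (H : Fin k → MvPowerSeries (Fin m) ℂ) :
    Matrix (Fin k) (Fin m) (MvPowerSeries (Fin m) ℂ) :=
  Matrix.of fun i j => MvPowerSeries.pderiv ℂ j (H i)

/-- The maximal (`m × m`) minor of `H_Z` on the rows selected by `e`. -/
def formalMinor {m k : ℕ} (H : Fin k → MvPowerSeries (Fin m) ℂ) (e : Fin m ↪o Fin k) :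
    MvPowerSeries (Fin m) ℂ :=
  ((formalJacobian H).submatrix e id).det

/-- The real tangent space at `0` of the formal hypersurface given by `ρ`, i.e. the kernel of
`dρ(0) = 2 Re (∑ j, ρ_{Z_j}(0) dZ_j)`. -/
def formalTangentSpace {m : ℕ} (ρ : MvPowerSeries (Fin m ⊕ Fin m) ℂ) :
    Submodule ℝ (Fin m → ℂ) where
  carrier := {v | (∑ j, formalGradient ρ j * v j).re = 0}
  add_mem' := fun {v w} hv hw => by
    simp only [Set.mem_ofPred_eq, Pi.add_apply, mul_add, Finset.sum_add_distrib,
      Complex.add_re] at *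
    rw [hv, hw, add_zero]
  zero_mem' := by simp
  smul_mem' := fun t v hv => by
    simp only [Set.mem_ofPred_eq, Pi.smul_apply, Complex.real_smul] at *
    have : ∑ j, formalGradient ρ j * ((t : ℂ) * v j)
        = (t : ℂ) * ∑ j, formalGradient ρ j * v j := by
      rw [Finset.mul_sum]
      exact Finset.sum_congr rfl fun j _ => by ring
    rw [this, Complex.re_ofReal_mul, hv, mul_zero]

/-- `T_0 M' + dH(T_0 ℂ^m) = T_0 ℂ^k` for a formal map `H` and the formal hypersurface `M'` given
by `ρ'`. -/
def IsFormallyTransversal {m k : ℕ} (H : Fin k → MvPowerSeries (Fin m) ℂ)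
    (ρ' : MvPowerSeries (Fin k ⊕ Fin k) ℂ) : Prop :=
  formalTangentSpace ρ' ⊔
    (LinearMap.range
      ((formalJacobian H).map MvPowerSeries.constantCoeff).mulVecLin).restrictScalars ℝ = ⊤

end

noncomputable section

/-! ### Power series rings over a field are factorial -/

namespace MvPowerSeries

/-! Formal version. Write `ρ'(H(Z), H̄(ξ)) = a ρ`. Differentiating at `0` shows that failure of
transversality forces `a(0) = 0`. Since `ρ = 0` can be solved for one variable, its coordinate ring
is a power series ring, hence factorial, and the restriction of `a` is zero or has an irreducible
factor `q`. Dividing by `q` (by `0` in the first case) and passing to the fraction field gives a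
field-valued point `φ` at which `ρ = a = 0` (`exists_field_ringHom_ker`).

At `φ` the `Z`-derivative of the identity gives `H_Zᵀ ρ'_{Z'} = 0`, and the mixed derivative gives
`H_Zᵀ ρ'_{Z'ξ'} H̄_ξ = a_Z ρ_ξᵀ + ρ_Z a_ξᵀ`, of rank at most `2`. Both Jacobians have full rank at
`φ`: otherwise `q` would divide all maximal minors modulo `ρ`, and restriction to a section of `ρ =
0` over the `Z`-space (or the `ξ`-space) would turn `q` into a nonunit common divisor of the minors.
The bordered matrix `(ρ'_{Z'} | ρ'_{Z'ξ'})` has rank at least `r + 1` at `0`, hence also at `φ`. Two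
applications of Sylvester's inequality give `2(n+1) + (r+1) ≤ 2(N+1) + 2`, that is `2N - r ≥ 2n -
1`, a contradiction (`formalLeviRank_le_of_field_ringHom`).

Smooth version. Everything is replaced by its Taylor series in `z` and `z̄`. A smooth function
vanishing on `M` has a Taylor series divisible by that of `ρ` (`dvd_of_hasTaylor_of_eq_zero`), so
the formal theorem applies once the Taylor series of the minors are known to have no common nonunit
divisor `d`. No convergence of `d` is needed: truncation gives, for every `K`, polynomials with
`D(0) = 0` such that each minor is a multiple of `D(z - p)` up to `O(‖z - p‖ ^ K)`. Codimension two
allows restriction to a plane where the minors have at most an isolated common zero. There a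
Łojasiewicz inequality (`exists_mul_pow_norm_fst_le`) bounds them below by a power of `|x|`, while
`D(x, ·)` has a zero near the origin at which all of them are too small when `K` is large. -/

instance isDomain_of_isDomain {σ R : Type*} [CommRing R] [IsDomain R] :
    IsDomain (MvPowerSeries σ R) :=
  NoZeroDivisors.to_isDomain _

section Maximal

variable {σ K : Type*} [Field K]

theorem mem_span_range_X_of_constantCoeff_eq_zero [Finite σ] {f : MvPowerSeries σ K}
    (hf : constantCoeff f = 0) : f ∈ Ideal.span (Set.range (X : σ → MvPowerSeries σ K)) := by
  classical
  cases nonempty_fintype σ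
  have hne : ∀ x : σ →₀ ℕ, x ≠ 0 → ∃ i, x i ≠ 0 := fun x hx => Finsupp.ne_iff.1 hx
  by_cases hσ : IsEmpty σ
  · have : f = 0 := by
      ext x
      rw [Subsingleton.elim x 0, coeff_zero_eq_constantCoeff_apply, hf, map_zero]
    exact this ▸ Ideal.zero_mem _
  rw [not_isEmpty_iff] at hσ
  choose! idx hidx using hne
  -- Each nonzero exponent is charged to one variable `idx` occurring in it, which splits `f` into
  -- multiples of the variables without overlap.
  let g : σ → MvPowerSeries σ K := fun i y =>
    if idx (y + Finsupp.single i 1) = i then coeff (y + Finsupp.single i 1) f else 0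
  have hg : ∀ i y, coeff y (g i) =
      if idx (y + Finsupp.single i 1) = i then coeff (y + Finsupp.single i 1) f else 0 :=
    fun _ _ => rfl
  have hfg : f = ∑ i, X i * g i := by
    ext x
    rw [map_sum]
    by_cases hx : x = 0
    · subst hx
      simp only [coeff_zero_eq_constantCoeff]
      simpa using hf
    rw [Finset.sum_eq_single (idx x)]
    · have hle : Finsupp.single (idx x) 1 ≤ x :=
        Finsupp.single_le_iff.2 (Nat.one_le_iff_ne_zero.2 (hidx x hx))
      rw [X, coeff_monomial_mul, if_pos hle, one_mul, hg, tsub_add_cancel_of_le hle, if_pos rfl]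
    · intro i _ hi
      rw [X, coeff_monomial_mul]
      split_ifs with hle
      · rw [hg, tsub_add_cancel_of_le hle, if_neg (Ne.symm hi), mul_zero]
      · rfl
    · simp
  rw [hfg]
  exact Ideal.sum_mem _ fun i _ => Ideal.mul_mem_right _ _ (Ideal.subset_span ⟨i, rfl⟩)

theorem mem_maximalIdeal_iff {f : MvPowerSeries σ K} :
    f ∈ IsLocalRing.maximalIdeal (MvPowerSeries σ K) ↔ constantCoeff f = 0 := by
  rw [IsLocalRing.mem_maximalIdeal, mem_nonunits_iff, isUnit_iff_constantCoeff, isUnit_iff_ne_zero,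
    not_not]

theorem maximalIdeal_eq_span_range_X [Finite σ] :
    IsLocalRing.maximalIdeal (MvPowerSeries σ K) =
      Ideal.span (Set.range (X : σ → MvPowerSeries σ K)) := by
  apply le_antisymm
  · intro f hf
    exact mem_span_range_X_of_constantCoeff_eq_zero (mem_maximalIdeal_iff.1 hf)
  · rw [Ideal.span_le]
    rintro _ ⟨i, rfl⟩
    exact mem_maximalIdeal_iff.2 (constantCoeff_X i)

/-- Weierstrass preparation and division are used below with a power series ring as coefficient
ring, which must be adically complete for this. -/
instance isAdicComplete_maximalIdeal [Finite σ] :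
    IsAdicComplete (IsLocalRing.maximalIdeal (MvPowerSeries σ K)) (MvPowerSeries σ K) := by
  rw [maximalIdeal_eq_span_range_X]
  infer_instance

end Maximal

end MvPowerSeries

open Polynomial in
-- Modulo `I` the polynomial `P` becomes a power of the prime `X`, so a monic divisor also becomes a
-- power of `X`.
theorem Polynomial.IsDistinguishedAt.of_dvd {R : Type*} [CommRing R] {I : Ideal R} [I.IsPrime]
    {P Q : R[X]} (hP : P.IsDistinguishedAt I) (hQ : Q.Monic) (hd : Q ∣ P) :
    Q.IsDistinguishedAt I := by
  refine ⟨⟨fun {i} hi => ?_⟩, hQ⟩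
  have h1 : Q.map (Ideal.Quotient.mk I) ∣ X ^ P.natDegree := by
    rw [← hP.map_eq_X_pow]
    exact Polynomial.map_dvd _ hd
  obtain ⟨j, -, hj⟩ := (dvd_prime_pow Polynomial.prime_X _).1 h1
  have hm : (Q.map (Ideal.Quotient.mk I)).Monic := hQ.map _
  have h2 : Q.map (Ideal.Quotient.mk I) = X ^ j :=
    eq_of_monic_of_associated hm (monic_X_pow j) hj
  have h3 : j = Q.natDegree := by
    have := congrArg natDegree h2
    rwa [hQ.natDegree_map, natDegree_X_pow, eq_comm] at this
  have h4 := congrArg (fun p => p.coeff i) h2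
  simp only [coeff_map, coeff_X_pow] at h4
  rw [if_neg (by omega)] at h4
  exact Ideal.Quotient.eq_zero_iff_mem.1 h4

open Polynomial in
/-- A prime ideal of `A⟦X⟧` containing a power series which is regular in `X` contains a prime
element. -/
theorem PowerSeries.exists_prime_mem_of_map_residue_ne_zero {A : Type*} [CommRing A] [IsDomain A]
    [IsLocalRing A] [IsAdicComplete (IsLocalRing.maximalIdeal A) A] [UniqueFactorizationMonoid A]
    (I : Ideal (PowerSeries A)) [hI : I.IsPrime] {f : PowerSeries A} (hf : f ∈ I)
    (hreg : f.map (IsLocalRing.residue A) ≠ 0) : ∃ q ∈ I, Prime q := by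
  obtain ⟨P, h, H⟩ := PowerSeries.exists_isWeierstrassFactorization hreg
  have hPI : (P : PowerSeries A) ∈ I := by
    have := hf
    rw [H.eq_mul] at this
    refine (hI.mem_or_mem this).resolve_right fun hh => ?_
    exact hI.ne_top (Ideal.eq_top_of_isUnit_mem _ hh H.isUnit)
  let J : Ideal A[X] := I.comap (Polynomial.coeToPowerSeries.ringHom)
  have hJ : J.IsPrime := Ideal.comap_isPrime _ _
  have hPJ : P ∈ J := by simpa [J] using hPI
  obtain ⟨Q, hQd, hQJ, hQp⟩ : ∃ Q, Q ∣ P ∧ Q ∈ J ∧ Prime Q := by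
    obtain ⟨s, hs, u, hu⟩ := UniqueFactorizationMonoid.exists_prime_factors P
      H.isDistinguishedAt.monic.ne_zero
    have : s.prod ∈ J := by
      have h1 : s.prod * u ∈ J := by rwa [hu]
      exact (hJ.mem_or_mem h1).resolve_right fun hh =>
        hJ.ne_top (Ideal.eq_top_of_isUnit_mem _ hh u.isUnit)
    obtain ⟨Q, hQs, hQJ⟩ := (hJ.multiset_prod_mem_iff_exists_mem s).1 this
    exact ⟨Q, (Multiset.dvd_prod hQs).trans ⟨u, hu.symm⟩, hQJ, hs Q hQs⟩
  -- A divisor of the monic `P` has a unit as leading coefficient, so `Q` can be made monic.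
  have hlc : IsUnit Q.leadingCoeff := by
    obtain ⟨T, hT⟩ := hQd
    have := congrArg leadingCoeff hT
    rw [leadingCoeff_mul, H.isDistinguishedAt.monic.leadingCoeff] at this
    exact .of_mul_eq_one _ this.symm
  obtain ⟨u, hu⟩ := hlc
  let Q' : A[X] := Q * Polynomial.C (↑u⁻¹ : A)
  have hCu : IsUnit (Polynomial.C (↑u⁻¹ : A)) := (u⁻¹).isUnit.map Polynomial.C
  have hass : Associated Q Q' := (associated_mul_unit_right Q _ hCu)
  have hmon : Q'.Monic := by
    rw [Monic, leadingCoeff_mul, leadingCoeff_C, ← hu, Units.mul_inv]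
  have hdist : Q'.IsDistinguishedAt (IsLocalRing.maximalIdeal A) :=
    H.isDistinguishedAt.of_dvd hmon (hass.symm.dvd.trans hQd)
  have hprime : Prime Q' := hass.prime hQp
  refine ⟨Q', ?_, ?_⟩
  · have : Q' ∈ J := Ideal.mul_mem_right _ _ hQJ
    simpa [J] using this
  have hne : (Q' : PowerSeries A) ≠ 0 := by
    simpa using hmon.ne_zero
  rw [← Ideal.span_singleton_prime hne, ← Ideal.Quotient.isDomain_iff_prime]
  -- For distinguished `Q'`, Weierstrass division identifies `A[X] ⧸ (Q')` with `A⟦X⟧ ⧸ (Q')`, so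
  -- primality carries over.
  have : IsDomain (A[X] ⧸ Ideal.span {Q'}) := by
    rw [Ideal.Quotient.isDomain_iff_prime, Ideal.span_singleton_prime hmon.ne_zero]
    exact hprime
  exact hdist.algEquivQuotient.symm.toMulEquiv.isDomain _

namespace MvPowerSeries

section Coordinates

variable {K : Type*} [Field K] {n : ℕ}

/-- The images of the variables under the substitution `X₀ ↦ b X₀`, `X_{i+1} ↦ X_{i+1} + a_i X₀`. -/
def shear (b : K) (a : Fin n → K) : Fin (n + 1) → MvPowerSeries (Fin (n + 1)) K :=
  Fin.cons (C b * X 0) fun i => X i.succ + C (a i) * X 0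

theorem shear_zero (b : K) (a : Fin n → K) : shear b a 0 = C b * X 0 := rfl

theorem shear_succ (b : K) (a : Fin n → K) (i : Fin n) :
    shear b a i.succ = X i.succ + C (a i) * X 0 := rfl

theorem hasSubst_shear (b : K) (a : Fin n → K) : HasSubst (shear b a) :=
  hasSubst_of_constantCoeff_zero fun i => by
    refine Fin.cases ?_ (fun i => ?_) i <;> simp [shear]

theorem subst_shear_subst_shear {b : K} (hb : b ≠ 0) (a : Fin n → K)
    (f : MvPowerSeries (Fin (n + 1)) K) :
    subst (shear b⁻¹ fun i => -(a i * b⁻¹)) (subst (shear b a) f) = f := by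
  have hC : ∀ (c : K) (s : Fin (n + 1) → MvPowerSeries (Fin (n + 1)) K),
      subst s (C c : MvPowerSeries (Fin (n + 1)) K) = C c := fun c s => subst_C c
  rw [subst_comp_subst_apply (hasSubst_shear _ _) (hasSubst_shear _ _)]
  have : (fun s => subst (shear b⁻¹ fun i => -(a i * b⁻¹)) (shear b a s)) = X := by
    have hs := hasSubst_shear b⁻¹ fun i => -(a i * b⁻¹)
    funext i
    refine Fin.cases ?_ (fun i => ?_) i
    · rw [shear_zero, subst_mul hs, subst_X hs, hC, shear_zero, ← mul_assoc, ← map_mul, mul_inv_cancel₀ hb,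
        map_one, one_mul]
    · rw [shear_succ, subst_add hs, subst_mul hs, subst_X hs, subst_X hs, hC, shear_zero, shear_succ,
        map_neg, map_mul]
      ring
  rw [this, subst_self]
  rfl

/-- The linear change of coordinates `X₀ ↦ b X₀`, `X_{i+1} ↦ X_{i+1} + a_i X₀`. -/
def shearEquiv {b : K} (hb : b ≠ 0) (a : Fin n → K) :
    MvPowerSeries (Fin (n + 1)) K ≃+* MvPowerSeries (Fin (n + 1)) K where
  toFun := subst (shear b a)
  invFun := subst (shear b⁻¹ fun i => -(a i * b⁻¹))
  left_inv := subst_shear_subst_shear hb a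
  right_inv f := by
    have := subst_shear_subst_shear (inv_ne_zero hb) (fun i => -(a i * b⁻¹)) f
    simpa [mul_assoc, hb] using this
  map_mul' f g := subst_mul (hasSubst_shear b a) f g
  map_add' f g := subst_add (hasSubst_shear b a) f g

/-- Killing all variables but `X 0` turns the image of each variable into a scalar multiple of `X
0`, so a monomial contributes to `X 0 ^ k` only in degree `k`. -/
theorem coeff_single_zero_prod_shear (b : K) (a : Fin n → K) (d : Fin (n + 1) →₀ ℕ) (k : ℕ) :
    coeff (Finsupp.single 0 k) (d.prod fun s e => shear b a s ^ e) =
      if d.degree = k then d.prod fun s e => (Fin.cons b a : Fin (n + 1) → K) s ^ e else 0 := by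
  let e : Unit ↪ Fin (n + 1) := ⟨fun _ => 0, fun _ _ _ => rfl⟩
  have h1 : ∀ p : MvPowerSeries (Fin (n + 1)) K, coeff (Finsupp.single 0 k) p =
      coeff (Finsupp.single () k) (killCompl e p) := by
    intro p
    rw [coeff_killCompl, Finsupp.embDomain_single]
    rfl
  have h2 : ∀ s, killCompl e (shear b a s) = C ((Fin.cons b a : Fin (n + 1) → K) s) * X () := by
    have h0 : killCompl e (X 0 : MvPowerSeries (Fin (n + 1)) K) = X () := killCompl_X (R := K) (e := e) ()
    intro s
    refine Fin.cases ?_ (fun i => ?_) s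
    · simp [shear, h0, killCompl_C]
    · have : killCompl e (X i.succ : MvPowerSeries (Fin (n + 1)) K) = 0 := by
        apply killCompl_X_eq_zero
        rintro ⟨_, h⟩
        exact (Fin.succ_ne_zero i) h.symm
      simp [shear, h0, this, killCompl_C]
  have h3 : ∀ c : K, ∀ j : ℕ, coeff (Finsupp.single () k) (C c * (X () : MvPowerSeries Unit K) ^ j)
      = if j = k then c else 0 := by
    intro c j
    classical
    rw [coeff_C_mul, coeff_X_pow]
    by_cases h : j = k
    · simp [h]
    · rw [if_neg, if_neg h, mul_zero]
      intro h'
      exact h (by simpa using (DFunLike.congr_fun h' ()).symm)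
  rw [h1, Finsupp.prod, map_prod]
  simp only [map_pow, h2, mul_pow]
  rw [Finset.prod_mul_distrib, Finset.prod_pow_eq_pow_sum]
  simp only [← map_pow]
  rw [← map_prod, h3]
  rfl

/-- This reduces regularity in `X 0` to the nonvanishing of a polynomial, the degree `k` part of
`f`, at the point `(b, a)`. -/
theorem coeff_single_zero_subst_shear (b : K) (a : Fin n → K) (f : MvPowerSeries (Fin (n + 1)) K)
    (k : ℕ) :
    coeff (Finsupp.single 0 k) (subst (shear b a) f) =
      MvPolynomial.eval (Fin.cons b a)
        (∑ d ∈ Finset.univ.finsuppAntidiag k, MvPolynomial.monomial d (coeff d f)) := by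
  classical
  rw [coeff_subst (hasSubst_shear b a)]
  simp only [coeff_single_zero_prod_shear, smul_eq_mul, map_sum, MvPolynomial.eval_monomial]
  rw [finsum_eq_sum_of_support_subset (s := Finset.univ.finsuppAntidiag k)]
  · refine Finset.sum_congr rfl fun d hd => ?_
    rw [if_pos]
    simpa [Finset.mem_finsuppAntidiag, Finsupp.degree_eq_sum] using hd
  · intro d hd
    simp only [Function.mem_support, ne_eq, mul_eq_zero, not_or, ite_eq_right_iff,
      Classical.not_imp] at hd
    simpa [Finset.mem_finsuppAntidiag, Finsupp.degree_eq_sum] using hd.2.1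

theorem exists_shear_map_residue_ne_zero [Infinite K] {f : MvPowerSeries (Fin (n + 1)) K}
    (hf : f ≠ 0) : ∃ (b : K) (hb : b ≠ 0) (a : Fin n → K),
      (finSuccEquiv K n (shearEquiv hb a f)).map
        (IsLocalRing.residue (MvPowerSeries (Fin n) K)) ≠ 0 := by
  classical
  obtain ⟨d₀, hd₀⟩ : ∃ d, coeff d f ≠ 0 := by
    by_contra! h
    exact hf (MvPowerSeries.ext h)
  set k := d₀.degree
  let p : MvPolynomial (Fin (n + 1)) K :=
    ∑ d ∈ Finset.univ.finsuppAntidiag k, MvPolynomial.monomial d (coeff d f)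
  have hp : p ≠ 0 := by
    intro h
    apply hd₀
    have := congrArg (MvPolynomial.coeff d₀) h
    simp only [p, MvPolynomial.coeff_sum, MvPolynomial.coeff_monomial, MvPolynomial.coeff_zero,
      Finset.sum_ite_eq'] at this
    rwa [if_pos] at this
    simp [Finset.mem_finsuppAntidiag, k, Finsupp.degree_eq_sum]
  -- The extra factor `X 0` forces the first coordinate of the chosen point to be nonzero, so that
  -- the shear is invertible. A point with nonzero value exists because `K` is infinite.
  have hpX : MvPolynomial.X 0 * p ≠ 0 := mul_ne_zero (MvPolynomial.X_ne_zero 0) hp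
  obtain ⟨v, hv⟩ : ∃ v, MvPolynomial.eval v (MvPolynomial.X 0 * p) ≠ 0 := by
    by_contra! h
    exact hpX (MvPolynomial.funext fun v => by simpa using h v)
  rw [map_mul, MvPolynomial.eval_X] at hv
  have hb := left_ne_zero_of_mul hv
  refine ⟨v 0, hb, Fin.tail v, fun h => ?_⟩
  have h1 := congrArg (PowerSeries.coeff k) h
  rw [PowerSeries.coeff_map, map_zero, IsLocalRing.residue_eq_zero_iff,
    mem_maximalIdeal_iff, ← coeff_zero_eq_constantCoeff_apply, coeff_coeff_finSuccEquiv] at h1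
  have h2 : Finsupp.cons k (0 : Fin n →₀ ℕ) = Finsupp.single 0 k := by
    ext i
    refine Fin.cases ?_ (fun i => ?_) i <;> simp
  rw [h2] at h1
  have h3 := coeff_single_zero_subst_shear (v 0) (Fin.tail v) f k
  rw [Fin.cons_self_tail] at h3
  exact right_ne_zero_of_mul hv (h3.symm.trans h1)

end Coordinates

/-- Induction on `n` by Kaplansky's criterion: every nonzero prime ideal must contain a prime
element. After a shear the ideal contains a series regular in `X 0`, and Weierstrass preparation
over the series in the other variables supplies the prime. -/
theorem uniqueFactorizationMonoid_fin (K : Type*) [Field K] [Infinite K] (n : ℕ) :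
    UniqueFactorizationMonoid (MvPowerSeries (Fin n) K) := by
  induction n with
  | zero => exact (isEmptyEquiv (Fin 0) K).symm.toMulEquiv.uniqueFactorizationMonoid inferInstance
  | succ n ih =>
    rw [UniqueFactorizationMonoid.iff_exists_prime_mem_of_isPrime]
    intro I hI hIp
    obtain ⟨f, hfI, hf⟩ := Submodule.exists_mem_ne_zero_of_ne_bot hI
    obtain ⟨b, hb, a, hreg⟩ := exists_shear_map_residue_ne_zero hf
    let φ : MvPowerSeries (Fin (n + 1)) K ≃+* PowerSeries (MvPowerSeries (Fin n) K) :=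
      (shearEquiv hb a).trans (finSuccEquiv K n).toRingEquiv
    have hp : (I.comap φ.symm).IsPrime := Ideal.comap_isPrime φ.symm I
    obtain ⟨q, hqI, hq⟩ := PowerSeries.exists_prime_mem_of_map_residue_ne_zero
      (I.comap φ.symm) (f := φ f) (by simpa using hfI) hreg
    exact ⟨φ.symm q, hqI, (MulEquiv.prime_iff φ.symm.toMulEquiv).2 hq⟩

instance uniqueFactorizationMonoid (σ K : Type*) [Finite σ] [Field K] [Infinite K] :
    UniqueFactorizationMonoid (MvPowerSeries σ K) := by
  cases nonempty_fintype σ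
  have := uniqueFactorizationMonoid_fin K (Fintype.card σ)
  exact (renameEquiv K (Fintype.equivFin σ)).symm.toMulEquiv.uniqueFactorizationMonoid this

end MvPowerSeries

end

noncomputable section

/-! ### Solving an equation for one variable, and the chain rule -/

namespace MvPowerSeries

theorem optionEquivLeft_rename_some {τ R : Type*} [Finite τ] [CommRing R] (f : MvPowerSeries τ R) :
    optionEquivLeft τ R (rename Option.some f) = PowerSeries.C f := by
  classical
  ext k x
  rw [coeff_coeff_optionEquivLeft, PowerSeries.coeff_C]
  split_ifs with hk
  · subst hk
    have : x.optionElim 0 = Finsupp.embDomain Function.Embedding.some x := by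
      ext i
      cases i with
      | none =>
        rw [Finsupp.optionElim_apply_none, Finsupp.embDomain_of_notMem_range]
        simp
      | some i =>
        rw [Finsupp.optionElim_apply_some]
        exact (Finsupp.embDomain_apply_self Function.Embedding.some x i).symm
    rw [this]
    exact coeff_embDomain_rename Function.Embedding.some f x
  · rw [map_zero]
    refine coeff_rename_eq_zero (f := Option.some) f ?_
    rintro ⟨y, hy⟩
    refine hk ?_
    have := DFunLike.congr_fun hy none
    rw [Finsupp.optionElim_apply_none] at this
    rw [← this]
    apply Finsupp.mapDomain_of_notMem_range
    simp

/-- If `ρ` has no constant term but contains the variable `X s` linearly, then `ρ = 0` can be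
solved for `X s`: modulo `ρ` every power series is congruent to a unique power series in the
remaining variables. -/
theorem exists_ringHom_ker_eq_span {σ K : Type*} [Finite σ] [Field K] (s : σ)
    {ρ : MvPowerSeries σ K} (h0 : constantCoeff ρ = 0) (h1 : coeff (Finsupp.single s 1) ρ ≠ 0) :
    ∃ π : MvPowerSeries σ K →+* MvPowerSeries {x // x ≠ s} K,
      (∀ f, π (rename Subtype.val f) = f) ∧ (∀ f, π f = 0 ↔ ρ ∣ f) ∧
      ∀ f, constantCoeff (π f) = constantCoeff f := by
  classical
  let τ := {x // x ≠ s}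
  let e : σ ≃ Option τ := (Equiv.optionSubtypeNe s).symm
  let E : MvPowerSeries σ K ≃+* PowerSeries (MvPowerSeries τ K) :=
    ((renameEquiv K e).trans (optionEquivLeft τ K)).toRingEquiv
  have hEC : ∀ f, E (rename Subtype.val f) = PowerSeries.C f := by
    intro f
    have h : e ∘ (Subtype.val : τ → σ) = Option.some := by
      funext x
      simp [e, Equiv.optionSubtypeNe_symm_of_ne x.2]
    change optionEquivLeft τ K (rename e (rename Subtype.val f)) = _
    rw [rename_rename]
    simp_rw [h]
    exact optionEquivLeft_rename_some f
  have hEk : ∀ (k : ℕ) f, constantCoeff (PowerSeries.coeff k (E f)) =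
      coeff (Finsupp.single s k) f := by
    intro k f
    change constantCoeff (PowerSeries.coeff k (optionEquivLeft τ K (rename e f))) = _
    rw [← coeff_zero_eq_constantCoeff_apply, coeff_coeff_optionEquivLeft]
    have : Finsupp.optionElim k (0 : τ →₀ ℕ) =
        Finsupp.embDomain e.toEmbedding (Finsupp.single s k) := by
      rw [Finsupp.embDomain_single]
      ext i
      have hes : e s = none := Equiv.optionSubtypeNe_symm_self s
      cases i with
      | none => simp [hes]
      | some i => simp [hes]
    rw [this]
    exact coeff_embDomain_rename e.toEmbedding f _
  set g := E ρ with hg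
  have hres : ∀ k, PowerSeries.coeff k
      (g.map (Ideal.Quotient.mk (IsLocalRing.maximalIdeal (MvPowerSeries τ K)))) = 0 ↔
      coeff (Finsupp.single s k) ρ = 0 := by
    intro k
    rw [PowerSeries.coeff_map, Ideal.Quotient.eq_zero_iff_mem, mem_maximalIdeal_iff, hEk]
  have hord : (g.map (Ideal.Quotient.mk
      (IsLocalRing.maximalIdeal (MvPowerSeries τ K)))).order.toNat = 1 := by
    have : (g.map (Ideal.Quotient.mk
      (IsLocalRing.maximalIdeal (MvPowerSeries τ K)))).order = (1 : ℕ) := by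
      rw [PowerSeries.order_eq_nat]
      refine ⟨fun h => h1 ((hres 1).1 h), fun i hi => (hres i).2 ?_⟩
      obtain rfl : i = 0 := by omega
      rw [Finsupp.single_zero, coeff_zero_eq_constantCoeff_apply, h0]
    rw [this]
    rfl
  have hdiv : PowerSeries.IsWeierstrassDivisor g := by
    apply PowerSeries.IsWeierstrassDivisor.of_map_ne_zero
    intro h
    apply h1
    rw [← hres]
    exact congrArg (PowerSeries.coeff 1) h
  -- Modulo the maximal ideal of the coefficients, `g` has order exactly 1, so Weierstrass division
  -- by `g` leaves constant remainders. Existence of the division makes `ι` surjective, uniqueness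
  -- makes it injective.
  let ι : MvPowerSeries τ K →+* PowerSeries (MvPowerSeries τ K) ⧸ Ideal.span {g} :=
    (Ideal.Quotient.mk _).comp PowerSeries.C
  have hι : Function.Bijective ι := by
    constructor
    · rw [injective_iff_map_eq_zero]
      intro r hr
      obtain ⟨q, hq⟩ := Ideal.mem_span_singleton'.1 (Ideal.Quotient.eq_zero_iff_mem.1 hr)
      have := (hdiv.eq_zero_of_mul_eq (q := q) (r := Polynomial.C r) (by
        rw [hord]
        exact Polynomial.degree_C_le.trans_lt (by norm_num)) (by
        rw [mul_comm, hq, Polynomial.coe_C])).2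
      simpa using this
    · intro x
      obtain ⟨f, rfl⟩ := Ideal.Quotient.mk_surjective x
      obtain ⟨hd, he⟩ := hdiv.isWeierstrassDivisionAt_div_mod f
      rw [hord] at hd
      obtain ⟨c, hc⟩ : ∃ c, hdiv.mod f = Polynomial.C c := by
        refine ⟨(hdiv.mod f).coeff 0, Polynomial.eq_C_of_natDegree_eq_zero ?_⟩
        rw [Polynomial.natDegree_eq_zero_iff_degree_le_zero, Polynomial.degree_le_iff_coeff_zero]
        intro k hk
        exact (Polynomial.degree_lt_iff_coeff_zero _ _).1 hd k
          (Nat.one_le_iff_ne_zero.2 fun h => by simp [h] at hk)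
      refine ⟨c, ?_⟩
      change Ideal.Quotient.mk _ _ = _
      rw [Ideal.Quotient.mk_eq_mk_iff_sub_mem, Ideal.mem_span_singleton]
      refine ⟨-hdiv.div f, ?_⟩
      rw [hc, Polynomial.coe_C] at he
      change PowerSeries.C c - f = _
      linear_combination -he
  let Φ := RingEquiv.ofBijective ι hι
  let π : MvPowerSeries σ K →+* MvPowerSeries τ K :=
    (Φ.symm.toRingHom.comp (Ideal.Quotient.mk _)).comp E.toRingHom
  have hπC : ∀ f, π (rename Subtype.val f) = f := by
    intro f
    change Φ.symm (Ideal.Quotient.mk _ (E (rename Subtype.val f))) = f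
    rw [hEC, RingEquiv.symm_apply_eq]
    rfl
  have hker : ∀ f, π f = 0 ↔ ρ ∣ f := by
    intro f
    change Φ.symm (Ideal.Quotient.mk _ (E f)) = 0 ↔ _
    rw [map_eq_zero_iff _ Φ.symm.injective, Ideal.Quotient.eq_zero_iff_mem,
      Ideal.mem_span_singleton, hg]
    exact map_dvd_iff E
  refine ⟨π, hπC, hker, fun f => ?_⟩
  obtain ⟨c, hc⟩ : ρ ∣ f - rename Subtype.val (π f) := by
    rw [← hker, map_sub, hπC, sub_self]
  have := congrArg constantCoeff hc
  rw [map_sub, map_mul, h0, zero_mul, constantCoeff_rename, sub_eq_zero] at this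
  exact this.symm

theorem natCast_le_order_pderiv {σ R : Type*} [CommRing R] {f : MvPowerSeries σ R} {k : ℕ}
    (hf : ((k + 1 : ℕ) : ℕ∞) ≤ f.order) (i : σ) : (k : ℕ∞) ≤ (pderiv R i f).order := by
  refine nat_le_order fun d hd => ?_
  rw [coeff_pderiv, coeff_of_lt_order, zero_mul]
  refine lt_of_lt_of_le ?_ hf
  rw [map_add, Finsupp.degree_single]
  exact_mod_cast Nat.succ_lt_succ hd

section ChainRule

variable {σ τ R : Type*} [Fintype σ] [CommRing R]

theorem order_le_order_subst {a : σ → MvPowerSeries τ R} (ha : ∀ i, constantCoeff (a i) = 0)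
    (f : MvPowerSeries σ R) : f.order ≤ (subst a f).order := by
  refine le_trans ?_ (le_order_subst (hasSubst_of_constantCoeff_zero ha) f)
  refine le_mul_of_one_le_left' (le_iInf fun i => ?_)
  exact one_le_order_iff_constCoeff_eq_zero.2 (ha i)

/-- The polynomial case is an induction. In general, differentiation lowers the order by at most one
and substitution does not lower it, so a tail of high order does not affect a given coefficient. -/
theorem pderiv_subst [Finite τ] {a : σ → MvPowerSeries τ R} (ha : ∀ i, constantCoeff (a i) = 0)
    (f : MvPowerSeries σ R) (j : τ) :
    pderiv R j (subst a f) = ∑ i, subst a (pderiv R i f) * pderiv R j (a i) := by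
  classical
  have hs := hasSubst_of_constantCoeff_zero ha
  have hpoly : ∀ p : MvPolynomial σ R, pderiv R j (subst a (p : MvPowerSeries σ R)) =
      ∑ i, subst a (pderiv R i (p : MvPowerSeries σ R)) * pderiv R j (a i) := by
    intro p
    induction p using MvPolynomial.induction_on with
    | C r =>
      simp only [MvPolynomial.coe_C, pderiv_C]
      rw [subst_C, pderiv_C]
      simp only [← coe_substAlgHom hs, map_zero, zero_mul, Finset.sum_const_zero]
    | add p q hp hq =>
      simp only [MvPolynomial.coe_add, subst_add hs, map_add, hp, hq, add_mul,
        Finset.sum_add_distrib]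
    | mul_X p s hp =>
      simp only [MvPolynomial.coe_mul, MvPolynomial.coe_X, subst_mul hs, Derivation.leibniz, hp,
        subst_X hs, smul_eq_mul, subst_add hs, add_mul, Finset.sum_add_distrib, pderiv_X,
        Finset.mul_sum]
      congr 1
      · rw [Finset.sum_eq_single s]
        · rw [Pi.single_eq_same, ← coe_substAlgHom hs, map_one, mul_one]
        · intro i _ hi
          rw [Pi.single_eq_of_ne (Ne.symm hi), ← coe_substAlgHom hs, map_zero, mul_zero, zero_mul]
        · simp
      · simp only [mul_assoc]
  ext x
  -- The tail left by truncation has order at least `k + 1 = x.degree + 2`, so its derivatives still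
  -- have order above `x.degree`.
  set k := x.degree + 1
  have hf : f = (f.truncTotal (k + 1) : MvPowerSeries σ R) + (f - f.truncTotal (k + 1)) := by ring
  set u := f - (f.truncTotal (k + 1) : MvPowerSeries σ R) with hu
  have huo : ((k + 1 : ℕ) : ℕ∞) ≤ u.order := by
    refine nat_le_order fun d hd => ?_
    rw [hu, map_sub, MvPolynomial.coeff_coe, coeff_truncTotal _ hd, sub_self]
  rw [hf]
  simp only [subst_add hs, map_add, add_mul, Finset.sum_add_distrib, hpoly]
  congr 1
  have hlt : (x.degree : ℕ∞) < (k : ℕ) := by exact_mod_cast Nat.lt_succ_self _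
  rw [coeff_of_lt_order (hlt.trans_le (natCast_le_order_pderiv
    (huo.trans (order_le_order_subst ha u)) j)), map_sum]
  symm
  refine Finset.sum_eq_zero fun i _ => ?_
  refine coeff_of_lt_order (hlt.trans_le ?_)
  refine le_trans ?_ le_order_mul
  refine le_trans ?_ le_self_add
  exact (natCast_le_order_pderiv huo i).trans (order_le_order_subst ha _)

end ChainRule

end MvPowerSeries

end

noncomputable section

/-! ### Ranks of matrices -/

namespace Matrix

/-- Sylvester's inequality: restricting `A` to the range of `B` loses at most the dimension of the
kernel of `A`. -/
theorem rank_add_rank_le_rank_mul_add_card {F l m n : Type*} [Field F] [Fintype l] [Fintype m]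
    [Fintype n] (A : Matrix l m F) (B : Matrix m n F) :
    A.rank + B.rank ≤ (A * B).rank + Fintype.card m := by
  classical
  have h1 : (A * B).rank =
      Module.finrank F ((LinearMap.range B.mulVecLin).map A.mulVecLin) := by
    rw [Matrix.rank, Matrix.mulVecLin_mul, LinearMap.range_comp]
  have h2 := LinearMap.finrank_range_add_finrank_ker
    (A.mulVecLin.domRestrict (LinearMap.range B.mulVecLin))
  have h3 : LinearMap.range (A.mulVecLin.domRestrict (LinearMap.range B.mulVecLin)) =
      (LinearMap.range B.mulVecLin).map A.mulVecLin := by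
    rw [LinearMap.range_domRestrict]
  have h4 : Module.finrank F (LinearMap.ker
      (A.mulVecLin.domRestrict (LinearMap.range B.mulVecLin))) ≤
      Module.finrank F (LinearMap.ker A.mulVecLin) := by
    rw [← Submodule.finrank_map_subtype_eq]
    apply Submodule.finrank_mono
    rintro _ ⟨x, hx, rfl⟩
    exact hx
  have h5 := LinearMap.finrank_range_add_finrank_ker A.mulVecLin
  rw [Module.finrank_fintype_fun_eq_card] at h5
  rw [h3] at h2
  rw [h1]
  have h6 : B.rank = Module.finrank F (LinearMap.range B.mulVecLin) := rfl
  have h7 : A.rank = Module.finrank F (LinearMap.range A.mulVecLin) := rfl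
  omega

/-- `E` and `G` certify the rank by a matrix identity, which can be lifted to a local ring and
tested on a determinant. -/
theorem exists_mul_mul_eq_one {F m n : Type*} [Field F] [Fintype m] [DecidableEq m] [Fintype n]
    [DecidableEq n] (A : Matrix m n F) :
    ∃ (E : Matrix (Fin A.rank) m F) (G : Matrix n (Fin A.rank) F), E * A * G = 1 := by
  let f : (n → F) →ₗ[F] (m → F) := A.mulVecLin
  obtain ⟨g, hg⟩ := f.rangeRestrict.exists_rightInverse_of_surjective f.range_rangeRestrict
  obtain ⟨p, hp⟩ := (LinearMap.range f).subtype.exists_leftInverse_of_injective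
    (Submodule.ker_subtype _)
  let b : Module.Basis (Fin A.rank) F (LinearMap.range f) := Module.finBasis F (LinearMap.range f)
  refine ⟨LinearMap.toMatrix (Pi.basisFun F m) b p, LinearMap.toMatrix b (Pi.basisFun F n) g, ?_⟩
  have hA : A = LinearMap.toMatrix (Pi.basisFun F n) (Pi.basisFun F m) f := by
    ext i j
    simp [LinearMap.toMatrix_apply, f]
  have h1 : p ∘ₗ f ∘ₗ g = LinearMap.id := by
    calc p ∘ₗ f ∘ₗ g = p ∘ₗ (LinearMap.range f).subtype ∘ₗ (f.rangeRestrict ∘ₗ g) := rfl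
      _ = LinearMap.id := by rw [hg, LinearMap.comp_id, hp]
  have h2 := congrArg (LinearMap.toMatrix b b) h1
  rw [LinearMap.toMatrix_id, LinearMap.toMatrix_comp b (Pi.basisFun F m) b,
    LinearMap.toMatrix_comp b (Pi.basisFun F n) (Pi.basisFun F m), ← hA] at h2
  rw [Matrix.mul_assoc]
  exact h2

/-- The rank of a matrix with entries in a local ring can only drop at the closed point. -/
theorem rank_map_le_rank_map {R k F m n : Type*} [CommRing R] [Field k] [Field F] [Fintype m]
    [Fintype n] (ψ : R →+* k) (hψ : Function.Surjective ψ) (hunit : ∀ x, ψ x ≠ 0 → IsUnit x)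
    (φ : R →+* F) (M : Matrix m n R) : (M.map ψ).rank ≤ (M.map φ).rank := by
  classical
  obtain ⟨E, G, h⟩ := exists_mul_mul_eq_one (M.map ψ)
  -- The lift is merely set-theoretic, but the lifted product still reduces to the identity matrix,
  -- so its determinant is a unit and stays nonzero under `φ`.
  obtain ⟨s, hs⟩ := hψ.hasRightInverse
  have hEG : (E.map s * M * G.map s).map ψ = 1 := by
    rw [Matrix.map_mul, Matrix.map_mul, Matrix.map_map, Matrix.map_map]
    rw [show ψ ∘ s = id from funext hs, Matrix.map_id, Matrix.map_id]
    exact h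
  have hdet : IsUnit ((E.map s * M * G.map s).det) := by
    apply hunit
    rw [RingHom.map_det, RingHom.mapMatrix_apply, hEG, det_one]
    exact one_ne_zero
  have h2 : ((E.map s * M * G.map s).map φ).det ≠ 0 := by
    rw [← RingHom.mapMatrix_apply, ← RingHom.map_det]
    exact (hdet.map φ).ne_zero
  have h3 := rank_of_det_ne_zero h2
  rw [Fintype.card_fin] at h3
  rw [← h3, Matrix.map_mul, Matrix.map_mul]
  exact (rank_mul_le_left _ _).trans (rank_mul_le_right _ _)

theorem rank_vecMulVec_add_vecMulVec_le {F m n : Type*} [Field F] [Fintype m] [Fintype n]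
    (x z : m → F) (y w : n → F) : (vecMulVec x y + vecMulVec z w).rank ≤ 2 := by
  have h1 : (vecMulVec x y + vecMulVec z w) =
      (Matrix.of fun i (j : Fin 2) => ![x i, z i] j) * Matrix.of fun (j : Fin 2) k =>
        ![y k, w k] j := by
    ext i k
    simp [Matrix.mul_apply, Fin.sum_univ_two, vecMulVec_apply]
  rw [h1]
  refine (rank_mul_le_left _ _).trans ?_
  exact (rank_le_card_width _).trans (by simp)

theorem rank_fromCols_zero_le {F m n o : Type*} [Field F] [Fintype m] [Fintype n] [Fintype o]
    (A : Matrix m n F) : (fromCols (0 : Matrix m o F) A).rank ≤ A.rank := by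
  classical
  have : fromCols (0 : Matrix m o F) A = A * fromCols (0 : Matrix n o F) (1 : Matrix n n F) := by
    rw [mul_fromCols, Matrix.mul_zero, Matrix.mul_one]
  rw [this]
  exact rank_mul_le_left _ _

/-- If the column `v` is annihilated by `A`, then the rank of `A * L * C` is bounded from below in
terms of the ranks of `A`, `(v | L)` and `C`. -/
theorem rank_le_of_mul_col_eq_zero {F l m n : Type*} [Field F] [Fintype l] [Fintype m]
    [Fintype n] (A : Matrix l m F) (v : Matrix m Unit F) (L : Matrix m m F) (C : Matrix m n F)
    (hv : A * v = 0) :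
    A.rank + (fromCols v L).rank + C.rank ≤ (A * L * C).rank + 2 * Fintype.card m := by
  -- Sylvester twice: for `A * (v | L)`, whose first column is zero, and for `(A * L) * C`.
  have h1 := rank_add_rank_le_rank_mul_add_card A (fromCols v L)
  rw [mul_fromCols, hv] at h1
  have h2 := rank_fromCols_zero_le (o := Unit) (A * L)
  have h3 := rank_add_rank_le_rank_mul_add_card (A * L) C
  omega

theorem le_rank_of_submatrix_det_ne_zero {F m n : Type*} [Field F] [Fintype m] [Fintype n]
    [DecidableEq n] {A : Matrix m n F} {e : n → m} (h : (A.submatrix e id).det ≠ 0) :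
    Fintype.card n ≤ A.rank := by
  rw [← rank_of_det_ne_zero h]
  exact rank_submatrix_le A e id

theorem exists_orderEmb_det_ne_zero {F : Type*} [Field F] {k m : ℕ}
    {A : Matrix (Fin k) (Fin m) F} (h : m ≤ A.rank) :
    ∃ e : Fin m ↪o Fin k, (A.submatrix e id).det ≠ 0 := by
  have hm : A.rank = m := le_antisymm (rank_le_width A) h
  have hfr : Module.finrank F (Submodule.span F (Set.range A.row)) = m := by
    rw [← rank_eq_finrank_span_row, hm]
  obtain ⟨f, hfs, hfspan, hfli⟩ := Submodule.exists_fun_fin_finrank_span_eq F (Set.range A.row)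
  have hg : ∀ i, ∃ j, A.row j = f i := hfs
  choose g hg using hg
  have hgf : A.row ∘ g = f := funext hg
  have hginj : Function.Injective g := by
    intro i j hij
    apply hfli.injective
    rw [← hgf, Function.comp_apply, Function.comp_apply, hij]
  have hcard : (Finset.univ.image g).card = m := by
    rw [Finset.card_image_of_injective _ hginj, Finset.card_univ, Fintype.card_fin, hfr]
  let e := (Finset.univ.image g).orderEmbOfFin hcard
  have he : ∀ i, ∃ j, g j = e i := by
    intro i
    obtain ⟨j, -, hj⟩ := Finset.mem_image.1
      (Finset.orderEmbOfFin_mem (Finset.univ.image g) hcard i)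
    exact ⟨j, hj⟩
  choose σ hσ using he
  have hσinj : Function.Injective σ := by
    intro i j hij
    apply e.injective
    rw [← hσ, ← hσ, hij]
  refine ⟨e, ?_⟩
  have hli : LinearIndependent F (A.submatrix e id).row := by
    have : (A.submatrix e id).row = f ∘ σ := by
      funext i
      rw [Function.comp_apply, ← hg, hσ]
      rfl
    rw [this]
    exact hfli.comp σ hσinj
  exact ((Matrix.isUnit_iff_isUnit_det _).1
    (Matrix.linearIndependent_rows_iff_isUnit.1 hli)).ne_zero

end Matrix

/-- The rank of a form on the hyperplane `c⊥` is less than the rank of the matrix of the form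
bordered by `c`. -/
theorem restrictedRank_lt_rank_fromCols {m : ℕ} (A : Matrix (Fin m) (Fin m) ℂ) {c : Fin m → ℂ}
    (hc : c ≠ 0) :
    restrictedRank A c < (Matrix.fromCols (Matrix.replicateCol Unit c) A).rank := by
  classical
  let M := Matrix.fromCols (Matrix.replicateCol Unit c) A
  let T : (Fin m → ℂ) →ₗ[ℂ] (Unit ⊕ Fin m → ℂ) := M.transpose.mulVecLin
  have hT1 : ∀ x, T x (Sum.inl ()) = ∑ j, c j * x j := by
    intro x
    simp [T, M, Matrix.vecMul, dotProduct, mul_comm]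
  have hT2 : ∀ x j, T x (Sum.inr j) = ∑ i, A i j * x i := by
    intro x j
    simp [T, M, Matrix.vecMul, dotProduct, mul_comm]
  have hrank : M.rank = Module.finrank ℂ (LinearMap.range T) := by
    rw [← Matrix.rank_transpose]
    rfl
  let V := annihilatedBy c
  have hV : ∀ x, x ∈ V ↔ ∑ j, c j * x j = 0 := fun x => Iff.rfl
  let B := (hermForm A).domRestrict₁₂ V V
  have hB : restrictedRank A c = Module.finrank ℂ (LinearMap.range B) := rfl
  have h1 : Module.finrank ℂ (LinearMap.range B) ≤
      Module.finrank ℂ (LinearMap.range (T.domRestrict V)) := by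
    have e1 := LinearMap.finrank_range_add_finrank_ker B
    have e2 := LinearMap.finrank_range_add_finrank_ker (T.domRestrict V)
    have e3 : LinearMap.ker (T.domRestrict V) ≤ LinearMap.ker B := by
      intro x hx
      rw [LinearMap.mem_ker] at hx ⊢
      have hx' : ∀ j, ∑ i, A i j * (x : Fin m → ℂ) i = 0 := by
        intro j
        rw [← hT2]
        exact congrFun hx (Sum.inr j)
      ext y
      change ∑ i, ∑ j, A i j * (x : Fin m → ℂ) i * starRingEnd ℂ ((y : Fin m → ℂ) j) = 0
      rw [Finset.sum_comm]
      refine Finset.sum_eq_zero fun j _ => ?_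
      rw [← Finset.sum_mul, hx' j, zero_mul]
    have e4 := Submodule.finrank_mono e3
    omega
  -- On `V` the border entry of `T x` is zero, while it is nonzero for a suitable basis vector; this
  -- is the extra unit of rank.
  have h2 : LinearMap.range (T.domRestrict V) < LinearMap.range T := by
    rw [LinearMap.range_domRestrict]
    refine lt_of_le_of_ne (LinearMap.map_le_range) fun h => ?_
    obtain ⟨j, hj⟩ := Function.ne_iff.1 hc
    have : T (Pi.single j 1) ∈ V.map T := h ▸ LinearMap.mem_range_self T _
    obtain ⟨x, hx, hxT⟩ := this
    have h3 := congrFun hxT (Sum.inl ())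
    rw [hT1, hT1, (hV x).1 hx] at h3
    simp only [Pi.single_apply, mul_ite, mul_one, mul_zero, Finset.sum_ite_eq',
      Finset.mem_univ, if_true] at h3
    exact hj h3.symm
  have h3 := Submodule.finrank_lt_finrank_of_lt h2
  change _ < M.rank
  omega

end

noncomputable section

/-! ### The formal theorem -/

namespace MvPowerSeries

theorem pderiv_map {σ R S : Type*} [CommRing R] [CommRing S] (φ : R →+* S)
    (f : MvPowerSeries σ R) (i : σ) : pderiv S i (map φ f) = map φ (pderiv R i f) := by
  ext d
  simp only [coeff_pderiv, coeff_map, map_mul, map_add, map_natCast, map_one]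

theorem pderiv_rename {σ τ R : Type*} [Fintype σ] [Finite τ] [DecidableEq τ] [CommRing R]
    (e : σ → τ) (f : MvPowerSeries σ R) (j : τ) :
    pderiv R j (rename e f) = ∑ i, if e i = j then rename e (pderiv R i f) else 0 := by
  rw [rename_eq_subst, pderiv_subst (a := X ∘ e) (fun i => constantCoeff_X (e i))]
  refine Finset.sum_congr rfl fun i _ => ?_
  rw [Function.comp_apply]
  split_ifs with h
  · subst h
    rw [pderiv_X_self, mul_one, rename_eq_subst]
  · rw [pderiv_X_of_ne h, mul_zero]

theorem pderiv_rename_self {σ τ R : Type*} [Fintype σ] [Finite τ] [CommRing R]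
    {e : σ → τ} (he : Function.Injective e) (f : MvPowerSeries σ R) (j : σ) :
    pderiv R (e j) (rename e f) = rename e (pderiv R j f) := by
  classical
  rw [pderiv_rename, Finset.sum_eq_single j]
  · rw [if_pos rfl]
  · intro i _ hi
    rw [if_neg fun h => hi (he h)]
  · simp

theorem pderiv_rename_of_notMem_range {σ τ R : Type*} [Fintype σ] [Finite τ] [CommRing R]
    {e : σ → τ} (f : MvPowerSeries σ R) {j : τ} (hj : j ∉ Set.range e) :
    pderiv R j (rename e f) = 0 := by
  classical
  rw [pderiv_rename]
  exact Finset.sum_eq_zero fun i _ => if_neg fun h => hj ⟨i, h⟩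

theorem constantCoeff_killCompl {σ τ R : Type*} [CommRing R] (e : σ ↪ τ)
    (f : MvPowerSeries τ R) : constantCoeff (killCompl e f) = constantCoeff f := by
  rw [← coeff_zero_eq_constantCoeff_apply, coeff_killCompl, Finsupp.embDomain_zero,
    coeff_zero_eq_constantCoeff_apply]

theorem constantCoeff_subst_of_constantCoeff_eq_zero {σ τ R : Type*} [Finite σ] [CommRing R]
    {a : σ → MvPowerSeries τ R} (ha : ∀ i, constantCoeff (a i) = 0) (f : MvPowerSeries σ R) :
    constantCoeff (subst a f) = constantCoeff f := by
  have hs := hasSubst_of_constantCoeff_zero ha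
  have h : f = C (constantCoeff f) + (f - C (constantCoeff f)) := by ring
  have h0 : constantCoeff (subst a (f - C (constantCoeff f))) = 0 :=
    constantCoeff_subst_eq_zero hs ha (by simp)
  conv_lhs => rw [h]
  rw [subst_add hs, map_add, h0, add_zero, subst_C, constantCoeff_C]

/-- On a formal hypersurface `ρ = 0`, every power series `a` without constant term vanishes at the
generic point of some irreducible formal subset given by a single equation `q = 0`. -/
theorem exists_field_ringHom_ker {σ K : Type} [Finite σ] [Field K] [Infinite K] (s : σ)
    {ρ : MvPowerSeries σ K} (h0 : constantCoeff ρ = 0) (h1 : coeff (Finsupp.single s 1) ρ ≠ 0)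
    {a : MvPowerSeries σ K} (ha : constantCoeff a = 0) :
    ∃ (F : Type) (_ : Field F) (φ : MvPowerSeries σ K →+* F) (q : MvPowerSeries σ K),
      constantCoeff q = 0 ∧ φ ρ = 0 ∧ φ a = 0 ∧ ∀ f, φ f = 0 → ∃ c, ρ ∣ f - q * c := by
  obtain ⟨π, hπ, hker, hcc⟩ := exists_ringHom_ker_eq_span s h0 h1
  obtain ⟨q, hq0, hqp, hqa⟩ : ∃ q : MvPowerSeries {x // x ≠ s} K, constantCoeff q = 0 ∧
      (Ideal.span {q}).IsPrime ∧ q ∣ π a := by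
    -- If `a` vanishes on all of `ρ = 0`, the generic point of the hypersurface itself is used, with
    -- `q = 0`.
    by_cases hπa : π a = 0
    · refine ⟨0, map_zero _, ?_, by rw [hπa]⟩
      rw [Ideal.span_singleton_zero]
      exact Ideal.isPrime_bot
    · have hnu : ¬ IsUnit (π a) := by
        rw [isUnit_iff_constantCoeff, hcc, ha]
        exact not_isUnit_zero
      obtain ⟨q, hq, hqa⟩ := WfDvdMonoid.exists_irreducible_factor hnu hπa
      have hqp : Prime q := UniqueFactorizationMonoid.irreducible_iff_prime.1 hq
      refine ⟨q, ?_, (Ideal.span_singleton_prime hqp.ne_zero).2 hqp, hqa⟩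
      exact mem_maximalIdeal_iff.1 ((IsLocalRing.mem_maximalIdeal _).2 hqp.not_isUnit)
  let D := MvPowerSeries {x // x ≠ s} K ⧸ Ideal.span {q}
  have : IsDomain D := (Ideal.Quotient.isDomain_iff_prime _).2 hqp
  let φ : MvPowerSeries σ K →+* FractionRing D :=
    ((algebraMap D (FractionRing D)).comp (Ideal.Quotient.mk _)).comp π
  have hφ : ∀ f, φ f = 0 ↔ q ∣ π f := by
    intro f
    change algebraMap D (FractionRing D) (Ideal.Quotient.mk _ (π f)) = 0 ↔ _
    rw [map_eq_zero_iff _ (IsFractionRing.injective D (FractionRing D)),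
      Ideal.Quotient.eq_zero_iff_mem, Ideal.mem_span_singleton]
  refine ⟨FractionRing D, inferInstance, φ, rename Subtype.val q, ?_, ?_, ?_, ?_⟩
  · rw [constantCoeff_rename, hq0]
  · rw [hφ, (hker ρ).2 dvd_rfl]
    exact dvd_zero _
  · rwa [hφ]
  · intro f hf
    obtain ⟨c, hc⟩ := (hφ f).1 hf
    refine ⟨rename Subtype.val c, ?_⟩
    rw [← hker, map_sub, map_mul, hπ, hπ, hc, sub_self]

/-- If `ρ` contains the variable `X s` linearly, then any set of variables not containing `X s`
parametrizes a formal submanifold of `ρ = 0`. -/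
theorem exists_ringHom_section {σ τ K : Type*} [Finite σ] [Field K] (s : σ)
    {ρ : MvPowerSeries σ K} (h0 : constantCoeff ρ = 0) (h1 : coeff (Finsupp.single s 1) ρ ≠ 0)
    (e : τ ↪ σ) [Finite τ] (hs : s ∉ Set.range e) :
    ∃ π : MvPowerSeries σ K →+* MvPowerSeries τ K, (∀ f, π (rename e f) = f) ∧ π ρ = 0 ∧
      ∀ f, constantCoeff (π f) = constantCoeff f := by
  obtain ⟨π, hπ, hker, hcc⟩ := exists_ringHom_ker_eq_span s h0 h1
  let e' : τ ↪ {x // x ≠ s} := ⟨fun i => ⟨e i, fun h => hs ⟨i, h⟩⟩, fun i j h =>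
    e.injective (congrArg Subtype.val h)⟩
  -- After solving for `X s`, the remaining variables outside the range of `e` are set to zero.
  refine ⟨(killCompl e').toRingHom.comp π, fun f => ?_, ?_, fun f => ?_⟩
  · have : rename e f = rename Subtype.val (rename e' f) := by
      rw [rename_rename]
      rfl
    change killCompl e' (π (rename e f)) = f
    rw [this, hπ]
    exact killCompl_rename_app f
  · change killCompl e' (π ρ) = 0
    rw [(hker ρ).2 dvd_rfl, map_zero]
  · change constantCoeff (killCompl e' (π f)) = _
    rw [constantCoeff_killCompl, hcc]

end MvPowerSeries

section Formal

open MvPowerSeries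

variable {m k : ℕ}

theorem coeff_single_inl (ρ : MvPowerSeries (Fin m ⊕ Fin m) ℂ) (j : Fin m) :
    coeff (Finsupp.single (Sum.inl j) 1) ρ = formalGradient ρ j := by
  rw [formalGradient, ← coeff_zero_eq_constantCoeff_apply, coeff_pderiv]
  simp

theorem coeff_single_inr {ρ : MvPowerSeries (Fin m ⊕ Fin m) ℂ} (hρ : hermConj ρ = ρ)
    (j : Fin m) :
    coeff (Finsupp.single (Sum.inr j) 1) ρ = starRingEnd ℂ (formalGradient ρ j) := by
  conv_lhs => rw [← hρ, hermConj]
  have h := coeff_embDomain_rename (Equiv.sumComm (Fin m) (Fin m)).toEmbedding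
    (MvPowerSeries.map (starRingEnd ℂ) ρ) (Finsupp.single (Sum.inl j) 1)
  rw [Finsupp.embDomain_single] at h
  rw [coeff_map, coeff_single_inl] at h
  exact h

theorem constantCoeff_complexifiedMap {H : Fin k → MvPowerSeries (Fin m) ℂ}
    (hH : ∀ i, constantCoeff (H i) = 0) (i : Fin k ⊕ Fin k) :
    constantCoeff (complexifiedMap H i) = 0 := by
  cases i with
  | inl i => rw [complexifiedMap, Sum.elim_inl, constantCoeff_rename, hH]
  | inr i =>
    rw [complexifiedMap, Sum.elim_inr, constantCoeff_rename, constantCoeff_map, hH, map_zero]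

theorem pderiv_inl_complexifiedMap_inl (H : Fin k → MvPowerSeries (Fin m) ℂ) (i : Fin k)
    (j : Fin m) : pderiv ℂ (Sum.inl j) (complexifiedMap H (Sum.inl i)) =
      rename Sum.inl (pderiv ℂ j (H i)) :=
  pderiv_rename_self Sum.inl_injective _ _

theorem pderiv_inr_complexifiedMap_inr (H : Fin k → MvPowerSeries (Fin m) ℂ) (i : Fin k)
    (j : Fin m) : pderiv ℂ (Sum.inr j) (complexifiedMap H (Sum.inr i)) =
      rename Sum.inr (MvPowerSeries.map (starRingEnd ℂ) (pderiv ℂ j (H i))) := by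
  rw [← pderiv_map]
  exact pderiv_rename_self Sum.inr_injective _ _

theorem pderiv_inl_complexifiedMap_inr (H : Fin k → MvPowerSeries (Fin m) ℂ) (i : Fin k)
    (j : Fin m) : pderiv ℂ (Sum.inl j) (complexifiedMap H (Sum.inr i)) = 0 :=
  pderiv_rename_of_notMem_range _ (by simp)

theorem pderiv_inr_complexifiedMap_inl (H : Fin k → MvPowerSeries (Fin m) ℂ) (i : Fin k)
    (j : Fin m) : pderiv ℂ (Sum.inr j) (complexifiedMap H (Sum.inl i)) = 0 :=
  pderiv_rename_of_notMem_range _ (by simp)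

theorem pderiv_inl_subst_complexifiedMap {H : Fin k → MvPowerSeries (Fin m) ℂ}
    (hH : ∀ i, constantCoeff (H i) = 0) (u : MvPowerSeries (Fin k ⊕ Fin k) ℂ) (j : Fin m) :
    pderiv ℂ (Sum.inl j) (subst (complexifiedMap H) u) =
      ∑ i, subst (complexifiedMap H) (pderiv ℂ (Sum.inl i) u) *
        rename Sum.inl (pderiv ℂ j (H i)) := by
  rw [pderiv_subst (constantCoeff_complexifiedMap hH), Fintype.sum_sum_type]
  simp only [pderiv_inl_complexifiedMap_inl, pderiv_inl_complexifiedMap_inr, mul_zero,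
    Finset.sum_const_zero, add_zero]

theorem pderiv_inr_subst_complexifiedMap {H : Fin k → MvPowerSeries (Fin m) ℂ}
    (hH : ∀ i, constantCoeff (H i) = 0) (u : MvPowerSeries (Fin k ⊕ Fin k) ℂ) (j : Fin m) :
    pderiv ℂ (Sum.inr j) (subst (complexifiedMap H) u) =
      ∑ i, subst (complexifiedMap H) (pderiv ℂ (Sum.inr i) u) *
        rename Sum.inr (MvPowerSeries.map (starRingEnd ℂ) (pderiv ℂ j (H i))) := by
  rw [pderiv_subst (constantCoeff_complexifiedMap hH), Fintype.sum_sum_type]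
  simp only [pderiv_inr_complexifiedMap_inl, pderiv_inr_complexifiedMap_inr, mul_zero,
    Finset.sum_const_zero, zero_add]

/-- No second derivatives of the map appear because `H` involves only `Z` and `H̄` only `ξ`. -/
theorem pderiv_pderiv_subst_complexifiedMap {H : Fin k → MvPowerSeries (Fin m) ℂ}
    (hH : ∀ i, constantCoeff (H i) = 0) (u : MvPowerSeries (Fin k ⊕ Fin k) ℂ) (j l : Fin m) :
    pderiv ℂ (Sum.inl j) (pderiv ℂ (Sum.inr l) (subst (complexifiedMap H) u)) =
      ∑ i', (∑ i, rename Sum.inl (pderiv ℂ j (H i)) *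
        subst (complexifiedMap H) (pderiv ℂ (Sum.inl i) (pderiv ℂ (Sum.inr i') u))) *
        rename Sum.inr (MvPowerSeries.map (starRingEnd ℂ) (pderiv ℂ l (H i'))) := by
  rw [pderiv_inr_subst_complexifiedMap hH, map_sum]
  refine Finset.sum_congr rfl fun i' _ => ?_
  rw [Derivation.leibniz, pderiv_inl_subst_complexifiedMap hH,
    pderiv_rename_of_notMem_range _ (by simp), smul_zero, zero_add, smul_eq_mul, mul_comm]
  congr 1
  exact Finset.sum_congr rfl fun i _ => mul_comm _ _

/-- The complex hyperplane annihilated by `ρ'_{Z'}` already lies in the tangent space, so one column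
of the Jacobian outside it supplies the rest. -/
theorem isFormallyTransversal_of_ne_zero {H : Fin k → MvPowerSeries (Fin m) ℂ}
    {ρ' : MvPowerSeries (Fin k ⊕ Fin k) ℂ} {j : Fin m}
    (hj : ∑ i, formalGradient ρ' i * constantCoeff (pderiv ℂ j (H i)) ≠ 0) :
    IsFormallyTransversal H ρ' := by
  rw [IsFormallyTransversal, eq_top_iff]
  intro v _
  set w := ∑ i, formalGradient ρ' i * constantCoeff (pderiv ℂ j (H i))
  set t := ∑ i, formalGradient ρ' i * v i
  let A := (formalJacobian H).map constantCoeff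
  let u : Fin k → ℂ := A.mulVecLin (Pi.single j (t / w))
  have hu : ∀ i, u i = constantCoeff (pderiv ℂ j (H i)) * (t / w) := by
    intro i
    simp [u, A, formalJacobian, div_eq_mul_inv]
  rw [Submodule.mem_sup]
  refine ⟨v - u, ?_, u, ⟨_, rfl⟩, sub_add_cancel _ _⟩
  change (∑ i, formalGradient ρ' i * (v - u) i).re = 0
  have : ∑ i, formalGradient ρ' i * (v - u) i = 0 := by
    simp only [Pi.sub_apply, mul_sub, Finset.sum_sub_distrib, hu]
    simp only [← mul_assoc, ← Finset.sum_mul]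
    change t - w * (t / w) = 0
    field_simp
    ring
  rw [this, Complex.zero_re]

/-- At `0` the `Z_j`-derivative of the mapping identity reads `∑ ρ'_{Z'_i} ∂_j H_i = a(0) ρ_{Z_j}`.
Without transversality the left side is `0` for every `j`, and some `ρ_{Z_j}(0)` is not. -/
theorem constantCoeff_eq_zero_of_not_isFormallyTransversal
    {ρ : MvPowerSeries (Fin m ⊕ Fin m) ℂ} {ρ' : MvPowerSeries (Fin k ⊕ Fin k) ℂ}
    {H : Fin k → MvPowerSeries (Fin m) ℂ} (hρ : IsFormalDefiningSeries ρ)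
    (hH : ∀ i, constantCoeff (H i) = 0) {a : MvPowerSeries (Fin m ⊕ Fin m) ℂ}
    (ha : subst (complexifiedMap H) ρ' = a * ρ) (hnt : ¬ IsFormallyTransversal H ρ') :
    constantCoeff a = 0 := by
  obtain ⟨j, hj⟩ := Function.ne_iff.1 hρ.grad
  have h1 := congrArg (fun f => constantCoeff (pderiv ℂ (Sum.inl j) f)) ha
  simp only [pderiv_inl_subst_complexifiedMap hH, map_sum, map_mul, constantCoeff_rename,
    constantCoeff_subst_of_constantCoeff_eq_zero (constantCoeff_complexifiedMap hH),
    Derivation.leibniz, smul_eq_mul, map_add, hρ.zero, zero_mul, add_zero] at h1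
  have h2 : ∑ i, constantCoeff (pderiv ℂ (Sum.inl i) ρ') * constantCoeff (pderiv ℂ j (H i)) = 0 := by
    by_contra h
    exact hnt (isFormallyTransversal_of_ne_zero h)
  rw [h2] at h1
  exact (mul_eq_zero.1 h1.symm).resolve_right hj

/-- At a point of `ρ = a = 0` where both `H_Z` and its conjugate have maximal rank, the rank of the
Levi form is bounded. -/
theorem formalLeviRank_le_of_field_ringHom {F : Type} [Field F]
    {ρ : MvPowerSeries (Fin m ⊕ Fin m) ℂ} {ρ' : MvPowerSeries (Fin k ⊕ Fin k) ℂ}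
    {H : Fin k → MvPowerSeries (Fin m) ℂ} (hρ' : IsFormalDefiningSeries ρ')
    (hH : ∀ i, constantCoeff (H i) = 0) {a : MvPowerSeries (Fin m ⊕ Fin m) ℂ}
    (ha : subst (complexifiedMap H) ρ' = a * ρ) (φ : MvPowerSeries (Fin m ⊕ Fin m) ℂ →+* F)
    (hφρ : φ ρ = 0) (hφa : φ a = 0) {e e' : Fin m ↪o Fin k}
    (he : φ (rename Sum.inl (formalMinor H e)) ≠ 0)
    (he' : φ (rename Sum.inr (MvPowerSeries.map (starRingEnd ℂ) (formalMinor H e'))) ≠ 0) :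
    2 * m + formalLeviRank ρ' + 1 ≤ 2 * k + 2 := by
  let ι : MvPowerSeries (Fin m) ℂ →+* F := φ.comp (rename Sum.inl).toRingHom
  let ι' : MvPowerSeries (Fin m) ℂ →+* F := (φ.comp (rename Sum.inr).toRingHom).comp
    (MvPowerSeries.map (starRingEnd ℂ))
  let A : Matrix (Fin m) (Fin k) F := ((formalJacobian H).map ι).transpose
  let C : Matrix (Fin k) (Fin m) F := (formalJacobian H).map ι'
  let v : Matrix (Fin k) Unit (MvPowerSeries (Fin m ⊕ Fin m) ℂ) :=
    Matrix.replicateCol Unit fun i => subst (complexifiedMap H) (pderiv ℂ (Sum.inl i) ρ')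
  let L : Matrix (Fin k) (Fin k) (MvPowerSeries (Fin m ⊕ Fin m) ℂ) :=
    Matrix.of fun i j => subst (complexifiedMap H) (pderiv ℂ (Sum.inl i) (pderiv ℂ (Sum.inr j) ρ'))
  have hArank : m ≤ A.rank := by
    rw [Matrix.rank_transpose]
    have := Matrix.le_rank_of_submatrix_det_ne_zero (A := (formalJacobian H).map ι) (e := e) (by
      rw [Matrix.submatrix_map, ← RingHom.mapMatrix_apply, ← RingHom.map_det]
      exact he)
    rwa [Fintype.card_fin] at this
  have hCrank : m ≤ C.rank := by
    have := Matrix.le_rank_of_submatrix_det_ne_zero (A := (formalJacobian H).map ι') (e := e') (by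
      rw [Matrix.submatrix_map, ← RingHom.mapMatrix_apply, ← RingHom.map_det]
      exact he')
    rwa [Fintype.card_fin] at this
  -- The first derivatives of `a * ρ` vanish where `ρ = a = 0`.
  have hAv : A * v.map φ = 0 := by
    ext j x
    have h1 := congrArg (fun f => φ (pderiv ℂ (Sum.inl j) f)) ha
    simp only [pderiv_inl_subst_complexifiedMap hH, Derivation.leibniz, smul_eq_mul, map_add,
      map_mul, hφρ, hφa, zero_mul, add_zero, map_sum] at h1
    rw [Matrix.zero_apply, ← h1, Matrix.mul_apply]
    exact Finset.sum_congr rfl fun i _ => mul_comm _ _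
  -- In the mixed second derivative of `a * ρ` only the two products of first derivatives survive,
  -- whence rank at most `2`.
  have hALC : A * L.map φ * C =
      Matrix.vecMulVec (fun j => φ (pderiv ℂ (Sum.inl j) a)) (fun l => φ (pderiv ℂ (Sum.inr l) ρ)) +
      Matrix.vecMulVec (fun j => φ (pderiv ℂ (Sum.inl j) ρ))
        (fun l => φ (pderiv ℂ (Sum.inr l) a)) := by
    ext j l
    have h1 := congrArg (fun f => φ (pderiv ℂ (Sum.inl j) (pderiv ℂ (Sum.inr l) f))) ha
    simp only [pderiv_pderiv_subst_complexifiedMap hH, Derivation.leibniz, smul_eq_mul, map_add,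
      map_mul, hφρ, hφa, zero_mul, zero_add, map_sum] at h1
    rw [Matrix.add_apply, Matrix.vecMulVec_apply, Matrix.vecMulVec_apply]
    calc (A * L.map φ * C) j l = _ := by
          rw [Matrix.mul_apply]
          refine Finset.sum_congr rfl fun i' _ => ?_
          rw [Matrix.mul_apply]
          rfl
      _ = _ := h1
      _ = _ := by ring
  have h2 := Matrix.rank_le_of_mul_col_eq_zero A (v.map φ) (L.map φ) C hAv
  have h3 : (A * L.map φ * C).rank ≤ 2 := by
    rw [hALC]
    exact Matrix.rank_vecMulVec_add_vecMulVec_le _ _ _ _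
  -- Semicontinuity of the rank carries the bound from the origin, where the Levi form is taken, to
  -- the point `φ`.
  have h4 : ((Matrix.fromCols v L).map (constantCoeff (σ := Fin m ⊕ Fin m) (R := ℂ))).rank ≤
      ((Matrix.fromCols v L).map φ).rank := by
    refine Matrix.rank_map_le_rank_map _ (fun c => ⟨MvPowerSeries.C c, constantCoeff_C c⟩)
      (fun x hx => ?_) φ _
    exact isUnit_iff_constantCoeff.2 (isUnit_iff_ne_zero.2 hx)
  have h5 : (Matrix.fromCols v L).map φ = Matrix.fromCols (v.map φ) (L.map φ) := by
    ext i j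
    cases j <;> rfl
  have h6 : (Matrix.fromCols v L).map (constantCoeff (σ := Fin m ⊕ Fin m) (R := ℂ)) =
      Matrix.fromCols (Matrix.replicateCol Unit (formalGradient ρ'))
        (Matrix.of fun i j => MvPowerSeries.constantCoeff
          (MvPowerSeries.pderiv ℂ (Sum.inl i) (MvPowerSeries.pderiv ℂ (Sum.inr j) ρ'))) := by
    ext i j
    cases j <;>
    exact constantCoeff_subst_of_constantCoeff_eq_zero (constantCoeff_complexifiedMap hH) _
  have h7 := restrictedRank_lt_rank_fromCols (Matrix.of fun i j => MvPowerSeries.constantCoeff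
    (MvPowerSeries.pderiv ℂ (Sum.inl i) (MvPowerSeries.pderiv ℂ (Sum.inr j) ρ'))) hρ'.grad
  change formalLeviRank ρ' < _ at h7
  rw [h5, h6] at h4
  rw [Fintype.card_fin] at h2
  omega

/-- By contradiction: if `a(0) = 0`, coprimality of the minors makes both Jacobians of full rank at
a field-valued point of `ρ = a = 0`, and the rank count there contradicts the bound on the Levi
rank. -/
theorem isFormallyTransversal_of_minors_coprime {n N : ℕ}
    {ρ : MvPowerSeries (Fin (n + 1) ⊕ Fin (n + 1)) ℂ}
    {ρ' : MvPowerSeries (Fin (N + 1) ⊕ Fin (N + 1)) ℂ}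
    {H : Fin (N + 1) → MvPowerSeries (Fin (n + 1)) ℂ}
    (hρ : IsFormalDefiningSeries ρ) (hρ' : IsFormalDefiningSeries ρ')
    (hH : ∀ i, constantCoeff (H i) = 0) (hmaps : FormallyMapsInto H ρ ρ')
    (hr : 2 * (N : ℤ) - (formalLeviRank ρ' : ℤ) ≤ 2 * (n : ℤ) - 2)
    (hd : ∀ d : MvPowerSeries (Fin (n + 1)) ℂ,
      (∀ e, formalMinor H e ≠ 0 → d ∣ formalMinor H e) → IsUnit d) :
    IsFormallyTransversal H ρ' := by
  by_contra hnt
  obtain ⟨a, ha⟩ := hmaps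
  have ha0 := constantCoeff_eq_zero_of_not_isFormallyTransversal hρ hH ha hnt
  obtain ⟨j, hj⟩ := Function.ne_iff.1 hρ.grad
  rw [Pi.zero_apply] at hj
  have hl : coeff (Finsupp.single (Sum.inl j) 1) ρ ≠ 0 := by rwa [coeff_single_inl]
  have hr' : coeff (Finsupp.single (Sum.inr j) 1) ρ ≠ 0 := by
    rw [coeff_single_inr hρ.real]
    simpa using hj
  obtain ⟨F, _, φ, q, hq0, hφρ, hφa, hφ⟩ :=
    exists_field_ringHom_ker (Sum.inl j) hρ.zero hl ha0
  -- `π` solves `ρ = 0` for one `ξ`-variable and sets the others to zero, leaving `Z` free; `π'`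
  -- exchanges the roles of `Z` and `ξ`.
  obtain ⟨π, hπ, hπρ, hπc⟩ := exists_ringHom_section (Sum.inr j) hρ.zero hr'
    (⟨Sum.inl, Sum.inl_injective⟩ : Fin (n + 1) ↪ Fin (n + 1) ⊕ Fin (n + 1)) (by simp)
  obtain ⟨π', hπ', hπ'ρ, hπ'c⟩ := exists_ringHom_section (Sum.inl j) hρ.zero hl
    (⟨Sum.inr, Sum.inr_injective⟩ : Fin (n + 1) ↪ Fin (n + 1) ⊕ Fin (n + 1)) (by simp)
  have hnu : ∀ d : MvPowerSeries (Fin (n + 1)) ℂ, constantCoeff d = 0 → ¬ IsUnit d := by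
    intro d hd0
    rw [isUnit_iff_constantCoeff, hd0]
    exact not_isUnit_zero
  obtain ⟨e, he⟩ : ∃ e, φ (rename Sum.inl (formalMinor H e)) ≠ 0 := by
    -- If every minor vanished at `φ`, each would be a multiple of `q` modulo `ρ`, and `π q` would
    -- be a nonunit dividing them all.
    by_contra! hall
    refine hnu (π q) (by rw [hπc, hq0]) (hd _ fun e _ => ?_)
    obtain ⟨c, t, ht⟩ := hφ _ (hall e)
    have := congrArg π ht
    rw [map_sub, map_mul, map_mul, hπρ, zero_mul, sub_eq_zero] at this
    refine ⟨π c, ?_⟩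
    rw [← this]
    exact (hπ _).symm
  obtain ⟨e', he'⟩ : ∃ e, φ (rename Sum.inr
      (MvPowerSeries.map (starRingEnd ℂ) (formalMinor H e))) ≠ 0 := by
    by_contra! hall
    refine hnu (MvPowerSeries.map (starRingEnd ℂ) (π' q))
      (by rw [constantCoeff_map, hπ'c, hq0, map_zero]) (hd _ fun e _ => ?_)
    obtain ⟨c, t, ht⟩ := hφ _ (hall e)
    have := congrArg π' ht
    rw [map_sub, map_mul, map_mul, hπ'ρ, zero_mul, sub_eq_zero] at this
    refine ⟨MvPowerSeries.map (starRingEnd ℂ) (π' c), ?_⟩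
    rw [← map_mul, ← this]
    have h1 : π' (rename Sum.inr (MvPowerSeries.map (starRingEnd ℂ) (formalMinor H e))) =
      MvPowerSeries.map (starRingEnd ℂ) (formalMinor H e) := hπ' _
    rw [h1]
    ext x
    simp
  -- With `m = n + 1` and `k = N + 1` the conclusion is `2N - r ≥ 2n - 1`.
  have := formalLeviRank_le_of_field_ringHom hρ' hH ha φ hφρ hφa he he'
  omega

end Formal

end

noncomputable section

/-! ### Wirtinger derivatives and Taylor series of smooth functions on `ℂ^m` -/

section Wirtinger

open MvPowerSeries

variable {m k : ℕ}

/-- The real-linear coordinates `z_j` and `z̄_j` on `ℂ^m`. -/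
def wirtingerCoord : Fin m ⊕ Fin m → (Fin m → ℂ) →L[ℝ] ℂ :=
  Sum.elim (fun j => ContinuousLinearMap.proj j)
    (fun j => Complex.conjCLE.toContinuousLinearMap.comp (ContinuousLinearMap.proj j))

theorem wirtingerCoord_inl (j : Fin m) (v : Fin m → ℂ) : wirtingerCoord (Sum.inl j) v = v j := rfl

theorem wirtingerCoord_inr (j : Fin m) (v : Fin m → ℂ) :
    wirtingerCoord (Sum.inr j) v = starRingEnd ℂ (v j) := rfl

/-- The coefficients of a real-linear form with respect to the coordinates `z_j` and `z̄_j`. -/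
def wirtingerCoeff : Fin m ⊕ Fin m → ((Fin m → ℂ) →L[ℝ] ℂ) →L[ℝ] ℂ :=
  Sum.elim
    (fun j => (2⁻¹ : ℝ) • (ContinuousLinearMap.apply ℝ ℂ (Pi.single j 1) -
      (Complex.I • ContinuousLinearMap.id ℝ ℂ).comp
        (ContinuousLinearMap.apply ℝ ℂ (Pi.single j Complex.I))))
    (fun j => (2⁻¹ : ℝ) • (ContinuousLinearMap.apply ℝ ℂ (Pi.single j 1) +
      (Complex.I • ContinuousLinearMap.id ℝ ℂ).comp
        (ContinuousLinearMap.apply ℝ ℂ (Pi.single j Complex.I))))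

theorem wirtingerCoeff_inl (j : Fin m) (A : (Fin m → ℂ) →L[ℝ] ℂ) :
    wirtingerCoeff (Sum.inl j) A =
      (A (Pi.single j 1) - Complex.I * A (Pi.single j Complex.I)) / 2 := by
  simp [wirtingerCoeff, div_eq_inv_mul]

theorem wirtingerCoeff_inr (j : Fin m) (A : (Fin m → ℂ) →L[ℝ] ℂ) :
    wirtingerCoeff (Sum.inr j) A =
      (A (Pi.single j 1) + Complex.I * A (Pi.single j Complex.I)) / 2 := by
  simp [wirtingerCoeff, div_eq_inv_mul, mul_add]

/-- The Wirtinger derivatives `∂/∂z_j` and `∂/∂z̄_j`. -/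
def wirtingerDeriv (s : Fin m ⊕ Fin m) (f : (Fin m → ℂ) → ℂ) : (Fin m → ℂ) → ℂ :=
  Sum.elim (fun j => wirtinger j f) (fun j => wirtingerBar j f) s

theorem wirtingerDeriv_apply (s : Fin m ⊕ Fin m) (f : (Fin m → ℂ) → ℂ) (z : Fin m → ℂ) :
    wirtingerDeriv s f z = wirtingerCoeff s (fderiv ℝ f z) := by
  cases s with
  | inl j => rw [wirtingerCoeff_inl]; rfl
  | inr j => rw [wirtingerCoeff_inr]; rfl

/-- The forms `dz_j` and `dz̄_j` are a basis of the complex-valued real-linear forms, with the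
Wirtinger derivatives as coefficients. -/
theorem sum_wirtingerCoeff_mul_wirtingerCoord (A : (Fin m → ℂ) →L[ℝ] ℂ) (v : Fin m → ℂ) :
    A v = ∑ s, wirtingerCoeff s A * wirtingerCoord s v := by
  rw [Fintype.sum_sum_type, ← Finset.sum_add_distrib]
  have hv : v = ∑ j, ((v j).re • (Pi.single j 1 : Fin m → ℂ) +
      (v j).im • (Pi.single j Complex.I : Fin m → ℂ)) := by
    ext i
    rw [Finset.sum_apply, Finset.sum_eq_single i]
    · simp [Complex.re_add_im]
    · intro j _ hj
      simp [hj.symm]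
    · simp
  conv_lhs => rw [hv]
  rw [map_sum]
  refine Finset.sum_congr rfl fun j _ => ?_
  rw [map_add, map_smul, map_smul, wirtingerCoeff_inl, wirtingerCoeff_inr, wirtingerCoord_inl,
    wirtingerCoord_inr, Complex.real_smul, Complex.real_smul]
  set a := A (Pi.single j 1)
  set b := A (Pi.single j Complex.I)
  have h1 : starRingEnd ℂ (v j) = (v j).re - (v j).im * Complex.I := by
    apply Complex.ext <;> simp
  have h2 := (Complex.re_add_im (v j)).symm
  rw [h1]
  generalize (v j).re = x at h2 ⊢
  generalize (v j).im = y at h2 ⊢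
  rw [h2]
  linear_combination (b * y) * Complex.I_sq

theorem wirtingerCoeff_wirtingerCoord (s t : Fin m ⊕ Fin m) :
    wirtingerCoeff s (wirtingerCoord t) = if t = s then 1 else 0 := by
  have h2 : Complex.I * Complex.I = -1 := Complex.I_mul_I
  rcases s with i | i <;> rcases t with j | j <;>
  simp only [wirtingerCoeff_inl, wirtingerCoeff_inr, wirtingerCoord_inl, wirtingerCoord_inr,
    Pi.single_apply, Sum.inl.injEq, Sum.inr.injEq, reduceCtorEq, if_false] <;>
  by_cases h : j = i <;> simp [h]

theorem wirtingerCoeff_const_mul (s : Fin m ⊕ Fin m) (c : ℂ) (A : (Fin m → ℂ) →L[ℝ] ℂ) :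
    wirtingerCoeff s (c • A) = c * wirtingerCoeff s A := by
  rcases s with i | i <;>
  simp only [wirtingerCoeff_inl, wirtingerCoeff_inr, smul_apply,
    smul_eq_mul] <;> ring

theorem wirtingerCoeff_comp (s : Fin m ⊕ Fin m) (A : (Fin k → ℂ) →L[ℝ] ℂ)
    (B : (Fin m → ℂ) →L[ℝ] (Fin k → ℂ)) :
    wirtingerCoeff s (A.comp B) =
      ∑ t, wirtingerCoeff t A * wirtingerCoeff s ((wirtingerCoord t).comp B) := by
  have h : A.comp B = ∑ t, wirtingerCoeff t A • (wirtingerCoord t).comp B := by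
    ext v
    rw [ContinuousLinearMap.comp_apply, sum_wirtingerCoeff_mul_wirtingerCoord,
      sum_apply]
    rfl
  rw [h, map_sum]
  exact Finset.sum_congr rfl fun t _ => wirtingerCoeff_const_mul _ _ _

theorem wirtingerCoeff_conj (A : (Fin m → ℂ) →L[ℝ] ℂ) (s : Fin m ⊕ Fin m) :
    wirtingerCoeff s (Complex.conjCLE.toContinuousLinearMap.comp A) =
      starRingEnd ℂ (wirtingerCoeff s.swap A) := by
  rcases s with i | i <;>
  simp [wirtingerCoeff_inl, wirtingerCoeff_inr, sub_eq_add_neg, map_ofNat]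

/-- Smoothness on a neighbourhood of a point. -/
def SmoothNear {E F : Type*} [NormedAddCommGroup E] [NormedSpace ℝ E] [NormedAddCommGroup F]
    [NormedSpace ℝ F] (f : E → F) (p : E) : Prop :=
  ∀ᶠ z in 𝓝 p, ContDiffAt ℝ ∞ f z

theorem SmoothNear.eventually_differentiableAt {E F : Type*} [NormedAddCommGroup E]
    [NormedSpace ℝ E] [NormedAddCommGroup F] [NormedSpace ℝ F] {f : E → F} {p : E}
    (hf : SmoothNear f p) : ∀ᶠ z in 𝓝 p, DifferentiableAt ℝ f z :=
  hf.mono fun _ hz => hz.differentiableAt (by simp)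

theorem SmoothNear.congr {E F : Type*} [NormedAddCommGroup E]
    [NormedSpace ℝ E] [NormedAddCommGroup F] [NormedSpace ℝ F] {f g : E → F} {p : E}
    (hf : SmoothNear f p) (h : f =ᶠ[𝓝 p] g) : SmoothNear g p := by
  filter_upwards [hf, h.eventuallyEq_nhds] with z hz hz'
  exact hz.congr_of_eventuallyEq hz'.symm

theorem SmoothNear.comp {E F G : Type*} [NormedAddCommGroup E]
    [NormedSpace ℝ E] [NormedAddCommGroup F] [NormedSpace ℝ F] [NormedAddCommGroup G]
    [NormedSpace ℝ G] {f : F → G} {h : E → F} {p : E}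
    (hf : SmoothNear f (h p)) (hh : SmoothNear h p) : SmoothNear (f ∘ h) p := by
  have hc : ContinuousAt h p := (hh.self_of_nhds).continuousAt
  filter_upwards [hc.eventually hf, hh] with z hz hz'
  exact hz.comp z hz'

variable {p : Fin m → ℂ} {f g : (Fin m → ℂ) → ℂ}

theorem SmoothNear.add (hf : SmoothNear f p) (hg : SmoothNear g p) : SmoothNear (f + g) p := by
  filter_upwards [hf, hg] with z h1 h2 using h1.add h2

theorem SmoothNear.mul (hf : SmoothNear f p) (hg : SmoothNear g p) : SmoothNear (f * g) p := by
  filter_upwards [hf, hg] with z h1 h2 using h1.mul h2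

theorem SmoothNear.wirtingerDeriv (hf : SmoothNear f p) (s : Fin m ⊕ Fin m) :
    SmoothNear (wirtingerDeriv s f) p := by
  filter_upwards [hf] with z hz
  have : _root_.wirtingerDeriv s f = wirtingerCoeff s ∘ fderiv ℝ f :=
    funext fun z => wirtingerDeriv_apply s f z
  rw [this]
  exact (wirtingerCoeff s).contDiff.contDiffAt.comp z (hz.fderiv_right (by simp))

theorem wirtingerDeriv_congr (h : f =ᶠ[𝓝 p] g) (s : Fin m ⊕ Fin m) :
    wirtingerDeriv s f =ᶠ[𝓝 p] wirtingerDeriv s g := by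
  filter_upwards [h.fderiv (𝕜 := ℝ)] with z hz
  rw [wirtingerDeriv_apply, wirtingerDeriv_apply, hz]

theorem wirtingerDeriv_add (hf : SmoothNear f p) (hg : SmoothNear g p) (s : Fin m ⊕ Fin m) :
    wirtingerDeriv s (f + g) =ᶠ[𝓝 p] wirtingerDeriv s f + wirtingerDeriv s g := by
  filter_upwards [hf.eventually_differentiableAt, hg.eventually_differentiableAt] with z h1 h2
  rw [Pi.add_apply, wirtingerDeriv_apply, wirtingerDeriv_apply, wirtingerDeriv_apply,
    fderiv_add h1 h2, map_add]

theorem wirtingerDeriv_mul (hf : SmoothNear f p) (hg : SmoothNear g p) (s : Fin m ⊕ Fin m) :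
    wirtingerDeriv s (f * g) =ᶠ[𝓝 p] f * wirtingerDeriv s g + g * wirtingerDeriv s f := by
  filter_upwards [hf.eventually_differentiableAt, hg.eventually_differentiableAt] with z h1 h2
  rw [Pi.add_apply, Pi.mul_apply, Pi.mul_apply, wirtingerDeriv_apply, wirtingerDeriv_apply,
    wirtingerDeriv_apply, fderiv_mul h1 h2, map_add, wirtingerCoeff_const_mul,
    wirtingerCoeff_const_mul]

theorem wirtingerDeriv_const (c : ℂ) (s : Fin m ⊕ Fin m) :
    wirtingerDeriv s (fun _ => c) = (fun _ => 0) := by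
  funext z
  rw [wirtingerDeriv_apply, fderiv_fun_const]
  exact map_zero _

/-- The shift by `q` does not change any derivative; it allows the coordinates of `h` to be centred,
as `HasTaylor.comp` requires. -/
theorem wirtingerDeriv_comp {q : Fin k → ℂ} {f : (Fin k → ℂ) → ℂ} {h : (Fin m → ℂ) → Fin k → ℂ}
    (hf : SmoothNear f (h p)) (hh : SmoothNear h p) (s : Fin m ⊕ Fin m) :
    wirtingerDeriv s (f ∘ h) =ᶠ[𝓝 p] ∑ t, (wirtingerDeriv t f ∘ h) *
      wirtingerDeriv s fun z => wirtingerCoord t (h z - q) := by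
  have hc : ContinuousAt h p := (hh.self_of_nhds).continuousAt
  filter_upwards [hc.eventually hf.eventually_differentiableAt,
    hh.eventually_differentiableAt] with z h1 h2
  rw [wirtingerDeriv_apply, fderiv_comp z h1 h2, wirtingerCoeff_comp, Finset.sum_apply]
  refine Finset.sum_congr rfl fun t _ => ?_
  rw [Pi.mul_apply, Function.comp_apply, wirtingerDeriv_apply, wirtingerDeriv_apply]
  congr 2
  have h3 : HasFDerivAt (fun z => h z - q) (fderiv ℝ h z) z := h2.hasFDerivAt.sub_const q
  exact (((wirtingerCoord t).hasFDerivAt.comp z h3).fderiv).symm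

theorem wirtingerDeriv_comm (hf : SmoothNear f p) (s t : Fin m ⊕ Fin m) :
    wirtingerDeriv s (wirtingerDeriv t f) =ᶠ[𝓝 p] wirtingerDeriv t (wirtingerDeriv s f) := by
  filter_upwards [hf] with z hz
  have hd : DifferentiableAt ℝ (fderiv ℝ f) z :=
    (hz.fderiv_right (m := 1) (WithTop.coe_le_coe.2 (le_top (a := (1 + 1 : ℕ∞))))).differentiableAt (by simp)
  have key : ∀ s t, wirtingerDeriv s (wirtingerDeriv t f) z =
      wirtingerCoeff s ((wirtingerCoeff t).comp (fderiv ℝ (fderiv ℝ f) z)) := by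
    intro s t
    have : wirtingerDeriv t f = wirtingerCoeff t ∘ fderiv ℝ f :=
      funext fun z => wirtingerDeriv_apply t f z
    rw [wirtingerDeriv_apply, this]
    congr 1
    exact ((wirtingerCoeff t).hasFDerivAt.comp z hd.hasFDerivAt).fderiv
  have hsymm : ∀ v w, fderiv ℝ (fderiv ℝ f) z v w = fderiv ℝ (fderiv ℝ f) z w v :=
    (hz.isSymmSndFDerivAt (by simpa using WithTop.coe_le_coe.2 (le_top (a := (2 : ℕ∞)))))
  rw [key, key]
  set B := fderiv ℝ (fderiv ℝ f) z
  rcases s with i | i <;> rcases t with j | j <;>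
  simp only [wirtingerCoeff_inl, wirtingerCoeff_inr, ContinuousLinearMap.comp_apply] <;>
  rw [hsymm (Pi.single i 1) (Pi.single j 1), hsymm (Pi.single i Complex.I) (Pi.single j 1),
    hsymm (Pi.single i 1) (Pi.single j Complex.I),
    hsymm (Pi.single i Complex.I) (Pi.single j Complex.I)] <;> ring

theorem wirtingerDeriv_conj (hf : SmoothNear f p) (s : Fin m ⊕ Fin m) :
    wirtingerDeriv s (fun z => starRingEnd ℂ (f z)) =ᶠ[𝓝 p]
      fun z => starRingEnd ℂ (wirtingerDeriv s.swap f z) := by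
  filter_upwards [hf.eventually_differentiableAt] with z hz
  rw [wirtingerDeriv_apply, wirtingerDeriv_apply]
  have h1 : fderiv ℝ (fun z => starRingEnd ℂ (f z)) z =
      Complex.conjCLE.toContinuousLinearMap.comp (fderiv ℝ f z) :=
    (Complex.conjCLE.toContinuousLinearMap.hasFDerivAt.comp z hz.hasFDerivAt).fderiv
  rw [h1]
  rcases s with j | j
  · exact wirtingerCoeff_conj _ _
  · exact wirtingerCoeff_conj _ _

end Wirtinger

end

noncomputable section

/-! ### Taylor series in `z` and `z̄`, tested by words of derivatives -/

section Taylor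

open MvPowerSeries

variable {m k : ℕ}

/-- Iterated Wirtinger derivatives. -/
def wirtingerWord : List (Fin m ⊕ Fin m) → ((Fin m → ℂ) → ℂ) → (Fin m → ℂ) → ℂ
  | [], f => f
  | s :: w, f => wirtingerWord w (wirtingerDeriv s f)

/-- Iterated formal partial derivatives. -/
def pderivWord {σ : Type*} : List σ → MvPowerSeries σ ℂ → MvPowerSeries σ ℂ
  | [], F => F
  | s :: w, F => pderivWord w (pderiv ℂ s F)

/-- `F` is the Taylor series at `p`, in terms of `z` and `z̄`, of the smooth function `f`. -/
def HasTaylor (f : (Fin m → ℂ) → ℂ) (F : MvPowerSeries (Fin m ⊕ Fin m) ℂ) (p : Fin m → ℂ) : Prop :=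
  SmoothNear f p ∧ ∀ w, wirtingerWord w f p = constantCoeff (pderivWord w F)

theorem pderivWord_add {σ : Type*} (w : List σ) (F G : MvPowerSeries σ ℂ) :
    pderivWord w (F + G) = pderivWord w F + pderivWord w G := by
  induction w generalizing F G with
  | nil => rfl
  | cons s w ih => rw [pderivWord, map_add, ih]; rfl

theorem pderivWord_zero {σ : Type*} (w : List σ) : pderivWord w (0 : MvPowerSeries σ ℂ) = 0 := by
  induction w with
  | nil => rfl
  | cons s w ih => rw [pderivWord, map_zero, ih]

open Nat in
theorem prod_factorial_mul_coeff_pderivWord {σ : Type*} [Fintype σ] [DecidableEq σ] (w : List σ)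
    (F : MvPowerSeries σ ℂ) (x : σ →₀ ℕ) :
    (∏ s, ((x s)! : ℂ)) * coeff x (pderivWord w F) =
      (∏ s, (((x + Multiset.toFinsupp (w : Multiset σ)) s)! : ℂ)) *
        coeff (x + Multiset.toFinsupp (w : Multiset σ)) F := by
  induction w generalizing F with
  | nil => simp [pderivWord]
  | cons t w ih =>
    rw [pderivWord, ih, coeff_pderiv]
    set y : σ →₀ ℕ := x + Multiset.toFinsupp (w : Multiset σ) with hy
    have h1 : x + Multiset.toFinsupp ((t :: w : List σ) : Multiset σ) = y + Finsupp.single t 1 := by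
      rw [← Multiset.cons_coe, ← Multiset.singleton_add, Multiset.toFinsupp_add,
        Multiset.toFinsupp_singleton, hy]
      abel
    rw [h1]
    have h2 : ∏ s, (((y + Finsupp.single t 1 : σ →₀ ℕ) s)! : ℂ) = (∏ s, ((y s)! : ℂ)) * (y t + 1) := by
      rw [← Finset.mul_prod_erase Finset.univ _ (Finset.mem_univ t),
        ← Finset.mul_prod_erase Finset.univ (fun s => ((y s)! : ℂ)) (Finset.mem_univ t)]
      have h3 : ∏ s ∈ Finset.univ.erase t, (((y + Finsupp.single t 1 : σ →₀ ℕ) s)! : ℂ) =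
          ∏ s ∈ Finset.univ.erase t, ((y s)! : ℂ) := by
        refine Finset.prod_congr rfl fun s hs => ?_
        rw [Finsupp.add_apply, Finsupp.single_eq_of_ne (Finset.ne_of_mem_erase hs), add_zero]
      rw [h3, Finsupp.add_apply, Finsupp.single_eq_same, Nat.factorial_succ]
      push_cast
      ring
    rw [h2]
    ring

open Nat in
-- A word enters only through the multiset of its letters, so testing a series on words amounts to
-- testing its coefficients.
theorem constantCoeff_pderivWord {σ : Type*} [Fintype σ] [DecidableEq σ] (w : List σ)
    (F : MvPowerSeries σ ℂ) :
    constantCoeff (pderivWord w F) =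
      (∏ s, ((Multiset.toFinsupp (w : Multiset σ) s)! : ℂ)) *
        coeff (Multiset.toFinsupp (w : Multiset σ)) F := by
  have := prod_factorial_mul_coeff_pderivWord w F 0
  simpa using this

theorem eq_zero_of_constantCoeff_pderivWord {σ : Type*} [Fintype σ] {F : MvPowerSeries σ ℂ}
    (h : ∀ w, constantCoeff (pderivWord w F) = 0) : F = 0 := by
  classical
  ext x
  have h1 := h (Finsupp.toMultiset x).toList
  rw [constantCoeff_pderivWord, Multiset.coe_toList, Finsupp.toMultiset_toFinsupp] at h1
  refine (mul_eq_zero.1 h1).resolve_left (Finset.prod_ne_zero_iff.2 fun s _ => ?_)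
  exact_mod_cast Nat.factorial_ne_zero _

theorem constantCoeff_pderivWord_of_lt_order {σ : Type*} [Fintype σ] {F : MvPowerSeries σ ℂ}
    {w : List σ} (h : (w.length : ℕ∞) < F.order) : constantCoeff (pderivWord w F) = 0 := by
  classical
  rw [constantCoeff_pderivWord, coeff_of_lt_order, mul_zero]
  refine lt_of_eq_of_lt ?_ h
  congr 1
  rw [Finsupp.degree_apply]
  change Finsupp.sum _ (fun _ => id) = _
  rw [← Finsupp.card_toMultiset, Multiset.toFinsupp_toMultiset, Multiset.coe_card]

variable {p : Fin m → ℂ} {f g : (Fin m → ℂ) → ℂ} {F G : MvPowerSeries (Fin m ⊕ Fin m) ℂ}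

theorem wirtingerWord_congr (w : List (Fin m ⊕ Fin m)) (h : f =ᶠ[𝓝 p] g) :
    wirtingerWord w f =ᶠ[𝓝 p] wirtingerWord w g := by
  induction w generalizing f g with
  | nil => exact h
  | cons s w ih => exact ih (wirtingerDeriv_congr h s)

theorem wirtingerWord_add (w : List (Fin m ⊕ Fin m)) (hf : SmoothNear f p) (hg : SmoothNear g p) :
    wirtingerWord w (f + g) =ᶠ[𝓝 p] wirtingerWord w f + wirtingerWord w g := by
  induction w generalizing f g with
  | nil => exact .rfl
  | cons s w ih =>
    exact (wirtingerWord_congr w (wirtingerDeriv_add hf hg s)).trans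
      (ih (hf.wirtingerDeriv s) (hg.wirtingerDeriv s))

theorem wirtingerWord_perm {w w' : List (Fin m ⊕ Fin m)} (h : w.Perm w') (hf : SmoothNear f p) :
    wirtingerWord w f =ᶠ[𝓝 p] wirtingerWord w' f := by
  induction h generalizing f with
  | nil => exact .rfl
  | cons s _ ih => exact ih (hf.wirtingerDeriv s)
  | swap s t w => exact wirtingerWord_congr w (wirtingerDeriv_comm hf s t)
  | trans _ _ ih1 ih2 => exact (ih1 hf).trans (ih2 hf)

theorem HasTaylor.congr (h : HasTaylor f F p) (hfg : f =ᶠ[𝓝 p] g) : HasTaylor g F p :=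
  ⟨h.1.congr hfg, fun w => ((wirtingerWord_congr w hfg).eq_of_nhds).symm.trans (h.2 w)⟩

theorem HasTaylor.wirtingerDeriv (h : HasTaylor f F p) (s : Fin m ⊕ Fin m) :
    HasTaylor (wirtingerDeriv s f) (pderiv ℂ s F) p :=
  ⟨h.1.wirtingerDeriv s, fun w => h.2 (s :: w)⟩

theorem HasTaylor.apply_eq (h : HasTaylor f F p) : f p = constantCoeff F := h.2 []

theorem HasTaylor.add (hf : HasTaylor f F p) (hg : HasTaylor g G p) : HasTaylor (f + g) (F + G) p :=
  ⟨hf.1.add hg.1, fun w => by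
    rw [(wirtingerWord_add w hf.1 hg.1).eq_of_nhds, Pi.add_apply, hf.2, hg.2, pderivWord_add,
      map_add]⟩

theorem HasTaylor.mul (hf : HasTaylor f F p) (hg : HasTaylor g G p) :
    HasTaylor (f * g) (F * G) p := by
  refine ⟨hf.1.mul hg.1, fun w => ?_⟩
  induction w generalizing f g F G with
  | nil =>
    change f p * g p = _
    rw [hf.apply_eq, hg.apply_eq, ← map_mul]
    rfl
  | cons s w ih =>
    have h1 := wirtingerWord_add w (hf.1.mul (hg.1.wirtingerDeriv s))
      (hg.1.mul (hf.1.wirtingerDeriv s))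
    have h2 := wirtingerWord_congr w (wirtingerDeriv_mul hf.1 hg.1 s)
    change wirtingerWord w (_root_.wirtingerDeriv s (f * g)) p = _
    rw [h2.eq_of_nhds, h1.eq_of_nhds, Pi.add_apply, ih hf (hg.wirtingerDeriv s),
      ih hg (hf.wirtingerDeriv s), pderivWord, Derivation.leibniz, pderivWord_add, map_add]
    rfl

theorem wirtingerWord_zero (w : List (Fin m ⊕ Fin m)) :
    wirtingerWord w (fun _ => 0) = fun _ => 0 := by
  induction w with
  | nil => rfl
  | cons s w ih => rw [wirtingerWord, wirtingerDeriv_const, ih]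

theorem hasTaylor_const (c : ℂ) : HasTaylor (fun _ => c) (C c) p := by
  refine ⟨Filter.Eventually.of_forall fun _ => contDiffAt_const, fun w => ?_⟩
  cases w with
  | nil => simp [wirtingerWord, pderivWord]
  | cons s w =>
    rw [wirtingerWord, wirtingerDeriv_const, wirtingerWord_zero, pderivWord, pderiv_C,
      pderivWord_zero, map_zero]

theorem HasTaylor.neg (hf : HasTaylor f F p) : HasTaylor (-f) (-F) p := by
  have h := (hasTaylor_const (p := p) (-1)).mul hf
  have h1 : (C (-1) : MvPowerSeries (Fin m ⊕ Fin m) ℂ) * F = -F := by simp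
  rw [h1] at h
  exact h.congr (Filter.Eventually.of_forall fun z => by simp)

theorem HasTaylor.sub (hf : HasTaylor f F p) (hg : HasTaylor g G p) :
    HasTaylor (f - g) (F - G) p := by
  rw [sub_eq_add_neg, sub_eq_add_neg]
  exact hf.add hg.neg

theorem HasTaylor.sum {ι : Type*} {f : ι → (Fin m → ℂ) → ℂ}
    {F : ι → MvPowerSeries (Fin m ⊕ Fin m) ℂ} {s : Finset ι} (h : ∀ i ∈ s, HasTaylor (f i) (F i) p) :
    HasTaylor (∑ i ∈ s, f i) (∑ i ∈ s, F i) p := by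
  classical
  induction s using Finset.induction_on with
  | empty =>
    have := hasTaylor_const (p := p) 0
    rw [map_zero] at this
    exact this
  | insert i s hi ih =>
    rw [Finset.sum_insert hi, Finset.sum_insert hi]
    exact (h i (Finset.mem_insert_self i s)).add (ih fun j hj => h j (Finset.mem_insert_of_mem hj))

theorem HasTaylor.prod {ι : Type*} {f : ι → (Fin m → ℂ) → ℂ}
    {F : ι → MvPowerSeries (Fin m ⊕ Fin m) ℂ} {s : Finset ι} (h : ∀ i ∈ s, HasTaylor (f i) (F i) p) :
    HasTaylor (∏ i ∈ s, f i) (∏ i ∈ s, F i) p := by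
  classical
  induction s using Finset.induction_on with
  | empty =>
    have := hasTaylor_const (p := p) 1
    rw [map_one] at this
    exact this
  | insert i s hi ih =>
    rw [Finset.prod_insert hi, Finset.prod_insert hi]
    exact (h i (Finset.mem_insert_self i s)).mul (ih fun j hj => h j (Finset.mem_insert_of_mem hj))

theorem HasTaylor.det {n : ℕ} {A : Fin n → Fin n → (Fin m → ℂ) → ℂ}
    {B : Matrix (Fin n) (Fin n) (MvPowerSeries (Fin m ⊕ Fin m) ℂ)}
    (h : ∀ i j, HasTaylor (A i j) (B i j) p) :
    HasTaylor (fun z => (Matrix.of fun i j => A i j z).det) B.det p := by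
  rw [Matrix.det_apply']
  have h1 := HasTaylor.sum (p := p) (s := Finset.univ)
    (f := fun τ : Equiv.Perm (Fin n) => (fun _ => ((Equiv.Perm.sign τ : ℤ) : ℂ)) *
      ∏ i, A (τ i) i)
    (F := fun τ => ((Equiv.Perm.sign τ : ℤ) : MvPowerSeries (Fin m ⊕ Fin m) ℂ) * ∏ i, B (τ i) i)
    (fun τ _ => by
      refine HasTaylor.mul ?_ (HasTaylor.prod fun i _ => h _ _)
      have := hasTaylor_const (p := p) ((Equiv.Perm.sign τ : ℤ) : ℂ)
      rwa [map_intCast] at this)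
  refine h1.congr (Filter.Eventually.of_forall fun z => ?_)
  simp only [Matrix.det_apply', Finset.sum_apply, Pi.mul_apply, Finset.prod_apply, Matrix.of_apply]

theorem HasTaylor.conj (hf : HasTaylor f F p) :
    HasTaylor (fun z => starRingEnd ℂ (f z)) (hermConj F) p := by
  refine ⟨?_, fun w => ?_⟩
  · filter_upwards [hf.1] with z hz
    exact Complex.conjCLE.contDiff.contDiffAt.comp z hz
  induction w generalizing f F with
  | nil =>
    change starRingEnd ℂ (f p) = constantCoeff (hermConj F)
    rw [hf.apply_eq, hermConj, constantCoeff_rename, constantCoeff_map]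
  | cons s w ih =>
    have h1 := ih (hf.wirtingerDeriv s.swap)
    change wirtingerWord w (_root_.wirtingerDeriv s (fun z => starRingEnd ℂ (f z))) p = _
    rw [(wirtingerWord_congr w (wirtingerDeriv_conj hf.1 s)).eq_of_nhds, h1, pderivWord]
    have h2 := pderiv_rename_self (e := Sum.swap) (Sum.swap_leftInverse.injective)
      (MvPowerSeries.map (starRingEnd ℂ) F) s.swap
    rw [Sum.swap_swap] at h2
    rw [hermConj, hermConj, h2, pderiv_map]

theorem HasTaylor.unique (hF : HasTaylor f F p) (hG : HasTaylor f G p) : F = G := by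
  rw [← sub_eq_zero]
  have h := hF.sub hG
  refine eq_zero_of_constantCoeff_pderivWord fun w => ?_
  rw [← h.2 w, sub_self]
  exact congrFun (wirtingerWord_zero w) p

theorem hasTaylor_coord (s : Fin m ⊕ Fin m) :
    HasTaylor (fun z => wirtingerCoord s (z - p)) (X s) p := by
  have hd : ∀ z, HasFDerivAt (fun z => wirtingerCoord s (z - p)) (wirtingerCoord s) z := fun z =>
    (wirtingerCoord s).hasFDerivAt.comp z ((hasFDerivAt_id z).sub_const p)
  refine ⟨Filter.Eventually.of_forall fun z =>
    (wirtingerCoord s).contDiff.contDiffAt.comp z (contDiffAt_id.sub contDiffAt_const), fun w => ?_⟩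
  cases w with
  | nil => simp [wirtingerWord, pderivWord]
  | cons t w =>
    have h1 : wirtingerDeriv t (fun z => wirtingerCoord s (z - p)) =
        fun _ => if s = t then 1 else 0 := by
      funext z
      rw [wirtingerDeriv_apply, (hd z).fderiv, wirtingerCoeff_wirtingerCoord]
    rw [wirtingerWord, pderivWord, h1, (hasTaylor_const (p := p) _).2]
    congr 2
    split_ifs with hst
    · subst hst
      rw [pderiv_X_self, map_one]
    · rw [pderiv_X_of_ne hst, map_zero]

/-- The smooth and the formal chain rule have the same shape, so the derivatives along each word
agree by induction. -/
theorem HasTaylor.comp {f : (Fin k → ℂ) → ℂ} {F : MvPowerSeries (Fin k ⊕ Fin k) ℂ}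
    {h : (Fin m → ℂ) → Fin k → ℂ} {A : Fin k ⊕ Fin k → MvPowerSeries (Fin m ⊕ Fin m) ℂ}
    (hf : HasTaylor f F (h p)) (hh : SmoothNear h p)
    (hA : ∀ t, HasTaylor (fun z => wirtingerCoord t (h z - h p)) (A t) p) :
    HasTaylor (f ∘ h) (subst A F) p := by
  have hA0 : ∀ t, constantCoeff (A t) = 0 := by
    intro t
    rw [← (hA t).apply_eq, sub_self, map_zero]
  refine ⟨hf.1.comp hh, fun w => ?_⟩
  -- The extra factor `g` absorbs the derivatives of the inner map, so that the chain rule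
  -- reproduces statements of the same form.
  have key : ∀ (w : List (Fin m ⊕ Fin m)) (f : (Fin k → ℂ) → ℂ)
      (F : MvPowerSeries (Fin k ⊕ Fin k) ℂ) (g : (Fin m → ℂ) → ℂ)
      (G : MvPowerSeries (Fin m ⊕ Fin m) ℂ), HasTaylor f F (h p) → HasTaylor g G p →
      wirtingerWord w ((f ∘ h) * g) p = constantCoeff (pderivWord w (subst A F * G)) := by
    intro w
    induction w with
    | nil =>
      intro f F g G hf hg
      change f (h p) * g p = constantCoeff (_ * _)
      rw [map_mul, constantCoeff_subst_of_constantCoeff_eq_zero hA0, hf.apply_eq, hg.apply_eq]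
    | cons s w ih =>
      intro f F g G hf hg
      have hsum : ∀ (S : Finset (Fin k ⊕ Fin k)) (φ : Fin k ⊕ Fin k → (Fin m → ℂ) → ℂ),
          (∀ t, SmoothNear (φ t) p) → SmoothNear (∑ t ∈ S, φ t) p ∧
          wirtingerWord w (∑ t ∈ S, φ t) p = ∑ t ∈ S, wirtingerWord w (φ t) p := by
        classical
        intro S φ hφ
        induction S using Finset.induction_on with
        | empty =>
          refine ⟨Filter.Eventually.of_forall fun _ => contDiffAt_const, ?_⟩
          rw [Finset.sum_empty, Finset.sum_empty]
          exact congrFun (wirtingerWord_zero w) p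
        | insert i S hi ih =>
          rw [Finset.sum_insert hi, Finset.sum_insert hi]
          exact ⟨(hφ i).add ih.1, by
            rw [(wirtingerWord_add w (hφ i) ih.1).eq_of_nhds, Pi.add_apply, ih.2]⟩
      have h1 : _root_.wirtingerDeriv s ((f ∘ h) * g) =ᶠ[𝓝 p]
          (f ∘ h) * _root_.wirtingerDeriv s g + ∑ t, (_root_.wirtingerDeriv t f ∘ h) *
            ((_root_.wirtingerDeriv s fun z => wirtingerCoord t (h z - h p)) * g) := by
        refine (wirtingerDeriv_mul (hf.1.comp hh) hg.1 s).trans ?_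
        filter_upwards [wirtingerDeriv_comp (q := h p) hf.1 hh s] with z hz
        rw [Pi.add_apply, Pi.add_apply, Pi.mul_apply, Pi.mul_apply, hz,
          Finset.sum_apply, Finset.sum_apply, Finset.mul_sum]
        congr 1
        refine Finset.sum_congr rfl fun t _ => ?_
        simp only [Pi.mul_apply]
        ring
      have hsm : ∀ t, SmoothNear ((_root_.wirtingerDeriv t f ∘ h) *
            ((_root_.wirtingerDeriv s fun z => wirtingerCoord t (h z - h p)) * g)) p := fun t =>
        ((hf.1.wirtingerDeriv t).comp hh).mul (((hA t).1.wirtingerDeriv s).mul hg.1)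
      obtain ⟨hs1, hs2⟩ := hsum Finset.univ _ hsm
      change wirtingerWord w (_root_.wirtingerDeriv s ((f ∘ h) * g)) p = _
      rw [(wirtingerWord_congr w h1).eq_of_nhds,
        (wirtingerWord_add w ((hf.1.comp hh).mul (hg.1.wirtingerDeriv s)) hs1).eq_of_nhds,
        Pi.add_apply, hs2, ih f F _ _ hf (hg.wirtingerDeriv s)]
      have h2 : ∀ t, wirtingerWord w ((_root_.wirtingerDeriv t f ∘ h) *
            ((_root_.wirtingerDeriv s fun z => wirtingerCoord t (h z - h p)) * g)) p =
          constantCoeff (pderivWord w (subst A (pderiv ℂ t F) * (pderiv ℂ s (A t) * G))) := fun t =>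
        ih _ _ _ _ (hf.wirtingerDeriv t) (((hA t).wirtingerDeriv s).mul hg)
      simp only [h2]
      rw [← map_sum, ← map_add, pderivWord, Derivation.leibniz, pderivWord_add, pderiv_subst hA0]
      congr 2
      simp only [smul_eq_mul, Finset.mul_sum]
      have h3 : ∀ (S : Finset (Fin k ⊕ Fin k)) (φ : Fin k ⊕ Fin k →
          MvPowerSeries (Fin m ⊕ Fin m) ℂ),
          pderivWord w (∑ t ∈ S, φ t) = ∑ t ∈ S, pderivWord w (φ t) := by
        classical
        intro S φ
        induction S using Finset.induction_on with
        | empty => rw [Finset.sum_empty, Finset.sum_empty, pderivWord_zero]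
        | insert i S hi ih => rw [Finset.sum_insert hi, Finset.sum_insert hi, pderivWord_add, ih]
      rw [h3]
      refine Finset.sum_congr rfl fun t _ => ?_
      congr 1
      ring
  have h1 := key w f F (fun _ => 1) 1 hf (by simpa using hasTaylor_const (p := p) 1)
  rw [mul_one] at h1
  rw [← h1]
  congr 1
  funext z
  simp

open Nat in
theorem exists_hasTaylor (hf : SmoothNear f p) : ∃ F, HasTaylor f F p := by
  classical
  -- Each coefficient is read off from one ordering of the derivatives; by `wirtingerWord_perm` the
  -- ordering is immaterial.
  let F : MvPowerSeries (Fin m ⊕ Fin m) ℂ := fun x =>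
    (∏ s, ((x s)! : ℂ))⁻¹ * wirtingerWord (Finsupp.toMultiset x).toList f p
  have hF : ∀ x, coeff x F =
    (∏ s, ((x s)! : ℂ))⁻¹ * wirtingerWord (Finsupp.toMultiset x).toList f p := fun _ => rfl
  refine ⟨F, hf, fun w => ?_⟩
  rw [constantCoeff_pderivWord, hF, mul_inv_cancel_left₀, Multiset.toFinsupp_toMultiset]
  · refine (wirtingerWord_perm ?_ hf).eq_of_nhds
    rw [← Multiset.coe_eq_coe, Multiset.coe_toList]
  · exact Finset.prod_ne_zero_iff.2 fun s _ => by exact_mod_cast Nat.factorial_ne_zero _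

end Taylor

end

noncomputable section

/-! ### Formal division by the defining function of a smooth hypersurface -/

section Division

open MvPowerSeries

variable {m : ℕ} {p : Fin m → ℂ}

theorem HasTaylor.eventually_ne_zero {f : (Fin m → ℂ) → ℂ} {F}
    (hf : HasTaylor f F p) (h : constantCoeff F ≠ 0) : ∀ᶠ z in 𝓝 p, f z ≠ 0 := by
  have hc : ContinuousAt f p := hf.1.self_of_nhds.continuousAt
  exact hc.eventually_ne (by rwa [hf.apply_eq])

theorem HasTaylor.exists_inv {f : (Fin m → ℂ) → ℂ} {F}
    (hf : HasTaylor f F p) (h : constantCoeff F ≠ 0) :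
    ∃ G, HasTaylor (fun z => (f z)⁻¹) G p ∧ F * G = 1 := by
  have hne := hf.eventually_ne_zero h
  have hs : SmoothNear (fun z => (f z)⁻¹) p := by
    filter_upwards [hf.1, hne] with z h1 h2 using h1.inv h2
  obtain ⟨G, hG⟩ := exists_hasTaylor hs
  refine ⟨G, hG, ((hf.mul hG).congr ?_).unique (by simpa using hasTaylor_const (p := p) 1)⟩
  filter_upwards [hne] with z hz using mul_inv_cancel₀ hz

/-- Lagrange multipliers: near `z` the function `φ` is constant on the zero set of `ρ`, so `z` is
trivially an extremum, and `dρ ≠ 0` makes the multiplier of `dφ` nonzero. -/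
theorem fderiv_eq_smul_of_eq_zero {E : Type*} [NormedAddCommGroup E] [NormedSpace ℝ E]
    [CompleteSpace E] {ρ φ : E → ℝ} {z : E} (hρ : ContDiffAt ℝ ∞ ρ z) (hφ : ContDiffAt ℝ ∞ φ z)
    (hρz : ρ z = 0) (hd : fderiv ℝ ρ z ≠ 0) (h : ∀ᶠ x in 𝓝 z, ρ x = 0 → φ x = 0) :
    ∃ c : ℝ, fderiv ℝ φ z = c • fderiv ℝ ρ z := by
  have hext : IsLocalExtrOn φ {x | ρ x = ρ z} z := by
    left
    have h0 := h.self_of_nhds hρz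
    refine eventually_nhdsWithin_iff.2 (h.mono fun x hx hxz => ?_)
    rw [h0, hx (Eq.trans hxz hρz)]
  obtain ⟨a, b, hab, h1⟩ := hext.exists_multipliers_of_hasStrictFDerivAt_1d
    (hρ.hasStrictFDerivAt (by simp)) (hφ.hasStrictFDerivAt (by simp))
  have hb : b ≠ 0 := by
    rintro rfl
    rw [zero_smul, add_zero, smul_eq_zero, or_iff_left hd] at h1
    exact hab (by rw [h1]; rfl)
  refine ⟨-(b⁻¹ * a), ?_⟩
  rw [neg_smul, mul_smul, eq_neg_of_add_eq_zero_left h1, smul_neg, neg_neg, smul_smul,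
    inv_mul_cancel₀ hb, one_smul]

theorem fderiv_eq_smul_ofReal_of_eq_zero {E : Type*} [NormedAddCommGroup E] [NormedSpace ℝ E]
    [CompleteSpace E] {ρ : E → ℝ} {φ : E → ℂ} {z : E} (hρ : ContDiffAt ℝ ∞ ρ z)
    (hφ : ContDiffAt ℝ ∞ φ z) (hρz : ρ z = 0) (hd : fderiv ℝ ρ z ≠ 0)
    (h : ∀ᶠ x in 𝓝 z, ρ x = 0 → φ x = 0) :
    ∃ c : ℂ, fderiv ℝ φ z = c • fderiv ℝ (fun x => (ρ x : ℂ)) z := by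
  have hφd : DifferentiableAt ℝ φ z := hφ.differentiableAt (by simp)
  have hρd : DifferentiableAt ℝ ρ z := hρ.differentiableAt (by simp)
  have hre := (Complex.reCLM.hasFDerivAt.comp z hφd.hasFDerivAt).fderiv
  have him := (Complex.imCLM.hasFDerivAt.comp z hφd.hasFDerivAt).fderiv
  have hof := (Complex.ofRealCLM.hasFDerivAt.comp z hρd.hasFDerivAt).fderiv
  obtain ⟨a, ha⟩ := fderiv_eq_smul_of_eq_zero (φ := Complex.reCLM ∘ φ) hρ
    (Complex.reCLM.contDiff.contDiffAt.comp z hφ) hρz hd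
    (h.mono fun x hx hx' => by simp [hx hx'])
  obtain ⟨b, hb⟩ := fderiv_eq_smul_of_eq_zero (φ := Complex.imCLM ∘ φ) hρ
    (Complex.imCLM.contDiff.contDiffAt.comp z hφ) hρz hd
    (h.mono fun x hx hx' => by simp [hx hx'])
  refine ⟨⟨a, b⟩, ?_⟩
  change _ = _ • fderiv ℝ (Complex.ofRealCLM ∘ ρ) z
  rw [hof]
  ext v
  rw [hre] at ha
  rw [him] at hb
  have ha' := congrArg (fun A => A v) ha
  have hb' := congrArg (fun A => A v) hb
  simp at ha' hb'
  apply Complex.ext <;> simp [ha', hb']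

/-- Modulo `R`, `Φ` is a series `r` in the variables other than `t`. The complex vector fields `∂_s
- (ρ_s / ρ_t) ∂_t` annihilate `ρ`; they preserve vanishing on `ρ = 0` and act on `r` as `∂_s`. Hence
all derivatives of `r` vanish at `0`. -/
theorem dvd_of_hasTaylor_of_eq_zero {ρ : (Fin m → ℂ) → ℝ} {φ : (Fin m → ℂ) → ℂ}
    {R Φ : MvPowerSeries (Fin m ⊕ Fin m) ℂ} {t : Fin m ⊕ Fin m}
    (hρs : SmoothNear ρ p) (hρ : HasTaylor (fun z => (ρ z : ℂ)) R p) (hρp : ρ p = 0)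
    (ht : coeff (Finsupp.single t 1) R ≠ 0) (hφ : HasTaylor φ Φ p)
    (hz : ∀ᶠ z in 𝓝 p, ρ z = 0 → φ z = 0) : R ∣ Φ := by
  classical
  have hR0 : constantCoeff R = 0 := by rw [← hρ.apply_eq, hρp, Complex.ofReal_zero]
  obtain ⟨π, hπ1, hπ2, -⟩ := exists_ringHom_ker_eq_span t hR0 ht
  have htR : constantCoeff (pderiv ℂ t R) ≠ 0 := by
    rw [← coeff_zero_eq_constantCoeff, coeff_pderiv]
    simpa using ht
  have hdρ := (hρ.wirtingerDeriv t).eventually_ne_zero htR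
  obtain ⟨V, hV, hRV⟩ := (hρ.wirtingerDeriv t).exists_inv htR
  -- `Q r`: modulo `R`, `r` is the Taylor series of a smooth function vanishing on `ρ = 0`.
  let Q : MvPowerSeries {x // x ≠ t} ℂ → Prop := fun r => ∃ (c : MvPowerSeries (Fin m ⊕ Fin m) ℂ)
    (f : (Fin m → ℂ) → ℂ), HasTaylor f (rename Subtype.val r + c * R) p ∧
      ∀ᶠ z in 𝓝 p, ρ z = 0 → f z = 0
  have hQ0 : ∀ r, Q r → constantCoeff r = 0 := by
    rintro r ⟨c, f, hf, hfz⟩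
    have := hf.apply_eq
    rwa [hfz.self_of_nhds hρp, map_add, map_mul, hR0, mul_zero, add_zero, constantCoeff_rename,
      eq_comm] at this
  have hQ1 : ∀ s r, Q r → Q (pderiv ℂ s r) := by
    rintro s r ⟨c, f, hf, hfz⟩
    have hT := (hf.wirtingerDeriv s.1).sub ((hV.mul (hρ.wirtingerDeriv s.1)).mul
      (hf.wirtingerDeriv t))
    have hE : pderiv ℂ s.1 (rename Subtype.val r + c * R) -
        V * pderiv ℂ s.1 R * pderiv ℂ t (rename Subtype.val r + c * R) =
        rename Subtype.val (pderiv ℂ s r) +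
          (pderiv ℂ s.1 c - V * pderiv ℂ s.1 R * pderiv ℂ t c) * R := by
      rw [map_add, map_add, pderiv_rename_self Subtype.val_injective,
        pderiv_rename_of_notMem_range r (j := t) (by simp), Derivation.leibniz, Derivation.leibniz]
      simp only [smul_eq_mul]
      linear_combination (-c * pderiv ℂ s.1 R) * hRV
    rw [hE] at hT
    refine ⟨_, _, hT, ?_⟩
    filter_upwards [hf.1, hρs, hdρ, hfz.eventually_nhds] with z h1 h2 h3 h4 h5
    have hd : fderiv ℝ ρ z ≠ 0 := by
      intro h0
      apply h3
      have := (Complex.ofRealCLM.hasFDerivAt.comp z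
        (h2.differentiableAt (by simp)).hasFDerivAt).fderiv
      rw [h0, ContinuousLinearMap.comp_zero] at this
      rw [wirtingerDeriv_apply]
      change wirtingerCoeff t (fderiv ℝ (Complex.ofRealCLM ∘ ρ) z) = 0
      rw [this, map_zero]
    -- On the hypersurface `df` is a multiple of `dρ`, so the tangential derivative of `f` vanishes
    -- there.
    obtain ⟨a, ha⟩ := fderiv_eq_smul_ofReal_of_eq_zero h2 h1 h5 hd h4
    simp only [Pi.sub_apply, Pi.mul_apply]
    rw [wirtingerDeriv_apply s.1 f, wirtingerDeriv_apply t f, ha, wirtingerCoeff_const_mul,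
      wirtingerCoeff_const_mul, ← wirtingerDeriv_apply, ← wirtingerDeriv_apply]
    field_simp
    ring
  have hQ : ∀ w r, Q r → constantCoeff (pderivWord w r) = 0 := by
    intro w
    induction w with
    | nil => exact hQ0
    | cons s w ih => exact fun r hr => ih _ (hQ1 s r hr)
  have hr : π Φ = 0 := by
    refine eq_zero_of_constantCoeff_pderivWord fun w => hQ w _ ?_
    obtain ⟨c, hc⟩ := (hπ2 (Φ - rename Subtype.val (π Φ))).1 (by rw [map_sub, hπ1, sub_self])
    refine ⟨c, φ, ?_, hz⟩
    rw [mul_comm, ← hc]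
    simpa using hφ
  exact (hπ2 Φ).1 hr

end Division

end

noncomputable section

/-! ### Order of vanishing, holomorphic Taylor series and polynomial approximation -/

section Estimate

open MvPowerSeries

variable {m : ℕ} {p : Fin m → ℂ}

/-- Induction on `K`: the mean value inequality on balls around `p` gains one power over the bound
for the first derivatives. -/
theorem isBigO_of_wirtingerWord_eq_zero {f : (Fin m → ℂ) → ℂ} {K : ℕ} (hf : SmoothNear f p)
    (h : ∀ w : List (Fin m ⊕ Fin m), w.length < K → wirtingerWord w f p = 0) :
    f =O[𝓝 p] fun z => ‖z - p‖ ^ K := by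
  induction K generalizing f with
  | zero =>
    simp only [pow_zero]
    exact hf.self_of_nhds.continuousAt.isBigO_one ℝ
  | succ K ih =>
    have h1 : ∀ s, wirtingerDeriv s f =O[𝓝 p] fun z => ‖z - p‖ ^ K := fun s =>
      ih (hf.wirtingerDeriv s) fun w hw => h (s :: w) (by simpa using hw)
    have h2 : fderiv ℝ f =O[𝓝 p] fun z => ‖z - p‖ ^ K := by
      have h3 : ∀ z, fderiv ℝ f z = ∑ s, wirtingerDeriv s f z • wirtingerCoord s := by
        intro z
        ext v
        rw [sum_wirtingerCoeff_mul_wirtingerCoord, sum_apply]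
        simp only [smul_apply, smul_eq_mul, wirtingerDeriv_apply]
      rw [show fderiv ℝ f = fun z => ∑ s, wirtingerDeriv s f z • wirtingerCoord s from funext h3]
      have h4 : ∀ s ∈ Finset.univ, (fun z => wirtingerDeriv s f z •
          (wirtingerCoord s : (Fin m → ℂ) →L[ℝ] ℂ)) =O[𝓝 p] fun z => ‖z - p‖ ^ K := fun s _ => by
        refine ((h1 s).norm_left.const_mul_left
          ‖(wirtingerCoord s : (Fin m → ℂ) →L[ℝ] ℂ)‖).congr_left (fun z => ?_) |>.of_norm_left
        rw [norm_smul, mul_comm]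
      exact (Asymptotics.IsBigO.sum h4).congr_left fun z => Finset.sum_apply _ _ _
    obtain ⟨c, hc⟩ := h2.bound
    obtain ⟨r, hr, hball⟩ := Metric.eventually_nhds_iff_ball.1
      (hc.and hf.eventually_differentiableAt)
    refine Asymptotics.IsBigO.of_bound c ?_
    filter_upwards [Metric.ball_mem_nhds p hr] with z hz
    have hsub : Metric.closedBall p ‖z - p‖ ⊆ Metric.ball p r :=
      Metric.closedBall_subset_ball (by rwa [← dist_eq_norm])
    have hc0 : 0 ≤ c * ‖‖z - p‖ ^ K‖ := (norm_nonneg _).trans (hball z hz).1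
    have hb : ∀ x ∈ Metric.closedBall p ‖z - p‖, ‖fderiv ℝ f x‖ ≤ |c| * ‖z - p‖ ^ K := by
      intro x hx
      refine (hball x (hsub hx)).1.trans ?_
      rw [norm_pow, norm_norm]
      refine mul_le_mul (le_abs_self c) ?_ (by positivity) (abs_nonneg c)
      exact pow_le_pow_left₀ (norm_nonneg _) (by rwa [← dist_eq_norm]) K
    have h4 := (convex_closedBall p ‖z - p‖).norm_image_sub_le_of_norm_fderiv_le (𝕜 := ℝ)
      (fun x hx => (hball x (hsub hx)).2) hb
      (Metric.mem_closedBall_self (norm_nonneg _)) (by simp [dist_eq_norm] : z ∈ _)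
    have h5 : f p = 0 := h [] (by simp)
    rw [h5, sub_zero] at h4
    -- The constant of an `O`-bound may be negative, but then the bound itself forces `z = p`.
    have h6 : 0 ≤ c ∨ z = p := by
      by_contra! h6
      have h7 : 0 < ‖‖z - p‖ ^ K‖ := by
        rw [norm_pow, norm_norm]
        exact pow_pos (norm_pos_iff.2 (sub_ne_zero.2 h6.2)) K
      exact absurd hc0 (not_le.2 (mul_neg_of_neg_of_pos h6.1 h7))
    rcases h6 with h6 | rfl
    · rw [abs_of_nonneg h6] at h4
      rw [norm_pow, norm_norm, pow_succ, ← mul_assoc]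
      exact h4
    · simp [h5]

theorem HasTaylor.isBigO {f : (Fin m → ℂ) → ℂ} {F} {K : ℕ} (hf : HasTaylor f F p)
    (hK : (K : ℕ∞) ≤ F.order) : f =O[𝓝 p] fun z => ‖z - p‖ ^ K :=
  isBigO_of_wirtingerWord_eq_zero hf.1 fun w hw => by
    rw [hf.2, constantCoeff_pderivWord_of_lt_order]
    exact lt_of_lt_of_le (by exact_mod_cast hw) hK

theorem AnalyticAt.smoothNear {E F : Type*} [NormedAddCommGroup E] [NormedSpace ℂ E]
    [NormedAddCommGroup F] [NormedSpace ℂ F] {f : E → F} {p : E} [CompleteSpace F]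
    (hf : AnalyticAt ℂ f p) : SmoothNear f p := by
  filter_upwards [hf.eventually_analyticAt] with z hz
  exact (hz.contDiffAt (n := ∞)).restrict_scalars ℝ

theorem wirtingerDeriv_inl_of_differentiableAt {f : (Fin m → ℂ) → ℂ} {z : Fin m → ℂ}
    (hf : DifferentiableAt ℂ f z) (j : Fin m) :
    wirtingerDeriv (Sum.inl j) f z = fderiv ℂ f z (Pi.single j 1) := by
  have h : (Pi.single j Complex.I : Fin m → ℂ) = Complex.I • Pi.single j 1 := by
    rw [← Pi.single_smul, smul_eq_mul, mul_one]
  rw [wirtingerDeriv_apply, hf.fderiv_restrictScalars ℝ, wirtingerCoeff_inl]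
  simp only [ContinuousLinearMap.coe_restrictScalars', h, map_smul, smul_eq_mul]
  rw [← mul_assoc, Complex.I_mul_I]
  ring

theorem wirtingerDeriv_inr_of_differentiableAt {f : (Fin m → ℂ) → ℂ} {z : Fin m → ℂ}
    (hf : DifferentiableAt ℂ f z) (j : Fin m) : wirtingerDeriv (Sum.inr j) f z = 0 := by
  have h : (Pi.single j Complex.I : Fin m → ℂ) = Complex.I • Pi.single j 1 := by
    rw [← Pi.single_smul, smul_eq_mul, mul_one]
  rw [wirtingerDeriv_apply, hf.fderiv_restrictScalars ℝ, wirtingerCoeff_inr]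
  simp only [ContinuousLinearMap.coe_restrictScalars', h, map_smul, smul_eq_mul]
  rw [← mul_assoc, Complex.I_mul_I]
  ring

/-- In characteristic zero a monomial containing `ξ_j` is not killed by `∂/∂ξ_j`. -/
theorem exists_rename_inl_eq {F : MvPowerSeries (Fin m ⊕ Fin m) ℂ}
    (h : ∀ j, pderiv ℂ (Sum.inr j) F = 0) :
    ∃ G : MvPowerSeries (Fin m) ℂ, F = rename Sum.inl G := by
  let e : Fin m ↪ Fin m ⊕ Fin m := Function.Embedding.inl
  have h0 : ∀ x : Fin m ⊕ Fin m →₀ ℕ, ∀ j, x (Sum.inr j) ≠ 0 → coeff x F = 0 := by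
    intro x j hj
    have h1 := congrArg (coeff (x - Finsupp.single (Sum.inr j) 1)) (h j)
    have h2 : Finsupp.single (Sum.inr j) 1 ≤ x := Finsupp.single_le_iff.2 (Nat.pos_of_ne_zero hj)
    rw [coeff_pderiv, tsub_add_cancel_of_le h2, coeff_zero] at h1
    refine (mul_eq_zero.1 h1).resolve_right ?_
    exact Nat.cast_add_one_ne_zero _
  refine ⟨killCompl e F, ?_⟩
  change F = rename e _
  ext x
  by_cases hx : ∃ y, x = Finsupp.embDomain e y
  · obtain ⟨y, rfl⟩ := hx
    rw [coeff_embDomain_rename, coeff_killCompl]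
  · obtain ⟨j, hj⟩ : ∃ j, x (Sum.inr j) ≠ 0 := by
      by_contra! hj
      refine hx ⟨Finsupp.comapDomain e x e.injective.injOn, ?_⟩
      rw [Finsupp.embDomain_comapDomain]
      intro s hs
      rcases s with i | i
      · exact ⟨i, rfl⟩
      · exact absurd (hj i) (by simpa using hs)
    rw [h0 x j hj, coeff_rename_eq_zero]
    rintro ⟨y, rfl⟩
    exact hx ⟨y, (Finsupp.embDomain_eq_mapDomain e y).symm⟩

theorem AnalyticAt.exists_hasTaylor {f : (Fin m → ℂ) → ℂ} (hf : AnalyticAt ℂ f p) :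
    ∃ F : MvPowerSeries (Fin m) ℂ, HasTaylor f (rename Sum.inl F) p := by
  obtain ⟨G, hG⟩ := _root_.exists_hasTaylor hf.smoothNear
  obtain ⟨F, rfl⟩ := exists_rename_inl_eq (F := G) fun j => by
    refine (hG.wirtingerDeriv (Sum.inr j)).unique ?_
    have := hasTaylor_const (p := p) 0
    rw [map_zero] at this
    refine this.congr ?_
    filter_upwards [hf.eventually_analyticAt] with z hz
    exact (wirtingerDeriv_inr_of_differentiableAt hz.differentiableAt j).symm
  exact ⟨F, hG⟩

theorem hasTaylor_eval (P : MvPolynomial (Fin m) ℂ) :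
    HasTaylor (fun z => MvPolynomial.eval (z - p) P)
      (rename Sum.inl (P : MvPowerSeries (Fin m) ℂ)) p := by
  induction P using MvPolynomial.induction_on with
  | C a => simpa using hasTaylor_const (p := p) a
  | add P Q hP hQ =>
    rw [MvPolynomial.coe_add, map_add]
    exact (hP.add hQ).congr (Filter.Eventually.of_forall fun z => (map_add _ _ _).symm)
  | mul_X P i hP =>
    rw [MvPolynomial.coe_mul, map_mul, MvPolynomial.coe_X, rename_X]
    refine (hP.mul (hasTaylor_coord (Sum.inl i))).congr (Filter.Eventually.of_forall fun z => ?_)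
    simp [wirtingerCoord_inl]

theorem natCast_le_order_sub_truncTotal {σ : Type*} [Fintype σ] (F : MvPowerSeries σ ℂ) (K : ℕ) :
    (K : ℕ∞) ≤ (F - (truncTotal K F : MvPolynomial σ ℂ)).order := by
  refine le_order fun x hx => ?_
  rw [map_sub, MvPolynomial.coeff_coe, coeff_truncTotal, sub_self]
  exact_mod_cast hx

theorem order_le_order_rename {σ τ : Type*} [Fintype σ] (e : σ → τ) (F : MvPowerSeries σ ℂ) :
    F.order ≤ (rename e F).order := by
  rw [rename_eq_subst]
  exact order_le_order_subst (fun i => by simp) F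

/-- The factors `d` and `g i` are formal and need not converge. Truncation replaces them by
polynomials, with an error of arbitrarily high order. -/
theorem HasTaylor.exists_polynomial_isBigO {ι : Type*} {f : ι → (Fin m → ℂ) → ℂ}
    {d : MvPowerSeries (Fin m) ℂ} {g : ι → MvPowerSeries (Fin m) ℂ}
    (hf : ∀ i, HasTaylor (f i) (rename Sum.inl (d * g i)) p) (hd : constantCoeff d = 0) (K : ℕ) :
    ∃ (D : MvPolynomial (Fin m) ℂ) (G : ι → MvPolynomial (Fin m) ℂ),
      MvPolynomial.eval 0 D = 0 ∧ ∀ i, (fun z => f i z -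
        MvPolynomial.eval (z - p) D * MvPolynomial.eval (z - p) (G i)) =O[𝓝 p]
          fun z => ‖z - p‖ ^ K := by
  -- Cutting at `K + 1` retains the constant term of `d` even for `K = 0`.
  refine ⟨truncTotal (K + 1) d, fun i => truncTotal (K + 1) (g i), ?_, fun i => ?_⟩
  · rw [MvPolynomial.eval_zero, ← hd, MvPolynomial.constantCoeff_eq, coeff_truncTotal,
      coeff_zero_eq_constantCoeff]
    simp
  · have h := (hf i).sub ((hasTaylor_eval (p := p) (truncTotal (K + 1) d)).mul
      (hasTaylor_eval (truncTotal (K + 1) (g i))))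
    refine h.isBigO ?_
    have h1 := natCast_le_order_sub_truncTotal d (K + 1)
    have h2 := natCast_le_order_sub_truncTotal (g i) (K + 1)
    generalize (truncTotal (K + 1) d : MvPowerSeries (Fin m) ℂ) = D at *
    generalize (truncTotal (K + 1) (g i) : MvPowerSeries (Fin m) ℂ) = G at *
    rw [← map_mul, ← map_sub]
    refine le_trans ?_ (order_le_order_rename _ _)
    have h3 : d * g i - D * G = (d - D) * g i + D * (g i - G) := by ring
    rw [h3]
    have h4 : (K : ℕ∞) ≤ ((K + 1 : ℕ) : ℕ∞) := by exact_mod_cast Nat.le_succ K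
    refine le_trans (le_min ?_ ?_) min_order_le_add
    · exact (h4.trans h1).trans (le_trans le_self_add le_order_mul)
    · exact (h4.trans h2).trans (le_trans le_add_self le_order_mul)

end Estimate

end

noncomputable section

/-! ### From smooth hypersurfaces and holomorphic maps to formal ones -/

section SmoothToFormal

open MvPowerSeries

variable {m k : ℕ} {p : Fin m → ℂ}

theorem exists_hasTaylor_ofReal {ρ : (Fin m → ℂ) → ℝ} (hρ : SmoothNear ρ p) :
    ∃ R, HasTaylor (fun z => (ρ z : ℂ)) R p ∧ hermConj R = R := by
  have hs : SmoothNear (fun z => (ρ z : ℂ)) p := by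
    filter_upwards [hρ] with z hz using Complex.ofRealCLM.contDiff.contDiffAt.comp z hz
  obtain ⟨R, hR⟩ := exists_hasTaylor hs
  refine ⟨R, hR, (hR.conj.congr (Filter.Eventually.of_forall fun z => ?_)).unique hR⟩
  exact Complex.conj_ofReal _

theorem fderiv_eq_two_mul_re {ρ : (Fin m → ℂ) → ℝ} {R} (hρ : SmoothNear ρ p)
    (hR : HasTaylor (fun z => (ρ z : ℂ)) R p) (hRc : hermConj R = R) (v : Fin m → ℂ) :
    fderiv ℝ ρ p v = 2 * (∑ j, formalGradient R j * v j).re := by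
  have hof := (Complex.ofRealCLM.hasFDerivAt.comp p
    (hρ.self_of_nhds.differentiableAt (by simp)).hasFDerivAt).fderiv
  have hc : ∀ s, wirtingerCoeff s (fderiv ℝ (Complex.ofRealCLM ∘ ρ) p) =
      coeff (Finsupp.single s 1) R := by
    intro s
    have := (hR.wirtingerDeriv s).apply_eq
    rw [wirtingerDeriv_apply] at this
    refine this.trans ?_
    rw [← coeff_zero_eq_constantCoeff_apply, coeff_pderiv]
    simp
  have h1 := sum_wirtingerCoeff_mul_wirtingerCoord (fderiv ℝ (Complex.ofRealCLM ∘ ρ) p) v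
  rw [Fintype.sum_sum_type] at h1
  simp only [hc, coeff_single_inl, coeff_single_inr hRc, wirtingerCoord_inl,
    wirtingerCoord_inr, ← map_mul] at h1
  rw [hof, ← map_sum, Complex.add_conj] at h1
  have h2 : ((fderiv ℝ ρ p v : ℝ) : ℂ) = _ := h1
  exact_mod_cast h2

theorem isFormalDefiningSeries_of_hasTaylor {ρ : (Fin m → ℂ) → ℝ} {R} (hρ : SmoothNear ρ p)
    (hR : HasTaylor (fun z => (ρ z : ℂ)) R p) (hRc : hermConj R = R) (h0 : ρ p = 0)
    (hd : fderiv ℝ ρ p ≠ 0) : IsFormalDefiningSeries R where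
  real := hRc
  zero := by rw [← hR.apply_eq, h0, Complex.ofReal_zero]
  grad := by
    intro hg
    apply hd
    ext v
    rw [fderiv_eq_two_mul_re hρ hR hRc, hg]
    simp

theorem leviRank_eq_formalLeviRank {ρ : (Fin m → ℂ) → ℝ} {R}
    (hR : HasTaylor (fun z => (ρ z : ℂ)) R p) : leviRank ρ p = formalLeviRank R := by
  rw [leviRank, formalLeviRank]
  congr 1
  · ext i j
    exact hR.2 [Sum.inr j, Sum.inl i]
  · funext j
    exact hR.2 [Sum.inl j]

theorem exists_formalMap {H : (Fin m → ℂ) → Fin k → ℂ} (hH : AnalyticAt ℂ H p) :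
    ∃ Ĥ : Fin k → MvPowerSeries (Fin m) ℂ, (∀ i, constantCoeff (Ĥ i) = 0) ∧
      (∀ t, HasTaylor (fun z => wirtingerCoord t (H z - H p)) (complexifiedMap Ĥ t) p) ∧
      ∀ i j, HasTaylor (fun z => jacobianMatrix H z i j) (rename Sum.inl (pderiv ℂ j (Ĥ i))) p := by
  have hHi : ∀ i, AnalyticAt ℂ (fun z => H z i - H p i) p := fun i =>
    (((ContinuousLinearMap.proj (R := ℂ) i).analyticAt _).comp hH).sub analyticAt_const
  choose Ĥ hT using fun i => (hHi i).exists_hasTaylor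
  refine ⟨Ĥ, fun i => ?_, fun t => ?_, fun i j => ?_⟩
  · rw [← constantCoeff_rename (f := (Sum.inl : Fin m → Fin m ⊕ Fin m)), ← (hT i).apply_eq, sub_self]
  · cases t with
    | inl i => exact hT i
    | inr i =>
      have h := (hT i).conj
      rw [hermConj, ← rename_map, rename_rename] at h
      exact h
  · rw [← pderiv_rename_self Sum.inl_injective]
    refine ((hT i).wirtingerDeriv (Sum.inl j)).congr ?_
    filter_upwards [hH.eventually_analyticAt, (hHi i).eventually_analyticAt] with z hz hz'
    rw [wirtingerDeriv_inl_of_differentiableAt hz'.differentiableAt]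
    have h1 := ((ContinuousLinearMap.proj (R := ℂ) (φ := fun _ : Fin k => ℂ) i).hasFDerivAt.comp z
      hz.differentiableAt.hasFDerivAt).sub_const (H p i)
    have h2 := h1.fderiv
    exact congrArg (fun A => A (Pi.single j 1)) h2

theorem hasTaylor_minor {H : (Fin m → ℂ) → Fin k → ℂ} {Ĥ : Fin k → MvPowerSeries (Fin m) ℂ}
    (h : ∀ i j, HasTaylor (fun z => jacobianMatrix H z i j) (rename Sum.inl (pderiv ℂ j (Ĥ i))) p)
    (e : Fin m ↪o Fin k) :
    HasTaylor (fun z => ((jacobianMatrix H z).submatrix e id).det)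
      (rename Sum.inl (formalMinor Ĥ e)) p := by
  rw [formalMinor, AlgHom.map_det]
  exact HasTaylor.det fun i j => h (e i) j

theorem isTransversalAt_of_isFormallyTransversal {H : (Fin m → ℂ) → Fin k → ℂ}
    {Ĥ : Fin k → MvPowerSeries (Fin m) ℂ} {ρ' : (Fin k → ℂ) → ℝ} {R'} (hH : AnalyticAt ℂ H p)
    (h : ∀ i j, HasTaylor (fun z => jacobianMatrix H z i j) (rename Sum.inl (pderiv ℂ j (Ĥ i))) p)
    (hρ : SmoothNear ρ' (H p)) (hR : HasTaylor (fun z => (ρ' z : ℂ)) R' (H p))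
    (hRc : hermConj R' = R') (ht : IsFormallyTransversal Ĥ R') : IsTransversalAt H p ρ' := by
  refine eq_top_mono (sup_le_sup ?_ ?_) ht
  · intro v hv
    change fderiv ℝ ρ' (H p) v = 0
    rw [fderiv_eq_two_mul_re hρ hR hRc, show (∑ j, formalGradient R' j * v j).re = 0 from hv,
      mul_zero]
  · rintro _ ⟨v, rfl⟩
    refine ⟨v, ?_⟩
    change fderiv ℝ H p v = _
    rw [hH.differentiableAt.fderiv_restrictScalars ℝ]
    have hv : v = ∑ j, v j • (Pi.single j 1 : Fin m → ℂ) := by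
      rw [← pi_eq_sum_univ' v]
    conv_lhs => rw [hv]
    rw [ContinuousLinearMap.coe_restrictScalars', map_sum]
    ext i
    rw [Finset.sum_apply, Matrix.mulVecLin_apply, Matrix.mulVec, dotProduct]
    refine Finset.sum_congr rfl fun j _ => ?_
    rw [map_smul, Pi.smul_apply, smul_eq_mul, mul_comm]
    congr 1
    have := (h i j).apply_eq
    rw [constantCoeff_rename] at this
    exact this

theorem IsLocalDefiningFunction.spec {M : Set (Fin m → ℂ)} {ρ : (Fin m → ℂ) → ℝ}
    (h : IsLocalDefiningFunction M p ρ) (hp : p ∈ M) :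
    SmoothNear ρ p ∧ ρ p = 0 ∧ fderiv ℝ ρ p ≠ 0 ∧ ∀ᶠ z in 𝓝 p, z ∈ M ↔ ρ z = 0 := by
  obtain ⟨U, hU, hpU, hs, hM, hd⟩ := h
  have hn := hU.mem_nhds hpU
  refine ⟨?_, (hM p hpU).1 hp, hd p hpU hp, ?_⟩
  · filter_upwards [hn] with z hz using hs.contDiffAt (hU.mem_nhds hz)
  · filter_upwards [hn] with z hz using hM z hz

/-- A holomorphic map between smooth hypersurfaces is transversal if no nonunit divides all the
maximal minors of its Jacobian matrix up to arbitrarily high order. -/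
theorem isTransversalAt_of_minors_coprime {n N : ℕ} {M : Set (Fin (n + 1) → ℂ)}
    {M' : Set (Fin (N + 1) → ℂ)} {p : Fin (n + 1) → ℂ} {H : (Fin (n + 1) → ℂ) → Fin (N + 1) → ℂ}
    {ρ' : (Fin (N + 1) → ℂ) → ℝ} (hM : IsSmoothRealHypersurface M) (hp : p ∈ M)
    (hp' : H p ∈ M') (hH : AnalyticAt ℂ H p) (hmaps : ∀ᶠ z in 𝓝 p, z ∈ M → H z ∈ M')
    (hρ' : IsLocalDefiningFunction M' (H p) ρ')
    (hr : 2 * (N : ℤ) - (leviRank ρ' (H p) : ℤ) ≤ 2 * (n : ℤ) - 2)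
    (hd : ¬ ∀ K : ℕ, ∃ (D : MvPolynomial (Fin (n + 1)) ℂ)
      (G : (Fin (n + 1) ↪o Fin (N + 1)) → MvPolynomial (Fin (n + 1)) ℂ),
      MvPolynomial.eval 0 D = 0 ∧ ∀ e : Fin (n + 1) ↪o Fin (N + 1), (fun z => ((jacobianMatrix H z).submatrix e id).det -
        MvPolynomial.eval (z - p) D * MvPolynomial.eval (z - p) (G e)) =O[𝓝 p]
          fun z => ‖z - p‖ ^ K) :
    IsTransversalAt H p ρ' := by
  obtain ⟨ρ, hρ⟩ := hM p hp
  obtain ⟨hρs, hρ0, hρd, hρM⟩ := hρ.spec hp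
  obtain ⟨hρs', hρ0', hρd', hρM'⟩ := hρ'.spec hp'
  obtain ⟨R, hR, hRc⟩ := exists_hasTaylor_ofReal hρs
  obtain ⟨R', hR', hRc'⟩ := exists_hasTaylor_ofReal hρs'
  obtain ⟨Ĥ, hĤ0, hĤ, hJ⟩ := exists_formalMap hH
  have hRd := isFormalDefiningSeries_of_hasTaylor hρs hR hRc hρ0 hρd
  have hRd' := isFormalDefiningSeries_of_hasTaylor hρs' hR' hRc' hρ0' hρd'
  refine isTransversalAt_of_isFormallyTransversal hH hJ hρs' hR' hRc'
    (isFormallyTransversal_of_minors_coprime hRd hRd' hĤ0 ?_ ?_ ?_)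
  · have hcomp := hR'.comp hH.smoothNear hĤ
    obtain ⟨j, hj⟩ := Function.ne_iff.1 hRd.grad
    rw [← coeff_single_inl] at hj
    -- `ρ' ∘ H` vanishes on `M`, so its Taylor series is a multiple of that of `ρ`.
    obtain ⟨a, ha⟩ := dvd_of_hasTaylor_of_eq_zero hρs hR hρ0 hj hcomp (by
      filter_upwards [hρM, hmaps, hH.continuousAt.eventually hρM'] with z h1 h2 h3 h4
      rw [Function.comp_apply, h3.1 (h2 (h1.2 h4)), Complex.ofReal_zero])
    exact ⟨a, by rw [ha, mul_comm]⟩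
  · rwa [← leviRank_eq_formalLeviRank hR']
  · intro d hdvd
    by_contra hu
    have hd0 : constantCoeff d = 0 := by
      by_contra h0
      exact hu (isUnit_iff_constantCoeff.2 (isUnit_iff_ne_zero.2 h0))
    refine hd fun K => ?_
    have hdvd' : ∀ e, ∃ g, formalMinor Ĥ e = d * g := by
      intro e
      by_cases h0 : formalMinor Ĥ e = 0
      · exact ⟨0, by rw [h0, mul_zero]⟩
      · exact hdvd e h0
    choose g hg using hdvd'
    exact HasTaylor.exists_polynomial_isBigO (fun e => hg e ▸ hasTaylor_minor hJ e) hd0 K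

end SmoothToFormal

end

noncomputable section

/-! ### One complex variable: zeros, residues and symmetric functions -/

section OneVariable

open Metric

theorem AnalyticOnNhd.finite_zeros_closedBall {g : ℂ → ℂ} {r : ℝ} (hr : 0 < r)
    (hg : AnalyticOnNhd ℂ g (closedBall 0 r)) (h0 : ∀ y ∈ sphere (0 : ℂ) r, g y ≠ 0) :
    (closedBall 0 r ∩ {y | g y = 0}).Finite ∧
      ∀ a ∈ closedBall (0 : ℂ) r, ¬ ∀ᶠ y in 𝓝 a, g y = 0 := by
  have h1 : ∀ a ∈ closedBall (0 : ℂ) r, ¬ ∀ᶠ y in 𝓝 a, g y = 0 := by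
    intro a ha h
    obtain ⟨y, hy⟩ := (NormedSpace.sphere_nonempty (x := (0 : ℂ))).2 hr.le
    exact h0 y hy (hg.eqOn_zero_of_preconnected_of_eventuallyEq_zero
      (convex_closedBall 0 r).isPreconnected ha h (sphere_subset_closedBall hy))
  refine ⟨?_, h1⟩
  by_contra hinf
  obtain ⟨a, ha, hacc⟩ := Set.Infinite.exists_accPt_of_subset_isCompact hinf
    (isCompact_closedBall (0 : ℂ) r) Set.inter_subset_left
  refine h1 a ha ((hg a ha).frequently_zero_iff_eventually_zero.1 ?_)
  exact (accPt_iff_frequently_nhdsNE.1 hacc).mono fun y hy => hy.2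

/-- Induction on the number of distinct zeros, dividing out one of them with its full multiplicity.
-/
theorem AnalyticOnNhd.exists_eq_prod_mul {g : ℂ → ℂ} {r : ℝ} (hr : 0 < r)
    (hg : AnalyticOnNhd ℂ g (closedBall 0 r)) (h0 : ∀ y ∈ sphere (0 : ℂ) r, g y ≠ 0) :
    ∃ (n : ℕ) (a : Fin n → ℂ) (h : ℂ → ℂ), (∀ i, a i ∈ ball (0 : ℂ) r) ∧
      AnalyticOnNhd ℂ h (closedBall 0 r) ∧ (∀ y ∈ closedBall (0 : ℂ) r, h y ≠ 0) ∧
      ∀ y, g y = (∏ i, (y - a i)) * h y := by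
  induction hN : (closedBall 0 r ∩ {y | g y = 0}).ncard using Nat.strong_induction_on
    generalizing g with
  | _ N ih =>
  obtain ⟨hfin, hne⟩ := hg.finite_zeros_closedBall hr h0
  rcases (closedBall 0 r ∩ {y | g y = 0}).eq_empty_or_nonempty with hZ | ⟨a, ha, hga⟩
  · refine ⟨0, Fin.elim0, g, fun i => i.elim0, hg, fun y hy h => ?_, by simp⟩
    exact Set.eq_empty_iff_forall_notMem.1 hZ y ⟨hy, h⟩
  have hab : a ∈ ball (0 : ℂ) r := by
    rcases (mem_closedBall.1 ha).lt_or_eq with h | h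
    · exact h
    · exact absurd hga (h0 a h)
  obtain ⟨k, g₁, hg₁, hg₁a, hgg₁⟩ := (hg a ha).exists_eventuallyEq_pow_smul_nonzero_iff.2 (hne a ha)
  have hk : k ≠ 0 := by
    rintro rfl
    apply hg₁a
    have := hgg₁.self_of_nhds
    rw [show g a = 0 from hga] at this
    simpa using this.symm
  let q : ℂ → ℂ := Function.update (fun y => g y / (y - a) ^ k) a (g₁ a)
  have hqa : q a = g₁ a := Function.update_self ..
  have hqn : ∀ y, y ≠ a → q y = g y / (y - a) ^ k := fun y hy => Function.update_of_ne hy ..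
  have hgq : ∀ y, g y = (y - a) ^ k * q y := by
    intro y
    by_cases hy : y = a
    · rw [hy, show g a = 0 from hga, sub_self, zero_pow hk, zero_mul]
    · rw [hqn y hy, mul_div_cancel₀ _ (pow_ne_zero k (sub_ne_zero.2 hy))]
  have hq : AnalyticOnNhd ℂ q (closedBall 0 r) := by
    intro y hy
    by_cases hya : y = a
    · subst hya
      refine hg₁.congr ?_
      filter_upwards [hgg₁] with z hz
      by_cases hzy : z = y
      · rw [hzy, hqa]
      · rw [hqn z hzy, hz, smul_eq_mul, mul_div_cancel_left₀ _ (pow_ne_zero k (sub_ne_zero.2 hzy))]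
    · refine ((hg y hy).div ((analyticAt_id.sub analyticAt_const).pow k)
        (pow_ne_zero k (sub_ne_zero.2 hya))).congr ?_
      filter_upwards [isOpen_ne.mem_nhds hya] with z hz
      rw [hqn z hz]
      rfl
  have hq0 : ∀ y ∈ sphere (0 : ℂ) r, q y ≠ 0 := by
    intro y hy hqy
    apply h0 y hy
    rw [hgq, hqy, mul_zero]
  have hcard : (closedBall 0 r ∩ {y | q y = 0}).ncard < N := by
    rw [← hN]
    refine Set.ncard_lt_ncard ⟨fun y hy => ⟨hy.1, ?_⟩, fun hsub => ?_⟩ hfin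
    · change g y = 0
      rw [hgq, show q y = 0 from hy.2, mul_zero]
    · have := (hsub ⟨ha, hga⟩).2
      exact hg₁a (hqa.symm.trans this)
  obtain ⟨n, b, h, hb, hh, hh0, hqh⟩ := ih _ hcard hq hq0 rfl
  refine ⟨k + n, Fin.append (fun _ => a) b, h, fun i => ?_, hh, hh0, fun y => ?_⟩
  · refine Fin.addCases (fun i => ?_) (fun i => ?_) i
    · rwa [Fin.append_left]
    · rw [Fin.append_right]
      exact hb i
  · rw [hgq, hqh, Fin.prod_univ_add]
    simp only [Fin.append_left, Fin.append_right, Finset.prod_const, Finset.card_univ,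
      Fintype.card_fin, mul_assoc]

theorem AnalyticOnNhd.diffContOnCl_ball {f : ℂ → ℂ} {r : ℝ}
    (hf : AnalyticOnNhd ℂ f (closedBall 0 r)) : DiffContOnCl ℂ f (ball 0 r) :=
  (hf.differentiableOn).diffContOnCl_ball subset_rfl

/-- On the circle `g' / g = ∑ (y - a_i)⁻¹ + h' / h`; the last term is holomorphic in the disc, and
Cauchy's formula evaluates the others. -/
theorem circleIntegral_mul_logDeriv {n : ℕ} {a : Fin n → ℂ} {g h φ : ℂ → ℂ} {r : ℝ} (hr : 0 < r)
    (ha : ∀ i, a i ∈ ball (0 : ℂ) r) (hh : AnalyticOnNhd ℂ h (closedBall 0 r))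
    (hh0 : ∀ y ∈ closedBall (0 : ℂ) r, h y ≠ 0) (hg : ∀ y, g y = (∏ i, (y - a i)) * h y)
    (hφ : AnalyticOnNhd ℂ φ (closedBall 0 r)) :
    ∮ y in C(0, r), φ y * logDeriv g y = 2 * Real.pi * Complex.I * ∑ i, φ (a i) := by
  have hne : ∀ y ∈ sphere (0 : ℂ) r, ∀ i, y - a i ≠ 0 := by
    intro y hy i h
    rw [sub_eq_zero] at h
    have := ha i
    rw [← h, mem_ball, mem_sphere.1 hy] at this
    exact lt_irrefl _ this
  have hL : AnalyticOnNhd ℂ (fun y => φ y * logDeriv h y) (closedBall 0 r) := fun y hy =>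
    (hφ y hy).mul ((hh y hy).deriv.div (hh y hy) (hh0 y hy))
  have h1 : Set.EqOn (fun y => φ y * logDeriv g y)
      (fun y => ∑ i, (y - a i)⁻¹ * φ y + φ y * logDeriv h y) (sphere 0 r) := by
    intro y hy
    have hyc := sphere_subset_closedBall hy
    have h2 : logDeriv g y = ∑ i, (y - a i)⁻¹ + logDeriv h y := by
      rw [show g = fun y => (∏ i, (y - a i)) * h y from funext hg, logDeriv_mul (f := fun y => ∏ i, (y - a i))
        (g := h) y (Finset.prod_ne_zero_iff.2 fun i _ => hne y hy i) (hh0 y hyc) (by fun_prop)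
        (hh y hyc).differentiableAt, logDeriv_prod (fun i _ => hne y hy i) (fun i _ => by fun_prop)]
      congr 1
      refine Finset.sum_congr rfl fun i _ => ?_
      rw [logDeriv_apply, deriv_sub_const, deriv_id'', one_div]
    simp only [h2]
    rw [mul_add, Finset.mul_sum]
    congr 1
    exact Finset.sum_congr rfl fun i _ => mul_comm _ _
  have hint : ∀ i, CircleIntegrable (fun y => (y - a i)⁻¹ * φ y) 0 r := by
    intro i
    refine ContinuousOn.circleIntegrable hr.le (ContinuousOn.mul (ContinuousOn.inv₀ (by fun_prop)
      fun y hy => hne y hy i) (hφ.continuousOn.mono sphere_subset_closedBall))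
  rw [circleIntegral.integral_congr hr.le h1, circleIntegral.integral_add
    (CircleIntegrable.fun_sum _ fun i _ => hint i)
    ((hL.continuousOn.mono sphere_subset_closedBall).circleIntegrable hr.le),
    hL.diffContOnCl_ball.circleIntegral_eq_zero hr.le, add_zero,
    circleIntegral.integral_fun_sum fun i _ => hint i, Finset.mul_sum]
  exact Finset.sum_congr rfl fun i _ => hφ.diffContOnCl_ball.circleIntegral_sub_inv_smul (ha i)

/-- A point of the disc at which a function is smaller than on the boundary circle forces a zero. -/
theorem exists_zero_of_lt_norm_sphere {g : ℂ → ℂ} {r b : ℝ}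
    (hg : Differentiable ℂ g) (hr : 0 < r) (h0 : ‖g 0‖ < b)
    (hb : ∀ y ∈ sphere (0 : ℂ) r, b ≤ ‖g y‖) : ∃ y ∈ ball (0 : ℂ) r, g y = 0 := by
  by_contra! hne
  have hb0 : 0 < b := (norm_nonneg _).trans_lt h0
  have hne' : ∀ y ∈ closedBall (0 : ℂ) r, g y ≠ 0 := by
    intro y hy
    rcases (mem_closedBall.1 hy).lt_or_eq with h | h
    · exact hne y h
    · exact norm_pos_iff.1 (hb0.trans_le (hb y h))
  -- If `g` had no zero, `1 / g` would violate the maximum principle.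
  have hd : DiffContOnCl ℂ (fun y => (g y)⁻¹) (ball 0 r) :=
    DifferentiableOn.diffContOnCl_ball (U := closedBall 0 r)
      (fun y hy => ((hg y).inv (hne' y hy)).differentiableWithinAt) subset_rfl
  have := Complex.norm_le_of_forall_mem_frontier_norm_le isBounded_ball hd (C := b⁻¹)
    (fun y hy => by
      rw [frontier_ball _ hr.ne'] at hy
      rw [norm_inv]
      exact inv_anti₀ hb0 (hb y hy)) (subset_closure (mem_ball_self hr))
  rw [norm_inv, inv_le_inv₀ (norm_pos_iff.2 (hne' 0 (mem_closedBall_self hr.le))) hb0] at this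
  exact absurd this (not_le.2 h0)

theorem le_norm_of_le_norm_sphere {h : ℂ → ℂ} {r b : ℝ} (hr : 0 < r) (hb : 0 < b)
    (hh : AnalyticOnNhd ℂ h (closedBall 0 r)) (hh0 : ∀ y ∈ closedBall (0 : ℂ) r, h y ≠ 0)
    (hs : ∀ y ∈ sphere (0 : ℂ) r, b ≤ ‖h y‖) {y : ℂ} (hy : y ∈ ball (0 : ℂ) r) : b ≤ ‖h y‖ := by
  have hd : DiffContOnCl ℂ (fun y => (h y)⁻¹) (ball 0 r) :=
    AnalyticOnNhd.diffContOnCl_ball fun y hy => (hh y hy).inv (hh0 y hy)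
  have := Complex.norm_le_of_forall_mem_frontier_norm_le isBounded_ball hd (C := b⁻¹)
    (fun y hy => by
      rw [frontier_ball _ hr.ne'] at hy
      rw [norm_inv]
      exact inv_anti₀ hb (hs y hy)) (subset_closure hy)
  rwa [norm_inv, inv_le_inv₀ (norm_pos_iff.2 (hh0 y (ball_subset_closedBall hy))) hb] at this

/-- Elementary symmetric functions depend holomorphically on a parameter if the power sums do. -/
theorem DifferentiableOn.prod_of_psum {n : ℕ} {u : ℂ → Fin n → ℂ} {s : Set ℂ}
    (h : ∀ k : ℕ, DifferentiableOn ℂ (fun x => ∑ i, u x i ^ k) s) :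
    DifferentiableOn ℂ (fun x => ∏ i, u x i) s := by
  have key : ∀ k, DifferentiableOn ℂ
      (fun x => MvPolynomial.aeval (u x) (MvPolynomial.esymm (Fin n) ℂ k)) s := by
    intro k
    induction k using Nat.strong_induction_on with
    | _ k ih =>
    rcases Nat.eq_zero_or_pos k with rfl | hk
    · simp only [MvPolynomial.esymm_zero, map_one]
      exact differentiableOn_const _
    · have hk' : (k : ℂ) ≠ 0 := by exact_mod_cast hk.ne'
      -- Newton's identities, solved for the elementary symmetric function of degree `k`.
      have h1 : ∀ x, MvPolynomial.aeval (u x) (MvPolynomial.esymm (Fin n) ℂ k) =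
          (k : ℂ)⁻¹ * ((-1) ^ (k + 1) * ∑ a ∈ Finset.HasAntidiagonal.antidiagonal k with a.1 < k, (-1) ^ a.1 *
            MvPolynomial.aeval (u x) (MvPolynomial.esymm (Fin n) ℂ a.1) * ∑ i, u x i ^ a.2) := by
        intro x
        rw [eq_inv_mul_iff_mul_eq₀ hk']
        have := congrArg (MvPolynomial.aeval (u x)) (MvPolynomial.mul_esymm_eq_sum (Fin n) ℂ k)
        simpa [MvPolynomial.psum] using this
      simp only [h1]
      refine (DifferentiableOn.const_mul (DifferentiableOn.fun_sum fun a ha => ?_) _).const_mul _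
      exact ((ih a.1 (Finset.mem_filter.1 ha).2).const_mul _).mul (h a.2)
  have h2 := key n
  refine h2.congr fun x _ => ?_
  rw [MvPolynomial.esymm, map_sum]
  have h3 := Finset.powersetCard_self (Finset.univ : Finset (Fin n))
  rw [Finset.card_univ, Fintype.card_fin] at h3
  rw [h3, Finset.sum_singleton, map_prod]
  simp

theorem differentiableOn_circleIntegral {G : ℂ × ℂ → ℂ} {r δ : ℝ} (hr : 0 < r)
    (hG : ∀ x ∈ ball (0 : ℂ) δ, ∀ y ∈ sphere (0 : ℂ) r, AnalyticAt ℂ G (x, y)) :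
    DifferentiableOn ℂ (fun x => ∮ y in C(0, r), G (x, y)) (ball 0 δ) := by
  intro x₀ hx₀
  refine DifferentiableAt.differentiableWithinAt ?_
  obtain ⟨ε, hε, hsub⟩ := Metric.nhds_basis_closedBall.mem_iff.1 (isOpen_ball.mem_nhds hx₀)
  have hcm : ∀ θ, circleMap 0 r θ ∈ sphere (0 : ℂ) r := fun θ => circleMap_mem_sphere 0 hr.le θ
  have hGc : ∀ x ∈ ball (0 : ℂ) δ, Continuous fun θ => G (x, circleMap 0 r θ) := by
    intro x hx
    rw [continuous_iff_continuousAt]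
    intro θ
    exact ContinuousAt.comp (f := fun θ => (x, circleMap 0 r θ)) (hG x hx _ (hcm θ)).continuousAt
      (by fun_prop)
  have hG'c : ∀ x ∈ ball (0 : ℂ) δ, Continuous fun θ => fderiv ℂ G (x, circleMap 0 r θ) (1, 0) := by
    intro x hx
    rw [continuous_iff_continuousAt]
    intro θ
    have h1 : ContinuousAt (fun θ => fderiv ℂ G (x, circleMap 0 r θ)) θ :=
      ContinuousAt.comp (f := fun θ => (x, circleMap 0 r θ))
        (hG x hx _ (hcm θ)).fderiv.continuousAt (by fun_prop)
    exact h1.clm_apply continuousAt_const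
  have hK : IsCompact (closedBall x₀ ε ×ˢ sphere (0 : ℂ) r) :=
    (isCompact_closedBall _ _).prod (isCompact_sphere _ _)
  obtain ⟨C, hC⟩ := hK.exists_bound_of_continuousOn (f := fun z => fderiv ℂ G z (1, 0)) (by
    rintro ⟨x, y⟩ ⟨hx, hy⟩
    exact ((hG x (hsub hx) y hy).fderiv.continuousAt.clm_apply
      continuousAt_const).continuousWithinAt)
  have hdc : Continuous fun θ => deriv (circleMap 0 r) θ := by
    simp only [deriv_circleMap]
    fun_prop
  have := intervalIntegral.hasDerivAt_integral_of_dominated_loc_of_deriv_le (μ := MeasureTheory.volume)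
    (a := 0) (b := 2 * Real.pi)
    (F := fun x θ => deriv (circleMap 0 r) θ • G (x, circleMap 0 r θ))
    (F' := fun x θ => deriv (circleMap 0 r) θ • fderiv ℂ G (x, circleMap 0 r θ) (1, 0))
    (x₀ := x₀) (s := closedBall x₀ ε) (bound := fun _ => r * C)
    (closedBall_mem_nhds _ hε)
    (by
      filter_upwards [isOpen_ball.mem_nhds hx₀] with x hx
      exact (hdc.smul (hGc x hx)).aestronglyMeasurable)
    ((hdc.smul (hGc x₀ hx₀)).intervalIntegrable _ _)
    (hdc.smul (hG'c x₀ hx₀)).aestronglyMeasurable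
    (Filter.Eventually.of_forall fun θ _ x hx => by
      rw [norm_smul]
      have h1 : ‖deriv (circleMap 0 r) θ‖ = r := by
        simp [deriv_circleMap, abs_of_pos hr]
      rw [h1]
      exact mul_le_mul_of_nonneg_left (hC (x, circleMap 0 r θ) ⟨hx, hcm θ⟩) hr.le)
    (continuous_const.intervalIntegrable _ _)
    (Filter.Eventually.of_forall fun θ _ x hx => by
      have h2 : HasDerivAt (fun x : ℂ => (x, circleMap 0 r θ)) (1, 0) x :=
        (hasDerivAt_id x).prodMk (hasDerivAt_const x _)
      have h3 := (hG x (hsub hx) _ (hcm θ)).differentiableAt.hasFDerivAt.comp_hasDerivAt x h2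
      exact h3.const_smul (deriv (circleMap 0 r) θ))
  exact this.2.differentiableAt

/-- Induction: in `u_0 (A + W)` the factor `u_0` is bounded by `M` in front of `A` and by `A + B
w_0` in front of `W`. The estimate stays linear in `A`, as the Łojasiewicz inequality needs. -/
theorem exists_prod_le_mul_add_prod (n : ℕ) {M B : ℝ} (hM : 0 ≤ M) (hB : 0 ≤ B) :
    ∃ C : ℝ, 0 ≤ C ∧ ∀ (A : ℝ) (u w : Fin n → ℝ), 0 ≤ A → (∀ i, 0 ≤ u i) → (∀ i, u i ≤ M) →
      (∀ i, 0 ≤ w i) → (∀ i, w i ≤ M) → (∀ i, u i ≤ A + B * w i) →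
      ∏ i, u i ≤ C * (A + ∏ i, w i) := by
  induction n with
  | zero => exact ⟨1, zero_le_one, fun A u w hA _ _ _ _ _ => by simpa using hA⟩
  | succ n ih =>
    obtain ⟨C, hC, h⟩ := ih
    refine ⟨C * (M + M ^ n + B), by positivity, fun A u w hA hu huM hw hwM huw => ?_⟩
    have h1 := h A (fun i => u i.succ) (fun i => w i.succ) hA (fun i => hu _) (fun i => huM _)
      (fun i => hw _) (fun i => hwM _) (fun i => huw _)
    rw [Fin.prod_univ_succ, Fin.prod_univ_succ]
    set W := ∏ i : Fin n, w i.succ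
    have hW : 0 ≤ W := Finset.prod_nonneg fun i _ => hw _
    have hWM : W ≤ M ^ n := by
      refine (Finset.prod_le_prod (fun i _ => hw _) fun i _ => hwM _).trans (by simp)
    calc u 0 * ∏ i : Fin n, u i.succ ≤ u 0 * (C * (A + W)) := mul_le_mul_of_nonneg_left h1 (hu 0)
      _ = C * (u 0 * A) + C * (u 0 * W) := by ring
      _ ≤ C * (M * A) + C * ((A + B * w 0) * W) := by
        gcongr
        · exact huM 0
        · exact huw 0
      _ = C * (M * A + A * W + B * (w 0 * W)) := by ring
      _ ≤ C * (M * A + A * M ^ n + B * (w 0 * W)) := by gcongr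
      _ ≤ C * ((M + M ^ n + B) * (A + w 0 * W)) := by
        have h2 : 0 ≤ w 0 * W := mul_nonneg (hw 0) hW
        gcongr
        nlinarith [mul_nonneg hM h2, mul_nonneg (pow_nonneg hM n) h2, mul_nonneg hB hA]
      _ = C * (M + M ^ n + B) * (A + w 0 * W) := by ring

end OneVariable

end

noncomputable section

/-! ### Two complex variables: a Łojasiewicz inequality -/

section TwoVariables

open Metric

/-- Finitely many proper subspaces do not cover a vector space over an infinite field, so some
linear form is nonzero on all the `u i`. -/
theorem exists_forall_sum_mul_ne_zero {ι κ : Type*} [Fintype ι] [Finite κ] (u : κ → ι → ℂ)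
    (hu : ∀ i, ∃ e, u i e ≠ 0) : ∃ c : ι → ℂ, ∀ i, ∑ e, c e * u i e ≠ 0 := by
  classical
  obtain ⟨f, hf⟩ := Module.exists_dual_forall_apply_ne_zero (K := ℂ) u fun i h =>
    (hu i).elim fun e he => he (congrFun h e)
  refine ⟨fun e => f (Pi.single e 1), fun i => ?_⟩
  have h := LinearMap.pi_apply_eq_sum_univ f (u i)
  simp only [smul_eq_mul] at h
  refine fun h0 => hf i (h.trans (Eq.trans (Finset.sum_congr rfl fun e _ => ?_) h0))
  rw [mul_comm]
  congr 2
  funext j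
  rw [Pi.single_apply]
  simp only [eq_comm]

theorem AnalyticAt.slice {f : ℂ × ℂ → ℂ} {x y : ℂ} (hf : AnalyticAt ℂ f (x, y)) :
    AnalyticAt ℂ (fun y => f (x, y)) y :=
  AnalyticAt.comp (f := fun y => (x, y)) hf (AnalyticAt.prod analyticAt_const analyticAt_id)

/-- The zeros of `F (x, ·)` in a disc, as long as there are none on the boundary: their number is
constant, and symmetric functions of them are holomorphic in `x`. -/
theorem exists_roots {F : ℂ × ℂ → ℂ} {ε δ : ℝ} (hε : 0 < ε) (hδ : δ ≤ ε)
    (hF : ∀ z ∈ closedBall (0 : ℂ × ℂ) ε, AnalyticAt ℂ F z)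
    (hFs : ∀ x ∈ ball (0 : ℂ) δ, ∀ y ∈ sphere (0 : ℂ) ε, F (x, y) ≠ 0) :
    ∃ (n : ℕ) (a : ℂ → Fin n → ℂ) (h : ℂ → ℂ → ℂ),
      (∀ x ∈ ball (0 : ℂ) δ, (∀ i, a x i ∈ ball (0 : ℂ) ε) ∧
        AnalyticOnNhd ℂ (h x) (closedBall 0 ε) ∧ (∀ y ∈ closedBall (0 : ℂ) ε, h x y ≠ 0) ∧
        ∀ y, F (x, y) = (∏ i, (y - a x i)) * h x y) ∧
      ∀ φ : ℂ × ℂ → ℂ, (∀ z ∈ closedBall (0 : ℂ × ℂ) ε, AnalyticAt ℂ φ z) →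
        DifferentiableOn ℂ (fun x => ∏ i, φ (x, a x i)) (ball 0 δ) := by
  have hmem : ∀ x ∈ ball (0 : ℂ) δ, ∀ y ∈ closedBall (0 : ℂ) ε,
      (x, y) ∈ closedBall (0 : ℂ × ℂ) ε := by
    intro x hx y hy
    rw [mem_closedBall_zero_iff, Prod.norm_mk]
    exact max_le ((mem_ball_zero_iff.1 hx).le.trans hδ) (mem_closedBall_zero_iff.1 hy)
  have hS : ∀ φ : ℂ × ℂ → ℂ, (∀ z ∈ closedBall (0 : ℂ × ℂ) ε, AnalyticAt ℂ φ z) →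
      DifferentiableOn ℂ (fun x => ∮ y in C(0, ε), φ (x, y) * logDeriv (fun y => F (x, y)) y)
        (ball 0 δ) := by
    intro φ hφ
    have h1 := differentiableOn_circleIntegral (G := fun z => φ z * (fderiv ℂ F z (0, 1) / F z))
      (δ := δ) hε (fun x hx y hy => by
        have hz := hmem x hx y (sphere_subset_closedBall hy)
        refine (hφ _ hz).mul (AnalyticAt.div ?_ (hF _ hz) (hFs x hx y hy))
        exact ((ContinuousLinearMap.apply ℂ ℂ ((0, 1) : ℂ × ℂ)).analyticAt _).comp (hF _ hz).fderiv)
    refine h1.congr fun x hx => circleIntegral.integral_congr hε.le fun y hy => ?_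
    have hz := hmem x hx y (sphere_subset_closedBall hy)
    have h2 : HasDerivAt (fun y : ℂ => (x, y)) (0, 1) y :=
      (hasDerivAt_const y x).prodMk (hasDerivAt_id y)
    have h3 := (hF _ hz).differentiableAt.hasFDerivAt.comp_hasDerivAt y h2
    simp only [logDeriv_apply]
    congr 2
    exact h3.deriv
  have hpi : (2 * Real.pi * Complex.I : ℂ) ≠ 0 := Complex.two_pi_I_ne_zero
  have hfac : ∀ x, x ∈ ball (0 : ℂ) δ → ∃ (n : ℕ) (a : Fin n → ℂ) (h : ℂ → ℂ),
      (∀ i, a i ∈ ball (0 : ℂ) ε) ∧ AnalyticOnNhd ℂ h (closedBall 0 ε) ∧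
      (∀ y ∈ closedBall (0 : ℂ) ε, h y ≠ 0) ∧ ∀ y, F (x, y) = (∏ i, (y - a i)) * h y :=
    fun x hx => AnalyticOnNhd.exists_eq_prod_mul hε (fun y hy => (hF _ (hmem x hx y hy)).slice)
      (hFs x hx)
  choose! n hn using hfac
  -- The integral for `φ = 1` counts the zeros, and a continuous integer-valued function on a disc
  -- is constant.
  have hcount : ContinuousOn n (ball (0 : ℂ) δ) := by
    rw [Nat.isClosedEmbedding_coe_real.isEmbedding.continuousOn_iff]
    have h1 := (hS (fun _ => 1) fun _ _ => analyticAt_const).continuousOn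
    have h2 : ContinuousOn (fun x => ((2 * Real.pi * Complex.I)⁻¹ *
      ∮ y in C(0, ε), 1 * logDeriv (fun y => F (x, y)) y).re) (ball 0 δ) :=
      Complex.continuous_re.comp_continuousOn (continuousOn_const.mul h1)
    refine h2.congr fun x hx => ?_
    obtain ⟨a, h, ha, hh, hh0, hg⟩ := hn x hx
    beta_reduce
    rw [circleIntegral_mul_logDeriv (φ := fun _ => 1) hε ha hh hh0 hg fun _ _ => analyticAt_const,
      inv_mul_cancel_left₀ hpi]
    simp
  have hconst : ∀ x ∈ ball (0 : ℂ) δ, n x = n 0 := fun x hx =>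
    (convex_ball (0 : ℂ) δ).isPreconnected.constant hcount hx
      (mem_ball_self (pos_of_mem_ball hx))
  have hfac : ∀ x, x ∈ ball (0 : ℂ) δ → ∃ (a : Fin (n 0) → ℂ) (h : ℂ → ℂ),
      (∀ i, a i ∈ ball (0 : ℂ) ε) ∧ AnalyticOnNhd ℂ h (closedBall 0 ε) ∧
      (∀ y ∈ closedBall (0 : ℂ) ε, h y ≠ 0) ∧ ∀ y, F (x, y) = (∏ i, (y - a i)) * h y :=
    fun x hx => hconst x hx ▸ hn x hx
  choose! a h hah using hfac
  refine ⟨n 0, a, h, hah, fun φ hφ => DifferentiableOn.prod_of_psum fun k => ?_⟩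
  -- The contour integrals of `φ ^ k` give the power sums of the values of `φ` at the roots.
  have h1 := (hS (fun z => φ z ^ k) fun z hz => (hφ z hz).pow k).const_mul
    (2 * Real.pi * Complex.I)⁻¹
  refine h1.congr fun x hx => ?_
  obtain ⟨ha, hh, hh0, hg⟩ := hah x hx
  rw [circleIntegral_mul_logDeriv (φ := fun y => φ (x, y) ^ k) hε ha hh hh0 hg
    fun y hy => (hφ _ (hmem x hx y hy)).slice.pow k, inv_mul_cancel_left₀ hpi]

/-- A Łojasiewicz inequality at an isolated common zero of holomorphic functions on `ℂ²`. -/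
theorem exists_mul_pow_norm_fst_le {ι : Type*} [Fintype ι] {f : ι → ℂ × ℂ → ℂ}
    (hf : ∀ e, AnalyticAt ℂ (f e) 0)
    (hiso : ∀ᶠ z in 𝓝 (0 : ℂ × ℂ), (∀ e, f e z = 0) → z = 0) {e₀ : ι}
    (he₀ : ∀ᶠ y in 𝓝[≠] (0 : ℂ), f e₀ (0, y) ≠ 0) :
    ∃ (L : ℕ) (c : ℝ), 0 < c ∧
      ∀ᶠ z in 𝓝 (0 : ℂ × ℂ), ∀ η, (∀ e, ‖f e z‖ ≤ η) → c * ‖z.1‖ ^ L ≤ η := by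
  have hev : ∀ᶠ z in 𝓝 (0 : ℂ × ℂ), (∀ e, AnalyticAt ℂ (f e) z) ∧ ((∀ e, f e z = 0) → z = 0) :=
    (Filter.eventually_all.2 fun e => (hf e).eventually_analyticAt).and hiso
  obtain ⟨ε₁, hε₁, hball₁⟩ := Metric.nhds_basis_closedBall.eventually_iff.1 hev
  obtain ⟨ε₂, hε₂, hball₂⟩ := Metric.nhds_basis_closedBall.eventually_iff.1
    (eventually_nhdsWithin_iff.1 he₀)
  obtain ⟨ε, hε, hball, hline⟩ : ∃ ε > 0, (∀ z ∈ closedBall (0 : ℂ × ℂ) ε,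
      (∀ e, AnalyticAt ℂ (f e) z) ∧ ((∀ e, f e z = 0) → z = 0)) ∧
      ∀ y ∈ sphere (0 : ℂ) ε, f e₀ (0, y) ≠ 0 := by
    have hm : 0 < min ε₁ ε₂ := lt_min hε₁ hε₂
    refine ⟨_, hm, fun z hz => hball₁ (closedBall_subset_closedBall (min_le_left _ _) hz),
      fun y hy => hball₂ (closedBall_subset_closedBall (min_le_right _ _)
        (sphere_subset_closedBall hy)) ?_⟩
    rintro rfl
    simp at hy
    exact hm.ne hy
  have hmem : ∀ x ∈ closedBall (0 : ℂ) ε, ∀ y ∈ closedBall (0 : ℂ) ε,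
      (x, y) ∈ closedBall (0 : ℂ × ℂ) ε := by
    intro x hx y hy
    rw [mem_closedBall_zero_iff, Prod.norm_mk]
    exact max_le (mem_closedBall_zero_iff.1 hx) (mem_closedBall_zero_iff.1 hy)
  have h0ε : (0 : ℂ) ∈ closedBall (0 : ℂ) ε := mem_closedBall_self hε.le
  -- Compactness of the circle keeps the zeros of `f e₀ (x, ·)` off it for small `x`.
  have htube : ∀ᶠ x in 𝓝 (0 : ℂ), ∀ y ∈ sphere (0 : ℂ) ε, f e₀ (x, y) ≠ 0 := by
    refine (isCompact_sphere (0 : ℂ) ε).eventually_forall_of_forall_eventually fun y hy => ?_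
    exact ((hball _ (hmem 0 h0ε y (sphere_subset_closedBall hy))).1 e₀).continuousAt.eventually_ne
      (hline y hy)
  obtain ⟨δ₁, hδ₁, htube⟩ := Metric.nhds_basis_closedBall.eventually_iff.1 htube
  obtain ⟨δ, hδ, hδε, hδs⟩ : ∃ δ > 0, δ ≤ ε ∧ ∀ x ∈ closedBall (0 : ℂ) δ, ∀ y ∈ sphere (0 : ℂ) ε,
      f e₀ (x, y) ≠ 0 :=
    ⟨min δ₁ ε, lt_min hδ₁ hε, min_le_right _ _,
      fun x hx => htube (closedBall_subset_closedBall (min_le_left _ _) hx)⟩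
  have hδc : ∀ x ∈ ball (0 : ℂ) δ, x ∈ closedBall (0 : ℂ) ε := fun x hx =>
    closedBall_subset_closedBall hδε (ball_subset_closedBall hx)
  obtain ⟨n, a, h, hah, hR⟩ := exists_roots hε hδε (fun z hz => (hball z hz).1 e₀)
    (fun x hx => hδs x (ball_subset_closedBall hx))
  obtain ⟨x₀, hx₀, hx₀0⟩ : ∃ x₀ ∈ ball (0 : ℂ) δ, x₀ ≠ 0 := by
    refine ⟨((δ / 2 : ℝ) : ℂ), ?_, ?_⟩
    · rw [mem_ball_zero_iff, Complex.norm_real, Real.norm_of_nonneg (by positivity)]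
      exact half_lt_self hδ
    · exact_mod_cast (half_pos hδ).ne'
  -- Over a fixed `x₀ ≠ 0` no root of `f e₀` is a common zero, so a suitable combination `φ` of the
  -- `f e` is nonzero at all of them.
  obtain ⟨c, hc⟩ := exists_forall_sum_mul_ne_zero (fun i e => f e (x₀, a x₀ i)) (by
    intro i
    by_contra! h0
    have := (hball _ (hmem x₀ (hδc _ hx₀) _ (ball_subset_closedBall ((hah x₀ hx₀).1 i)))).2 h0
    exact hx₀0 (congrArg Prod.fst this))
  set φ : ℂ × ℂ → ℂ := fun z => ∑ e, c e * f e z with hφdef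
  have hφ : ∀ z ∈ closedBall (0 : ℂ × ℂ) ε, AnalyticAt ℂ φ z := fun z hz =>
    Finset.univ.analyticAt_fun_sum fun e _ => analyticAt_const.mul ((hball z hz).1 e)
  have hRd := hR φ hφ
  -- `R` plays the role of a resultant of `f e₀` and `φ`. It is holomorphic and nonzero at `x₀`, so
  -- it vanishes to a finite order `L` at `0`.
  set R : ℂ → ℂ := fun x => ∏ i, φ (x, a x i) with hRdef
  have hRan : AnalyticOnNhd ℂ R (ball 0 δ) := hRd.analyticOnNhd isOpen_ball
  have h0δ : (0 : ℂ) ∈ ball (0 : ℂ) δ := mem_ball_self hδ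
  have hR0 : ¬ ∀ᶠ x in 𝓝 (0 : ℂ), R x = 0 := by
    intro h0
    have := hRan.eqOn_zero_of_preconnected_of_eventuallyEq_zero (convex_ball 0 δ).isPreconnected
      h0δ h0 hx₀
    exact Finset.prod_ne_zero_iff.2 (fun i _ => hc i) this
  obtain ⟨L, g, hg, hg0, hRg⟩ := (hRan 0 h0δ).exists_eventuallyEq_pow_smul_nonzero_iff.2 hR0
  have hglow : ∀ᶠ x in 𝓝 (0 : ℂ), ‖g 0‖ / 2 < ‖g x‖ :=
    hg.continuousAt.norm.eventually_const_lt (half_lt_self (norm_pos_iff.2 hg0))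
  have hKc : IsCompact (closedBall (0 : ℂ × ℂ) ε) := isCompact_closedBall _ _
  obtain ⟨M₀, hM₀⟩ := hKc.exists_bound_of_continuousOn (f := φ)
    fun z hz => (hφ z hz).continuousAt.continuousWithinAt
  obtain ⟨B, hB⟩ := hKc.exists_bound_of_continuousOn (f := fderiv ℂ φ)
    fun z hz => (hφ z hz).fderiv.continuousAt.continuousWithinAt
  have hB0 : 0 ≤ B := (norm_nonneg _).trans (hB 0 (mem_closedBall_self hε.le))
  have hM₀0 : 0 ≤ M₀ := (norm_nonneg _).trans (hM₀ 0 (mem_closedBall_self hε.le))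
  obtain ⟨b₀, hb₀, hb₀F⟩ : ∃ b₀ > 0, ∀ x ∈ closedBall (0 : ℂ) δ, ∀ y ∈ sphere (0 : ℂ) ε,
      b₀ ≤ ‖f e₀ (x, y)‖ := by
    have hK : IsCompact (closedBall (0 : ℂ) δ ×ˢ sphere (0 : ℂ) ε) :=
      (isCompact_closedBall _ _).prod (isCompact_sphere _ _)
    obtain ⟨b₀, hb₀, hb⟩ := hK.exists_forall_le' (f := fun z => ‖f e₀ z‖) (a := 0) (by
      rintro ⟨x, y⟩ ⟨hx, hy⟩
      exact ((hball _ (hmem x (closedBall_subset_closedBall hδε hx) y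
        (sphere_subset_closedBall hy))).1 e₀).continuousAt.norm.continuousWithinAt) (by
      rintro ⟨x, y⟩ ⟨hx, hy⟩
      exact norm_pos_iff.2 (hδs x hx y hy))
    exact ⟨b₀, hb₀, fun x hx y hy => hb (x, y) ⟨hx, hy⟩⟩
  obtain ⟨C, hC, hprod⟩ := exists_prod_le_mul_add_prod n (M := max M₀ (2 * ε)) (B := B)
    (le_max_of_le_left hM₀0) hB0
  have hdist : ∀ x ∈ ball (0 : ℂ) δ, ∀ y ∈ closedBall (0 : ℂ) ε, ∀ i, ‖y - a x i‖ ≤ 2 * ε := by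
    intro x hx y hy i
    have h1 := mem_ball_zero_iff.1 ((hah x hx).1 i)
    have h2 := mem_closedBall_zero_iff.1 hy
    linarith [norm_sub_le y (a x i)]
  -- On the circle `‖f e₀‖ ≥ b₀` and each of the `n` distances to the roots is at most `2 * ε`; the
  -- minimum principle carries the resulting bound for the zero-free factor `h` inside.
  set b := b₀ / (2 * ε) ^ n with hbdef
  have hb : 0 < b := by positivity
  have hhlow : ∀ x ∈ ball (0 : ℂ) δ, ∀ y ∈ ball (0 : ℂ) ε, b ≤ ‖h x y‖ := by
    intro x hx y hy
    obtain ⟨ha, hh, hh0, hFx⟩ := hah x hx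
    refine le_norm_of_le_norm_sphere hε hb hh hh0 (fun y hy => ?_) hy
    have h1 := hb₀F x (ball_subset_closedBall hx) y hy
    rw [hFx, norm_mul, norm_prod] at h1
    rw [hbdef, div_le_iff₀ (by positivity), mul_comm]
    refine h1.trans (mul_le_mul_of_nonneg_right ?_ (norm_nonneg _))
    refine (Finset.prod_le_prod (fun i _ => norm_nonneg _) fun i _ =>
      hdist x hx y (sphere_subset_closedBall hy) i).trans (by simp)
  -- `‖φ‖` at a root exceeds `‖φ (x, y)‖` by at most `B` times the distance to `y`, and the product
  -- of these distances is bounded through `f e₀`. Hence `R x = O(η)`.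
  have hupper : ∀ x ∈ ball (0 : ℂ) δ, ∀ y ∈ ball (0 : ℂ) ε, ∀ η, (∀ e, ‖f e (x, y)‖ ≤ η) →
      ‖R x‖ ≤ C * ((∑ e, ‖c e‖) * η + b⁻¹ * η) := by
    intro x hx y hy η hη
    obtain ⟨ha, hh, hh0, hFx⟩ := hah x hx
    have hη0 : 0 ≤ η := (norm_nonneg _).trans (hη e₀)
    have hyc := ball_subset_closedBall hy
    have hz := hmem x (hδc x hx) y hyc
    have hza : ∀ i, (x, a x i) ∈ closedBall (0 : ℂ × ℂ) ε := fun i =>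
      hmem x (hδc x hx) _ (ball_subset_closedBall (ha i))
    have h1 : ‖φ (x, y)‖ ≤ (∑ e, ‖c e‖) * η := by
      rw [Finset.sum_mul]
      refine (norm_sum_le _ _).trans (Finset.sum_le_sum fun e _ => ?_)
      rw [norm_mul]
      exact mul_le_mul_of_nonneg_left (hη e) (norm_nonneg _)
    have h2 : ∏ i, ‖y - a x i‖ ≤ b⁻¹ * η := by
      have h3 := hη e₀
      rw [hFx, norm_mul, norm_prod] at h3
      rw [inv_mul_eq_div, le_div_iff₀ hb]
      exact (mul_le_mul_of_nonneg_left (hhlow x hx y hy)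
        (Finset.prod_nonneg fun i _ => norm_nonneg _)).trans h3
    rw [hRdef]
    simp only
    rw [norm_prod]
    refine (hprod ‖φ (x, y)‖ _ (fun i => ‖y - a x i‖) (norm_nonneg _) (fun i => norm_nonneg _)
      (fun i => (hM₀ _ (hza i)).trans (le_max_left _ _)) (fun i => norm_nonneg _)
      (fun i => (hdist x hx y hyc i).trans (le_max_right _ _)) fun i => ?_).trans
      (mul_le_mul_of_nonneg_left (add_le_add h1 h2) hC)
    have h4 := (convex_closedBall (0 : ℂ × ℂ) ε).norm_image_sub_le_of_norm_fderiv_le (𝕜 := ℂ)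
      (fun z hz => (hφ z hz).differentiableAt) hB hz (hza i)
    have h5 : ‖(x, a x i) - (x, y)‖ = ‖y - a x i‖ := by
      rw [Prod.mk_sub_mk, sub_self, Prod.norm_mk, norm_zero, norm_sub_rev]
      exact max_eq_right (norm_nonneg _)
    rw [h5] at h4
    have h6 := norm_sub_norm_le (φ (x, a x i)) (φ (x, y))
    linarith
  set C' := C * ((∑ e, ‖c e‖) + b⁻¹) with hC'
  have hC'0 : 0 ≤ C' := by positivity
  refine ⟨L, ‖g 0‖ / 2 / (C' + 1), by positivity, ?_⟩
  have hfst : Filter.Tendsto (Prod.fst : ℂ × ℂ → ℂ) (𝓝 0) (𝓝 0) := continuous_fst.tendsto 0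
  have hsnd : Filter.Tendsto (Prod.snd : ℂ × ℂ → ℂ) (𝓝 0) (𝓝 0) := continuous_snd.tendsto 0
  filter_upwards [hfst.eventually hRg, hfst.eventually hglow, hfst.eventually (ball_mem_nhds 0 hδ),
    hsnd.eventually (ball_mem_nhds 0 hε)] with z h1 h2 h3 h4 η hη
  have hη0 : 0 ≤ η := (norm_nonneg _).trans (hη e₀)
  have h5 := hupper z.1 h3 z.2 h4 η hη
  rw [h1, sub_zero, norm_smul, norm_pow] at h5
  rw [div_mul_eq_mul_div, div_le_iff₀ (by positivity)]
  have h6 : ‖g 0‖ / 2 * ‖z.1‖ ^ L ≤ ‖z.1‖ ^ L * ‖g z.1‖ := by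
    rw [mul_comm]
    exact mul_le_mul_of_nonneg_left h2.le (by positivity)
  have h7 : C * ((∑ e, ‖c e‖) * η + b⁻¹ * η) = C' * η := by rw [hC']; ring
  linarith

end TwoVariables

end

noncomputable section

/-! ### Codimension two excludes a common divisor of the minors -/

section Codimension

open Metric

theorem eq_zero_of_isBigO_norm_sub {E : Type*} [NormedAddCommGroup E] {f : E → ℂ} {p : E}
    (h : f =O[𝓝 p] fun z => ‖z - p‖ ^ 1) : f p = 0 := by
  obtain ⟨C, hC⟩ := h.bound
  have := hC.self_of_nhds
  simpa using this

/-- Holomorphic functions on `ℂ²` with an isolated common zero have no common divisor vanishing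
at that point, not even up to arbitrarily high order. -/
theorem not_forall_exists_isBigO_sub_mul {ι : Type*} [Fintype ι] {f : ι → ℂ × ℂ → ℂ}
    (hf : ∀ e, AnalyticAt ℂ (f e) 0)
    (hiso : ∀ᶠ z in 𝓝 (0 : ℂ × ℂ), (∀ e, f e z = 0) → z = 0) :
    ¬ ∀ K : ℕ, ∃ (D : ℂ × ℂ → ℂ) (G : ι → ℂ × ℂ → ℂ), ContDiff ℂ 1 D ∧ (∀ e, Continuous (G e)) ∧
      D 0 = 0 ∧ ∀ e, (fun z => f e z - D z * G e z) =O[𝓝 0] fun z => ‖z‖ ^ K := by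
  intro h
  have hf0 : ∀ e, f e 0 = 0 := by
    obtain ⟨D, G, -, -, hD0, hO⟩ := h 1
    intro e
    have h1 := eq_zero_of_isBigO_norm_sub (p := (0 : ℂ × ℂ)) (by simpa using hO e)
    simpa [hD0] using h1
  -- If all `f e` vanished along the line `x = 0`, the origin would not be an isolated common zero.
  obtain ⟨e₀, he₀⟩ : ∃ e₀, ∀ᶠ y in 𝓝[≠] (0 : ℂ), f e₀ (0, y) ≠ 0 := by
    by_contra hno
    have h1 : ∀ᶠ y in 𝓝 (0 : ℂ), ∀ e, f e (0, y) = 0 := by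
      refine Filter.eventually_all.2 fun e => ?_
      exact ((hf e).slice.eventually_eq_zero_or_eventually_ne_zero).resolve_right
        fun h => hno ⟨e, h⟩
    have ht : Filter.Tendsto (fun y : ℂ => ((0 : ℂ), y)) (𝓝 0) (𝓝 0) :=
      (Continuous.prodMk_right (0 : ℂ)).tendsto 0
    have h2 : ∀ᶠ y in 𝓝[≠] (0 : ℂ), False := by
      filter_upwards [nhdsWithin_le_nhds h1, nhdsWithin_le_nhds (ht.eventually hiso),
        self_mem_nhdsWithin] with y hy1 hy2 hy3
      exact hy3 (congrArg Prod.snd (hy2 hy1))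
    exact h2.exists.choose_spec
  obtain ⟨L, c, hc, hL⟩ := exists_mul_pow_norm_fst_le hf hiso he₀
  have hu : AnalyticAt ℂ (fun y => f e₀ (0, y)) 0 := (hf e₀).slice
  obtain ⟨m, q, hq, hq0, huq⟩ := hu.exists_eventuallyEq_pow_smul_nonzero_iff.2 fun h0 =>
    (he₀.and (nhdsWithin_le_nhds h0)).exists.elim fun y hy => hy.1 hy.2
  have hm : m ≠ 0 := by
    rintro rfl
    apply hq0
    have := huq.self_of_nhds
    rw [pow_zero, one_smul] at this
    exact this.symm.trans (hf0 e₀)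
  set q₁ := ‖q 0‖ / 2 with hq₁
  have hq₁0 : 0 < q₁ := half_pos (norm_pos_iff.2 hq0)
  have hqlow : ∀ᶠ y in 𝓝 (0 : ℂ), q₁ < ‖q y‖ :=
    hq.continuousAt.norm.eventually_const_lt (half_lt_self (norm_pos_iff.2 hq0))
  -- At the point found below `‖x‖ = s ^ m`, so the Łojasiewicz bound is `c * s ^ (m * L)`. The
  -- surplus `m + 1` makes the error negligible against it; `K > m` also makes it negligible against
  -- the leading term of `f e₀ (0, y)`.
  set K := m * L + m + 1 with hK
  obtain ⟨D, G, hD, hG, hD0, hO⟩ := h K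
  choose C hC using fun e => (hO e).bound
  set C₁ := ∑ e, |C e| with hC₁
  have hC₁0 : 0 ≤ C₁ := Finset.sum_nonneg fun e _ => abs_nonneg _
  have hCC₁ : ∀ᶠ z in 𝓝 (0 : ℂ × ℂ), ∀ e, ‖f e z - D z * G e z‖ ≤ C₁ * ‖z‖ ^ K := by
    refine Filter.eventually_all.2 fun e => (hC e).mono fun z hz => hz.trans ?_
    rw [norm_pow, norm_norm]
    exact mul_le_mul_of_nonneg_right ((le_abs_self _).trans
      (Finset.single_le_sum (f := fun e => |C e|) (fun e _ => abs_nonneg _) (Finset.mem_univ e)))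
      (by positivity)
  set g₁ := ‖G e₀ 0‖ + 1 with hg₁
  have hg₁0 : 0 < g₁ := by positivity
  have hGup : ∀ᶠ z in 𝓝 (0 : ℂ × ℂ), ‖G e₀ z‖ < g₁ :=
    (hG e₀).continuousAt.norm.eventually_lt_const (lt_add_one _)
  obtain ⟨B, t, ht, hB⟩ := hD.contDiffAt.exists_lipschitzOnWith (x := (0 : ℂ × ℂ))
  have hsmall : ∀ᶠ y in 𝓝 (0 : ℂ), C₁ * ‖y‖ < q₁ / 2 ∧ ‖y‖ < 1 := by
    have h1 : Filter.Tendsto (fun y : ℂ => C₁ * ‖y‖) (𝓝 0) (𝓝 0) :=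
      Continuous.tendsto' (by fun_prop) _ _ (by simp)
    have h2 : Filter.Tendsto (fun y : ℂ => ‖y‖) (𝓝 0) (𝓝 0) :=
      Continuous.tendsto' (by fun_prop) _ _ (by simp)
    exact (h1.eventually_lt_const (half_pos hq₁0)).and (h2.eventually_lt_const one_pos)
  obtain ⟨r₁, hr₁, hball₁⟩ := Metric.eventually_nhds_iff_ball.1
    (hCC₁.and (hGup.and (hL.and (Filter.eventually_mem_set.2 ht))))
  obtain ⟨r₂, hr₂, hball₂⟩ := Metric.eventually_nhds_iff_ball.1 (huq.and (hqlow.and hsmall))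
  set d := q₁ / 2 / g₁ with hd
  have hd0 : 0 < d := by positivity
  -- On `x = 0` the function `f e₀` has exact order `m` and `G e₀` is bounded, so `D` vanishes to
  -- order at most `m`.
  have hDlow : ∀ y : ℂ, ‖y‖ < min r₁ r₂ → d * ‖y‖ ^ m ≤ ‖D (0, y)‖ := by
    intro y hy
    have hn : ‖((0 : ℂ), y)‖ = ‖y‖ := by
      rw [Prod.norm_mk, norm_zero]
      exact max_eq_right (norm_nonneg _)
    obtain ⟨h1, h2, -⟩ := hball₁ (0, y) (by
      rw [mem_ball_zero_iff, hn]
      exact hy.trans_le (min_le_left _ _))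
    obtain ⟨h3, h4, h5, h6⟩ := hball₂ y (by
      rw [mem_ball_zero_iff]
      exact hy.trans_le (min_le_right _ _))
    have h7 := h1 e₀
    rw [hn, h3, sub_zero, norm_sub_rev] at h7
    have h8 : ‖y‖ ^ m * ‖q y‖ ≤ ‖D (0, y)‖ * g₁ + C₁ * ‖y‖ ^ K := by
      have h9 := norm_sub_norm_le (y ^ m • q y) (D (0, y) * G e₀ (0, y))
      rw [norm_sub_rev, norm_smul, norm_pow, norm_mul] at h9
      have h10 : ‖D (0, y)‖ * ‖G e₀ (0, y)‖ ≤ ‖D (0, y)‖ * g₁ :=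
        mul_le_mul_of_nonneg_left h2.le (norm_nonneg _)
      linarith
    have h11 : C₁ * ‖y‖ ^ K ≤ q₁ / 2 * ‖y‖ ^ m := by
      have h12 : ‖y‖ ^ K ≤ ‖y‖ ^ (1 + m) :=
        pow_le_pow_of_le_one (norm_nonneg _) h6.le (by rw [hK]; lia)
      calc C₁ * ‖y‖ ^ K ≤ C₁ * ‖y‖ ^ (1 + m) := mul_le_mul_of_nonneg_left h12 hC₁0
        _ = C₁ * ‖y‖ * ‖y‖ ^ m := by ring
        _ ≤ q₁ / 2 * ‖y‖ ^ m := mul_le_mul_of_nonneg_right h5.le (by positivity)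
    have h13 : q₁ * ‖y‖ ^ m ≤ ‖y‖ ^ m * ‖q y‖ := by
      rw [mul_comm]
      exact mul_le_mul_of_nonneg_left h4.le (by positivity)
    rw [hd, div_mul_eq_mul_div, div_le_iff₀ hg₁0]
    linarith
  -- With this `A`, `‖D (0, y)‖ ≥ (2 * B + 1) * s ^ m` on the circle `‖y‖ = A * s`, whereas moving
  -- from `0` to `x` changes `D` by at most `B * s ^ m`.
  obtain ⟨A, hA1, hA⟩ : ∃ A : ℝ, 1 ≤ A ∧ 2 * B + 1 ≤ d * A ^ m := by
    refine ⟨max 1 ((2 * B + 1) / d), le_max_left _ _, ?_⟩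
    have h1 : (2 * B + 1) / d ≤ (max 1 ((2 * B + 1) / d)) ^ m :=
      (le_max_right _ _).trans (le_self_pow₀ (le_max_left _ _) hm)
    rw [mul_comm d]
    exact (div_le_iff₀ hd0).1 h1
  have hA0 : 0 < A := zero_lt_one.trans_le hA1
  obtain ⟨s, hs0, hs1, hsA, hsc⟩ : ∃ s : ℝ, 0 < s ∧ s < 1 ∧ A * s < min r₁ r₂ ∧
      C₁ * A ^ K * s < c := by
    have h1 : Filter.Tendsto (fun s : ℝ => A * s) (𝓝 0) (𝓝 0) :=
      Continuous.tendsto' (by fun_prop) _ _ (by simp)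
    have h2 : Filter.Tendsto (fun s : ℝ => C₁ * A ^ K * s) (𝓝 0) (𝓝 0) :=
      Continuous.tendsto' (by fun_prop) _ _ (by simp)
    have h3 : ∀ᶠ s in 𝓝[>] (0 : ℝ), 0 < s ∧ s < 1 ∧ A * s < min r₁ r₂ ∧ C₁ * A ^ K * s < c := by
      filter_upwards [self_mem_nhdsWithin, nhdsWithin_le_nhds (eventually_lt_nhds one_pos),
        nhdsWithin_le_nhds (h1.eventually_lt_const (lt_min hr₁ hr₂)),
        nhdsWithin_le_nhds (h2.eventually_lt_const hc)] with s h1 h2 h3 h4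
      exact ⟨h1, h2, h3, h4⟩
    exact h3.exists
  set x : ℂ := ((s ^ m : ℝ) : ℂ) with hx
  have hxn : ‖x‖ = s ^ m := by rw [hx, Complex.norm_real, Real.norm_of_nonneg (by positivity)]
  have hsm : s ^ m ≤ A * s := (pow_le_of_le_one hs0.le hs1.le hm).trans
    (le_mul_of_one_le_left hs0.le hA1)
  have hzn : ∀ y : ℂ, ‖y‖ ≤ A * s → ‖(x, y)‖ ≤ A * s := by
    intro y hy
    rw [Prod.norm_mk, hxn]
    exact max_le hsm hy
  have hmem : ∀ z : ℂ × ℂ, ‖z‖ ≤ A * s → z ∈ ball (0 : ℂ × ℂ) r₁ := by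
    intro z hz
    rw [mem_ball_zero_iff]
    exact hz.trans_lt (hsA.trans_le (min_le_left _ _))
  have hlip : ∀ y : ℂ, ‖y‖ ≤ A * s → ‖D (x, y) - D (0, y)‖ ≤ B * s ^ m := by
    intro y hy
    have h1 := hB.norm_sub_le (hball₁ _ (hmem _ (hzn y hy))).2.2.2
      (hball₁ (0, y) (hmem _ (by
        rw [Prod.norm_mk, norm_zero]
        exact max_le (by positivity) hy))).2.2.2
    rwa [Prod.mk_sub_mk, sub_self, sub_zero, Prod.norm_mk, norm_zero, max_eq_left (norm_nonneg _),
      hxn] at h1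
  -- `‖D (x, ·)‖` is at most `B * s ^ m` at the centre and at least `(B + 1) * s ^ m` on the circle.
  obtain ⟨y, hy, hDy⟩ := exists_zero_of_lt_norm_sphere (g := fun y => D (x, y)) (r := A * s)
    (b := (B + 1) * s ^ m) ((hD.differentiable one_ne_zero).comp
      (differentiable_const x |>.prodMk differentiable_id)) (by positivity) (by
      have h1 := hlip 0 (by simp; positivity)
      rw [show ((0 : ℂ), (0 : ℂ)) = 0 from rfl, hD0, sub_zero] at h1
      refine h1.trans_lt ?_
      have : 0 < s ^ m := by positivity
      nlinarith) (by
      intro y hy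
      have hyn : ‖y‖ = A * s := mem_sphere_zero_iff_norm.1 hy
      have h1 := hlip y hyn.le
      have h2 := hDlow y (hyn ▸ hsA)
      rw [hyn, mul_pow, ← mul_assoc] at h2
      have h3 := norm_sub_norm_le (D (0, y)) (D (x, y))
      rw [norm_sub_rev] at h3
      have h4 : (2 * B + 1) * s ^ m ≤ d * A ^ m * s ^ m :=
        mul_le_mul_of_nonneg_right hA (by positivity)
      nlinarith)
  have hyn := (mem_ball_zero_iff.1 hy).le
  obtain ⟨h1, -, h2, -⟩ := hball₁ _ (hmem _ (hzn y hyn))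
  -- At a zero of `D` only the error terms of the `f e` remain, which is too small for the
  -- Łojasiewicz inequality.
  have h3 := h2 (C₁ * (A * s) ^ K) fun e => by
    have h4 := h1 e
    rw [show D (x, y) = 0 from hDy, zero_mul, sub_zero] at h4
    exact h4.trans (mul_le_mul_of_nonneg_left
      (pow_le_pow_left₀ (norm_nonneg _) (hzn y hyn) K) hC₁0)
  rw [hxn, ← pow_mul] at h3
  have h5 : C₁ * (A * s) ^ K = C₁ * A ^ K * s * s ^ m * s ^ (m * L) := by
    rw [mul_pow, hK]
    ring
  rw [h5] at h3
  have h6 := le_of_mul_le_mul_right h3 (by positivity)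
  have h7 : C₁ * A ^ K * s * s ^ m ≤ C₁ * A ^ K * s :=
    mul_le_of_le_one_right (by positivity) (pow_le_one₀ hs0.le hs1.le)
  linarith

theorem analyticAt_minor {m k : ℕ} {H : (Fin m → ℂ) → Fin k → ℂ} {p : Fin m → ℂ}
    (hH : AnalyticAt ℂ H p) (e : Fin m → Fin k) :
    AnalyticAt ℂ (fun z => ((jacobianMatrix H z).submatrix e id).det) p := by
  simp only [Matrix.det_apply']
  refine Finset.analyticAt_fun_sum _ fun τ _ => analyticAt_const.mul
    (Finset.analyticAt_fun_prod _ fun i _ => ?_)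
  have h1 := ((ContinuousLinearMap.apply ℂ (Fin k → ℂ)
    (Pi.single i 1 : Fin m → ℂ)).analyticAt (fderiv ℂ H p)).comp hH.fderiv
  exact ((ContinuousLinearMap.proj (R := ℂ) (φ := fun _ : Fin k => ℂ) (e (τ i))).analyticAt _).comp h1

theorem exists_minor_ne_zero {m k : ℕ} {H : (Fin m → ℂ) → Fin k → ℂ} {z : Fin m → ℂ}
    (hz : z ∉ degeneracyLocus H) :
    ∃ e : Fin m ↪o Fin k, ((jacobianMatrix H z).submatrix e id).det ≠ 0 :=
  Matrix.exists_orderEmb_det_ne_zero (not_lt.1 hz)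

/-- If the degeneracy locus has codimension at least two, then the maximal minors of the Jacobian
matrix have no common nonunit divisor, not even up to arbitrarily high order. -/
theorem GermCodimAtLeast.not_forall_exists_isBigO {m k : ℕ} {H : (Fin m → ℂ) → Fin k → ℂ}
    {p : Fin m → ℂ} (hH : AnalyticAt ℂ H p) (h : GermCodimAtLeast (degeneracyLocus H) p 2) :
    ¬ ∀ K : ℕ, ∃ (D : MvPolynomial (Fin m) ℂ) (G : (Fin m ↪o Fin k) → MvPolynomial (Fin m) ℂ),
      MvPolynomial.eval 0 D = 0 ∧ ∀ e : Fin m ↪o Fin k,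
        (fun z => ((jacobianMatrix H z).submatrix e id).det -
          MvPolynomial.eval (z - p) D * MvPolynomial.eval (z - p) (G e)) =O[𝓝 p]
            fun z => ‖z - p‖ ^ K := by
  intro hdiv
  rcases h with h | ⟨L, hL, hLp⟩
  -- For the empty germ some minor is nonzero at `p`, and order `K = 1` already gives a
  -- contradiction.
  · obtain ⟨e, he⟩ := exists_minor_ne_zero h.self_of_nhds
    obtain ⟨D, G, hD, hO⟩ := hdiv 1
    have := eq_zero_of_isBigO_norm_sub (hO e)
    rw [sub_self, hD, zero_mul, sub_zero] at this
    exact he this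
  let b := Module.finBasisOfFinrankEq ℂ L hL
  -- An injective parametrization of the plane `L`; pulled back along it, the minors have no common
  -- zero near the origin except possibly the origin itself.
  let ℓ : ℂ × ℂ →L[ℂ] (Fin m → ℂ) :=
    (ContinuousLinearMap.fst ℂ ℂ ℂ).smulRight (b 0 : Fin m → ℂ) +
      (ContinuousLinearMap.snd ℂ ℂ ℂ).smulRight (b 1 : Fin m → ℂ)
  have hℓ : ∀ z, ℓ z = z.1 • (b 0 : Fin m → ℂ) + z.2 • (b 1 : Fin m → ℂ) := fun z => rfl
  have hℓL : ∀ z, ℓ z ∈ L := fun z =>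
    L.add_mem (L.smul_mem _ (b 0).2) (L.smul_mem _ (b 1).2)
  have hℓ0 : ∀ z, ℓ z = 0 → z = 0 := by
    intro z hz
    have h1 := Fintype.linearIndependent_iff.1 b.linearIndependent ![z.1, z.2] (by
      ext1
      simpa [Fin.sum_univ_two, hℓ] using hz)
    exact Prod.ext (h1 0) (h1 1)
  have hψ : Filter.Tendsto (fun z => ℓ z + p) (𝓝 0) (𝓝 p) :=
    Continuous.tendsto' (by fun_prop) _ _ (by simp)
  refine not_forall_exists_isBigO_sub_mul (ι := Fin m ↪o Fin k)
    (f := fun e z => ((jacobianMatrix H (ℓ z + p)).submatrix e id).det) (fun e => ?_) ?_ fun K => ?_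
  · have h1 : AnalyticAt ℂ (fun z => ℓ z + p) 0 := (ℓ.analyticAt 0).add analyticAt_const
    exact AnalyticAt.comp (f := fun z => ℓ z + p)
      (by simpa using analyticAt_minor hH e) h1
  · filter_upwards [hψ.eventually hLp] with z hz hz0
    have h1 : ℓ z + p ∈ degeneracyLocus H := by
      by_contra hn
      obtain ⟨e, he⟩ := exists_minor_ne_zero hn
      exact he (hz0 e)
    have h2 := hz h1 (by rw [add_sub_cancel_right]; exact hℓL z)
    exact hℓ0 z (by simpa using h2)
  · obtain ⟨D, G, hD, hO⟩ := hdiv K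
    have hcd : ∀ P : MvPolynomial (Fin m) ℂ, ContDiff ℂ 1 fun z => MvPolynomial.eval (ℓ z) P := by
      intro P
      exact contDiffOn_univ.1 (AnalyticOnNhd.eval_continuousLinearMap ℓ P).contDiffOn_of_completeSpace
    refine ⟨fun z => MvPolynomial.eval (ℓ z) D, fun e z => MvPolynomial.eval (ℓ z) (G e), hcd D,
      fun e => (hcd (G e)).continuous, by simpa using hD, fun e => ?_⟩
    have h1 := (hO e).comp_tendsto hψ
    simp only [Function.comp_def, add_sub_cancel_right] at h1
    refine h1.trans ?_
    exact (ℓ.isBigO_id (𝓝 0)).norm_norm.pow K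

end Codimension

end

/-! ### The smooth and the formal version together -/

theorem theorem1 (n N : ℕ) :
    -- smooth hypersurfaces and a germ of a holomorphic map
    (∀ (M : Set (Fin (n + 1) → ℂ)) (M' : Set (Fin (N + 1) → ℂ))
        (p : Fin (n + 1) → ℂ) (p' : Fin (N + 1) → ℂ)
        (H : (Fin (n + 1) → ℂ) → (Fin (N + 1) → ℂ))
        (ρ' : (Fin (N + 1) → ℂ) → ℝ),
      IsSmoothRealHypersurface M → p ∈ M →
      IsSmoothRealHypersurface M' → p' ∈ M' →
      AnalyticAt ℂ H p → H p = p' →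
      (∀ᶠ z in 𝓝 p, z ∈ M → H z ∈ M') →
      IsLocalDefiningFunction M' p' ρ' →
      2 * (N : ℤ) - (leviRank ρ' p' : ℤ) ≤ 2 * (n : ℤ) - 2 →
      GermCodimAtLeast (degeneracyLocus H) p 2 →
      IsTransversalAt H p ρ') ∧
    -- formal hypersurfaces and a formal holomorphic map
    (∀ (ρ : MvPowerSeries (Fin (n + 1) ⊕ Fin (n + 1)) ℂ)
        (ρ' : MvPowerSeries (Fin (N + 1) ⊕ Fin (N + 1)) ℂ)
        (H : Fin (N + 1) → MvPowerSeries (Fin (n + 1)) ℂ),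
      IsFormalDefiningSeries ρ → IsFormalDefiningSeries ρ' →
      (∀ i, MvPowerSeries.constantCoeff (H i) = 0) →
      FormallyMapsInto H ρ ρ' →
      2 * (N : ℤ) - (formalLeviRank ρ' : ℤ) ≤ 2 * (n : ℤ) - 2 →
      (∃ e, formalMinor H e ≠ 0) →
      (∀ d : MvPowerSeries (Fin (n + 1)) ℂ,
        (∀ e, formalMinor H e ≠ 0 → d ∣ formalMinor H e) → IsUnit d) →
      IsFormallyTransversal H ρ') := by
  refine ⟨?_, fun ρ ρ' H hρ hρ' hH hmaps hr _ hd =>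
    isFormallyTransversal_of_minors_coprime hρ hρ' hH hmaps hr hd⟩
  rintro M M' p _ H ρ' hM hp - hp' hH rfl hmaps hρ' hr hW
  exact isTransversalAt_of_minors_coprime hM hp hp' hH hmaps hρ' hr
    (hW.not_forall_exists_isBigO hH)
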